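/- Notation. Let $P$ be a polynomial with real coefficients, $P(0)=0$, $P(1)=1$; let $0<\vartheta<1/2$, $A>0$, and for $T>2\pi$ put $y=T^{\vartheta}$, $\mathscr{L}=\log\frac{T}{2\pi}$, $\eta=\mathscr{L}^{A}$. Let $$b(k)=\mu(k)\,P\Big(\frac{\log (y/k)}{\log y}\Big)\quad(k\le y),\qquad B(s)=\sum_{k\le y}\frac{b(k)}{k^{s}},$$ and define $a_1(n),a_2(n)$ by the Dirichlet series (for $\mathrm{Re}\,s>1$) $$\frac{\zeta'}{\zeta}(s)\zeta'(s)=\sum_{n\ge1}\frac{a_1(n)}{n^{s}},\qquad \frac{\zeta'}{\zeta}(s)\zeta'(s)^2B(s)=\sum_{n\ge1}\frac{a_2(n)}{n^{s}}.$$ For a Dirichlet character $\psi$ modulo $q$ let $\tau(\psi)=\sum_{a\,(\mathrm{mod}\ q)}\psi(a)e^{2\pi i a/q}$, and for $d\mid kq$ let $$\delta(q,kq,d,\psi)=\sum_{l\mid (d,k)}\frac{\mu(d/l)}{\varphi(kq/l)}\,\overline{\psi}\Big(\frac{-k}{l}\Big)\psi\Big(\frac{d}{l}\Big)\mu\Big(\frac{k}{l}\Big).$$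 For $\nu=1,2$ let $$\mathcal{M}_{\nu,3}=\sum_{\eta<q\le y}\ \sum_{\substack{\psi\,(\mathrm{mod}\ q)\\ \psi\ \mathrm{primitive}}}\tau(\overline{\psi})\sum_{k\le y/q}\frac{b(kq)}{kq}\sum_{d\mid kq}\delta(q,kq,d,\psi)\sum_{m\le kqT/(2\pi d)}a_\nu(md)\psi(m).$$ Lemma 2. There is an absolute constant $C>0$ such that, unconditionally, for every fixed $\varepsilon>0$ and every fixed $P$ as above, $$\mathcal{M}_{\nu,3}\ll_{\varepsilon} y^{1/3}T^{5/6+\varepsilon}+\eta^{-1/2}\,T\mathscr{L}^{C}\qquad(\nu=1,2)$$ for all sufficiently large $T$. Here the implied constant and the lower bound for $T$ may depend on $\varepsilon$ and on the fixed polynomial $P$, but not on $A$ or $\vartheta$. -/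

import Mathlib

namespace SimpleZeros

noncomputable section

open Finset ArithmeticFunction

/-- The logarithmic parameter `log (T / 2π)`. -/
def logT (T : ℝ) : ℝ := Real.log (T / (2 * Real.pi))

/-- The mollifier coefficients `b(k) = μ(k) P(log(y/k) / log y)` for `1 ≤ k ≤ y`, and `0` for
`k > y`. -/
def mollifierCoeff (P : Polynomial ℝ) (y : ℝ) : ArithmeticFunction ℝ where
  toFun k := if (k : ℝ) ≤ y then
    (moebius k : ℝ) * P.eval (Real.log (y / k) / Real.log y) else 0
  map_zero' := by simp

/-- The mollifier `B(s) = ∑_{k ≤ y} b(k) k^{-s}`. -/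
def mollifier (P : Polynomial ℝ) (y : ℝ) (s : ℂ) : ℂ :=
  ∑ k ∈ Finset.Icc 1 ⌊y⌋₊, (mollifierCoeff P y k : ℂ) / (k : ℂ) ^ s

/-- The Dirichlet coefficients of `(ζ'/ζ)(s) ζ'(s)`, as a Dirichlet convolution; see
`hasSum_coeffOne`. -/
def coeffOne : ArithmeticFunction ℝ := vonMangoldt * log

/-- The Dirichlet coefficients of `(ζ'/ζ)(s) ζ'(s)² B(s)`, as a Dirichlet convolution; see
`hasSum_coeffTwo`. -/
def coeffTwo (P : Polynomial ℝ) (y : ℝ) : ArithmeticFunction ℝ :=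
  -(vonMangoldt * log * log * mollifierCoeff P y)

/-- The sum `∑_{a mod q} ψ(a) e(a/q)` attached to a Dirichlet character `ψ` modulo `q`;
see `charGaussSum_eq`. -/
def charGaussSum {q : ℕ} (ψ : DirichletCharacter ℂ q) : ℂ :=
  ∑ a ∈ Finset.range q, ψ (a : ZMod q) * Complex.exp (2 * Real.pi * Complex.I * a / q)

theorem finite_dirichletCharacter (q : ℕ) : Finite (DirichletCharacter ℂ q) := by
  have : Finite (ZMod q)ˣ := by
    rcases q with _ | q
    · exact inferInstanceAs (Finite ℤˣ)
    · infer_instance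
  infer_instance

/-- The finite set of primitive Dirichlet characters modulo `q`. -/
def primitiveCharacters (q : ℕ) : Finset (DirichletCharacter ℂ q) :=
  haveI := finite_dirichletCharacter q
  (Set.toFinite {ψ : DirichletCharacter ℂ q | ψ.IsPrimitive}).toFinset

/-- `δ(q, kq, d, ψ) = ∑_{l ∣ (d,k)} μ(d/l) / φ(kq/l) · ψ̄(-k/l) ψ(d/l) μ(k/l)`. All the
divisions of natural numbers here are exact. -/
def delta (q k d : ℕ) (ψ : DirichletCharacter ℂ q) : ℂ :=
  ∑ l ∈ (Nat.gcd d k).divisors,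
    (moebius (d / l) : ℂ) / (Nat.totient (k * q / l) : ℂ)
      * (star ψ) (-((k / l : ℕ) : ZMod q)) * ψ ((d / l : ℕ) : ZMod q) * (moebius (k / l) : ℂ)

/-- The sum over the moduli `η < q ≤ y`:
`∑_{η < q ≤ y} ∑*_{ψ mod q} τ(ψ̄) ∑_{k ≤ y/q} b(kq)/(kq) ∑_{d ∣ kq} δ(q,kq,d,ψ)
  ∑_{m ≤ kqT/(2πd)} a(md) ψ(m)`. -/
def sumLargeModuli (a b : ArithmeticFunction ℝ) (η y T : ℝ) : ℂ :=
  ∑ q ∈ Finset.Ioc ⌊η⌋₊ ⌊y⌋₊, ∑ ψ ∈ primitiveCharacters q, charGaussSum (star ψ) *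
    ∑ k ∈ Finset.Icc 1 ⌊y / q⌋₊, (b (k * q) : ℂ) / ((k * q : ℕ) : ℂ) *
      ∑ d ∈ (k * q).divisors, delta q k d ψ *
        ∑ m ∈ Finset.Icc 1 ⌊(k * q : ℝ) * T / (2 * Real.pi * d)⌋₊,
          (a (m * d) : ℂ) * ψ (m : ZMod q)

/-- The part `M_{1,3}` of the sum `M_1`, coming from the moduli `η < q ≤ y`. -/
def MOneThree (P : Polynomial ℝ) (η y T : ℝ) : ℂ :=
  sumLargeModuli coeffOne (mollifierCoeff P y) η y T

/-- The part `M_{2,3}` of the sum `M_2`, coming from the moduli `η < q ≤ y`. -/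
def MTwoThree (P : Polynomial ℝ) (η y T : ℝ) : ℂ :=
  sumLargeModuli (coeffTwo P y) (mollifierCoeff P y) η y T

/-! Checks that the definitions are the intended ones. -/

theorem mem_primitiveCharacters {q : ℕ} (ψ : DirichletCharacter ℂ q) :
    ψ ∈ primitiveCharacters q ↔ ψ.IsPrimitive := by
  simp [primitiveCharacters]

theorem charGaussSum_eq {q : ℕ} [NeZero q] (ψ : DirichletCharacter ℂ q) :
    charGaussSum ψ = gaussSum ψ ZMod.stdAddChar := by
  unfold charGaussSum gaussSum
  refine Finset.sum_bij' (fun a _ => (a : ZMod q)) (fun a _ => a.val) ?_ ?_ ?_ ?_ ?_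
  · intro a _; exact Finset.mem_univ _
  · intro a _; exact Finset.mem_range.2 (ZMod.val_lt a)
  · intro a ha; exact ZMod.val_cast_of_lt (Finset.mem_range.1 ha)
  · intro a _; exact ZMod.natCast_zmod_val a
  · intro a _
    have h := ZMod.stdAddChar_coe (N := q) (a : ℤ)
    push_cast at h
    rw [h]

theorem hasSum_mul {f g : ArithmeticFunction ℝ} {s u v : ℂ}
    (hf : LSeriesHasSum (fun n => (f n : ℂ)) s u) (hg : LSeriesHasSum (fun n => (g n : ℂ)) s v) :
    LSeriesHasSum (fun n => ((f * g) n : ℂ)) s (u * v) := by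
  have h := hf.convolution hg
  have e : LSeries.convolution (fun n => (f n : ℂ)) (fun n => (g n : ℂ))
      = fun n => ((f * g) n : ℂ) := by
    funext n
    simp [LSeries.convolution_def, ArithmeticFunction.mul_apply]
  rwa [e] at h

theorem hasSum_vonMangoldt {s : ℂ} (hs : 1 < s.re) :
    LSeriesHasSum (fun n => (vonMangoldt n : ℂ)) s (-deriv riemannZeta s / riemannZeta s) := by
  rw [← LSeries_vonMangoldt_eq_deriv_riemannZeta_div hs]
  exact (LSeriesSummable_vonMangoldt hs).LSeriesHasSum

theorem hasSum_log {s : ℂ} (hs : 1 < s.re) :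
    LSeriesHasSum (fun n => (log n : ℂ)) s (-deriv riemannZeta s) := by
  have h1 : LSeries.abscissaOfAbsConv 1 < s.re := by
    rw [LSeries.abscissaOfAbsConv_one]; exact_mod_cast hs
  have e : LSeries.logMul 1 = fun n => (log n : ℂ) := by
    funext n
    simp [LSeries.logMul, ArithmeticFunction.log_apply, Complex.natCast_log]
  have hd : deriv (LSeries 1) s = deriv riemannZeta s := by
    refine Filter.EventuallyEq.deriv_eq <| Filter.eventuallyEq_iff_exists_mem.mpr ?_
    exact ⟨{z | 1 < z.re}, (isOpen_lt continuous_const Complex.continuous_re).mem_nhds hs,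
      fun _ hz => LSeries_one_eq_riemannZeta hz⟩
  rw [← hd, LSeries_deriv h1, neg_neg, e, ← e]
  exact (LSeriesSummable_logMul_of_lt_re h1).LSeriesHasSum

theorem hasSum_mollifier (P : Polynomial ℝ) (y : ℝ) (s : ℂ) :
    LSeriesHasSum (fun n => (mollifierCoeff P y n : ℂ)) s (mollifier P y s) := by
  have h : HasSum (LSeries.term (fun n => (mollifierCoeff P y n : ℂ)) s)
      (∑ k ∈ Finset.Icc 1 ⌊y⌋₊, LSeries.term (fun n => (mollifierCoeff P y n : ℂ)) s k) := by
    refine hasSum_sum_of_ne_finset_zero fun n hn => ?_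
    rcases Nat.eq_zero_or_pos n with rfl | hpos
    · simp
    · have hy : ¬ (n : ℝ) ≤ y := fun hle => hn (Finset.mem_Icc.2 ⟨hpos, Nat.le_floor hle⟩)
      rw [LSeries.term_of_ne_zero hpos.ne']
      simp [mollifierCoeff, hy]
  have e : mollifier P y s = ∑ k ∈ Finset.Icc 1 ⌊y⌋₊,
      LSeries.term (fun n => (mollifierCoeff P y n : ℂ)) s k := by
    refine Finset.sum_congr rfl fun k hk => ?_
    rw [LSeries.term_of_ne_zero (Nat.one_le_iff_ne_zero.1 (Finset.mem_Icc.1 hk).1)]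
  rw [e]
  exact h

theorem hasSum_coeffOne {s : ℂ} (hs : 1 < s.re) :
    LSeriesHasSum (fun n => (coeffOne n : ℂ)) s
      (deriv riemannZeta s / riemannZeta s * deriv riemannZeta s) := by
  have h := hasSum_mul (hasSum_vonMangoldt hs) (hasSum_log hs)
  rw [show deriv riemannZeta s / riemannZeta s * deriv riemannZeta s
    = -deriv riemannZeta s / riemannZeta s * -deriv riemannZeta s by ring]
  exact h

theorem hasSum_coeffTwo (P : Polynomial ℝ) (y : ℝ) {s : ℂ} (hs : 1 < s.re) :
    LSeriesHasSum (fun n => (coeffTwo P y n : ℂ)) s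
      (deriv riemannZeta s / riemannZeta s * deriv riemannZeta s ^ 2 * mollifier P y s) := by
  have h := (hasSum_mul (hasSum_mul (hasSum_mul (hasSum_vonMangoldt hs) (hasSum_log hs))
    (hasSum_log hs)) (hasSum_mollifier P y s)).neg
  rw [show deriv riemannZeta s / riemannZeta s * deriv riemannZeta s ^ 2 * mollifier P y s
    = -(-deriv riemannZeta s / riemannZeta s * -deriv riemannZeta s * -deriv riemannZeta s
      * mollifier P y s) by ring]
  convert h using 1
  funext n
  simp [coeffTwo]

end

end SimpleZeros

namespace SimpleZeros

noncomputable section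

open Finset ArithmeticFunction

/-! Put `U = (yT)^(1/3)`. After the arithmetic weights are bounded, everything reduces to a mean
value (`HasMeanBound`): over primitive characters with modulus in `[Q, 2Q)` and with weight
`q/φ(q)`, the sums of `a(md) ψ(m)` over `m ≤ N(q) ≤ X` have total size at most `X + √X U Q + √X Q² +
U Q^(5/2)`, up to powers of logarithms and of `τ(d)`.

Both coefficient sequences are, up to sign, convolutions of the Möbius function with logarithms and
possibly the mollifier, because `Λ = μ * log`. All arguments stay below `U³`, so in any product of
two factors, one exceeding `U` forces the other below `U²`. This drives a Vaughan-type decomposition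
(`exists_hasMeanBound_moebius_mul`, `exists_hasMeanBound_mul_list_prod`) into two kinds of pieces.
If both factors live on `[1, U²]`, then Cauchy–Schwarz and the multiplicative large sieve give the
first three terms (`hasMeanBound_mul_of_support`). If one factor is monotone and larger than `U²`,
the other is at most `U`, and partial summation with the Pólya–Vinogradov inequality gives `U
Q^(5/2)` (`hasMeanBound_mul_highPart`). The cutoff `m ≤ N(q)` couples the two variables and moves
with `q`; it is removed by a Perron formula whose majorant does not depend on the cutoff and costs
only logarithms (`charMean_norm_sum_filter_le`).

In the sum over large moduli the Gauss sum has modulus `√q`. Since `b(kq)` is supported on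
squarefree numbers, `k` and `q` are coprime, `δ` vanishes unless `d ∣ k`, and its size is at most
`τ(k)² d / (k φ(q))`. Each dyadic block thus carries the mean value divided by `Q^(3/2)`, with `X`
of size `kQT/d`. The term `X` contributes `T/√Q ≪ T/√η`; the other three contribute at most `√T U`,
`√T y` and `U y`, all at most `y^(1/3) T^(5/6)` because `y ≤ √T`. The factors `k/d` are compensated
by the weights, and the remaining sum of `τ(k)^j / k` is a power of a logarithm. -/

/-! ### Duality and the additive large sieve -/

open scoped ComplexConjugate in
/-- The duality (Schur test) form of the large sieve inequality. -/
theorem sum_norm_sq_le_of_kernel {ι : Type*} (I : Finset ι) (S : Finset ℕ) (e : ι → ℕ → ℂ)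
    {D : ℝ} (hD : 0 ≤ D)
    (h : ∀ i ∈ I, ∑ j ∈ I, ‖∑ n ∈ S, e i n * conj (e j n)‖ ≤ D) (c : ℕ → ℂ) :
    ∑ i ∈ I, ‖∑ n ∈ S, c n * e i n‖ ^ 2 ≤ D * ∑ n ∈ S, ‖c n‖ ^ 2 := by
  set s : ι → ℂ := fun i => ∑ n ∈ S, c n * e i n with hs
  set t : ℕ → ℂ := fun n => ∑ i ∈ I, conj (s i) * e i n with ht
  set E : ℝ := ∑ i ∈ I, ‖s i‖ ^ 2 with hE
  have hE0 : 0 ≤ E := Finset.sum_nonneg fun i _ => by positivity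
  have h1 : (E : ℂ) = ∑ n ∈ S, c n * t n := by
    rw [hE]
    push_cast
    have : ∀ i ∈ I, ((‖s i‖ : ℂ)) ^ 2 = ∑ n ∈ S, c n * (conj (s i) * e i n) := by
      intro i _
      rw [← Complex.conj_mul']
      nth_rewrite 2 [hs]
      rw [Finset.mul_sum]
      exact Finset.sum_congr rfl fun n _ => by ring
    rw [Finset.sum_congr rfl this, Finset.sum_comm]
    exact Finset.sum_congr rfl fun n _ => by rw [ht, Finset.mul_sum]
  have h2 : E ≤ ∑ n ∈ S, ‖c n‖ * ‖t n‖ := by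
    calc E = ‖(E : ℂ)‖ := by rw [Complex.norm_real, Real.norm_of_nonneg hE0]
      _ ≤ _ := by
        rw [h1]
        exact (norm_sum_le _ _).trans (Finset.sum_le_sum fun n _ => by rw [norm_mul])
  have h3 : E ^ 2 ≤ (∑ n ∈ S, ‖c n‖ ^ 2) * ∑ n ∈ S, ‖t n‖ ^ 2 :=
    (pow_le_pow_left₀ hE0 h2 2).trans (Finset.sum_mul_sq_le_sq_mul_sq _ _ _)
  set K : ι → ι → ℂ := fun i j => ∑ n ∈ S, e i n * conj (e j n) with hK
  have hKs : ∀ i j, ‖K i j‖ = ‖K j i‖ := by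
    intro i j
    rw [← Complex.norm_conj (K i j)]
    congr 1
    simp only [hK, map_sum, map_mul, Complex.conj_conj]
    exact Finset.sum_congr rfl fun n _ => by ring
  have h4 : ((∑ n ∈ S, ‖t n‖ ^ 2 : ℝ) : ℂ) = ∑ i ∈ I, ∑ j ∈ I, conj (s i) * s j * K i j := by
    push_cast
    have : ∀ n ∈ S, ((‖t n‖ : ℂ)) ^ 2
        = ∑ i ∈ I, ∑ j ∈ I, conj (s i) * s j * (e i n * conj (e j n)) := by
      intro n _
      rw [← Complex.mul_conj']
      simp only [ht, map_sum, map_mul, Complex.conj_conj]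
      rw [Finset.sum_mul_sum]
      exact Finset.sum_congr rfl fun i _ => Finset.sum_congr rfl fun j _ => by ring
    rw [Finset.sum_congr rfl this, Finset.sum_comm]
    refine Finset.sum_congr rfl fun i _ => ?_
    rw [Finset.sum_comm]
    exact Finset.sum_congr rfl fun j _ => Finset.mul_sum _ _ _ |>.symm
  have h5 : ∑ n ∈ S, ‖t n‖ ^ 2 ≤ D * E := by
    have h0 : 0 ≤ ∑ n ∈ S, ‖t n‖ ^ 2 := Finset.sum_nonneg fun i _ => by positivity
    calc ∑ n ∈ S, ‖t n‖ ^ 2 = ‖((∑ n ∈ S, ‖t n‖ ^ 2 : ℝ) : ℂ)‖ := by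
          rw [Complex.norm_real, Real.norm_of_nonneg h0]
      _ ≤ ∑ i ∈ I, ∑ j ∈ I, ‖s i‖ * ‖s j‖ * ‖K i j‖ := by
          rw [h4]
          refine (norm_sum_le _ _).trans (Finset.sum_le_sum fun i _ => ?_)
          refine (norm_sum_le _ _).trans (Finset.sum_le_sum fun j _ => ?_)
          simp
      -- Schur test: the arithmetic–geometric mean inequality decouples `i` from `j`, and the
      -- Hermitian symmetry of the kernel turns both halves into row sums.
      _ ≤ ∑ i ∈ I, ∑ j ∈ I, (‖s i‖ ^ 2 * ‖K i j‖ / 2 + ‖s j‖ ^ 2 * ‖K j i‖ / 2) := by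
          refine Finset.sum_le_sum fun i _ => Finset.sum_le_sum fun j _ => ?_
          rw [hKs j i]
          nlinarith [norm_nonneg (K i j), mul_nonneg (norm_nonneg (K i j))
            (sq_nonneg (‖s i‖ - ‖s j‖))]
      _ = ∑ i ∈ I, ‖s i‖ ^ 2 * ∑ j ∈ I, ‖K i j‖ := by
          simp only [Finset.sum_add_distrib]
          rw [Finset.sum_comm (f := fun i j => ‖s j‖ ^ 2 * ‖K j i‖ / 2)]
          rw [← Finset.sum_add_distrib]
          refine Finset.sum_congr rfl fun i _ => ?_
          rw [← Finset.sum_add_distrib, Finset.mul_sum]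
          exact Finset.sum_congr rfl fun j _ => by ring
      _ ≤ ∑ i ∈ I, ‖s i‖ ^ 2 * D :=
          Finset.sum_le_sum fun i hi => mul_le_mul_of_nonneg_left (h i hi) (by positivity)
      _ = D * E := by rw [← Finset.sum_mul, mul_comm]
  rcases hE0.eq_or_lt with h0 | hpos
  · rw [← h0]
    exact mul_nonneg hD (Finset.sum_nonneg fun i _ => by positivity)
  · have hc : 0 ≤ ∑ n ∈ S, ‖c n‖ ^ 2 := Finset.sum_nonneg fun i _ => by positivity
    have := h3.trans (mul_le_mul_of_nonneg_left h5 hc)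
    nlinarith

/-- The additive character `n ↦ e(nθ)`. -/
def expChar (θ : ℝ) (n : ℕ) : ℂ := Complex.exp (2 * Real.pi * Complex.I * θ * n)

theorem norm_expChar (θ : ℝ) (n : ℕ) : ‖expChar θ n‖ = 1 := by
  rw [expChar, Complex.norm_exp]
  simp

theorem expChar_eq_pow (θ : ℝ) (n : ℕ) : expChar θ n = expChar θ 1 ^ n := by
  rw [expChar, expChar, ← Complex.exp_nat_mul]
  congr 1
  push_cast
  ring

open scoped ComplexConjugate in
theorem expChar_mul_conj (a b : ℝ) (n : ℕ) :
    expChar a n * conj (expChar b n) = expChar (a - b) n := by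
  rw [expChar, expChar, expChar, ← Complex.exp_conj, ← Complex.exp_add]
  congr 1
  simp only [map_mul, Complex.conj_ofReal, Complex.conj_I, map_natCast, map_ofNat]
  push_cast
  ring

theorem norm_expChar_sub_one (θ : ℝ) : ‖expChar θ 1 - 1‖ = 2 * |Real.sin (Real.pi * θ)| := by
  have h : expChar θ 1 = Complex.exp (Complex.I * ((2 * Real.pi * θ : ℝ) : ℂ)) := by
    rw [expChar]
    congr 1
    push_cast
    ring
  rw [h, Complex.norm_exp_I_mul_ofReal_sub_one]
  rw [norm_mul, Real.norm_eq_abs, Real.norm_eq_abs, abs_two]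
  congr 3
  ring

/-- Jordan's inequality `sin x ≥ 2x/π` on `[0, π/2]`, applied at `πθ` or at `π(1 - θ)`. -/
theorem four_mul_min_le {θ : ℝ} (h0 : 0 < θ) (h1 : θ < 1) :
    4 * min θ (1 - θ) ≤ ‖expChar θ 1 - 1‖ := by
  rw [norm_expChar_sub_one]
  have hpi := Real.pi_pos
  rcases le_total θ (1 - θ) with h | h
  · rw [min_eq_left h]
    have := Real.mul_le_sin (x := Real.pi * θ) (by positivity) (by nlinarith)
    have e : 2 / Real.pi * (Real.pi * θ) = 2 * θ := by field_simp
    have := le_abs_self (Real.sin (Real.pi * θ))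
    linarith
  · rw [min_eq_right h]
    have := Real.mul_le_sin (x := Real.pi * (1 - θ)) (by nlinarith) (by nlinarith)
    have e : 2 / Real.pi * (Real.pi * (1 - θ)) = 2 * (1 - θ) := by field_simp
    have e2 : Real.sin (Real.pi * (1 - θ)) = Real.sin (Real.pi * θ) := by
      rw [← Real.sin_pi_sub]
      congr 1
      ring
    have := le_abs_self (Real.sin (Real.pi * θ))
    linarith

theorem norm_sum_expChar_le_of_pos {θ : ℝ} (h0 : 0 < θ) (h1 : θ < 1) (A B : ℕ) :
    ‖∑ n ∈ Ioc A B, expChar θ n‖ ≤ 1 / θ + 1 / (1 - θ) := by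
  have hm : 0 < min θ (1 - θ) := lt_min h0 (by linarith)
  have h4 := four_mul_min_le h0 h1
  have hne : expChar θ 1 ≠ 1 := by
    intro h
    rw [h] at h4
    rw [sub_self, norm_zero] at h4
    linarith
  have hpos : 0 < ‖expChar θ 1 - 1‖ := norm_pos_iff.2 (sub_ne_zero.2 hne)
  have hsum : ‖∑ n ∈ Ioc A B, expChar θ n‖ ≤ 2 / ‖expChar θ 1 - 1‖ := by
    rcases le_total A B with hAB | hAB
    · have : ∑ n ∈ Ioc A B, expChar θ n = ∑ n ∈ Ico (A + 1) (B + 1), expChar θ 1 ^ n := by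
        refine Finset.sum_congr ?_ fun n _ => expChar_eq_pow θ n
        ext n
        simp only [mem_Ioc, mem_Ico]
        omega
      rw [this, geom_sum_Ico hne (by omega), norm_div]
      gcongr
      refine (norm_sub_le _ _).trans ?_
      rw [← expChar_eq_pow, ← expChar_eq_pow, norm_expChar, norm_expChar]
      norm_num
    · rw [Finset.Ioc_eq_empty (by omega)]
      simp
      positivity
  refine hsum.trans ?_
  have : 2 / ‖expChar θ 1 - 1‖ ≤ 2 / (4 * min θ (1 - θ)) := by gcongr
  refine this.trans ?_
  rcases le_total θ (1 - θ) with h | h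
  · rw [min_eq_left h]
    have e : 2 / (4 * θ) = 1 / θ / 2 := by field_simp; norm_num
    have : 0 ≤ 1 / θ := by positivity
    have : 0 ≤ 1 / (1 - θ) := div_nonneg zero_le_one (by linarith)
    linarith
  · have hh : 0 < 1 - θ := by linarith
    rw [min_eq_right h]
    have e : 2 / (4 * (1 - θ)) = 1 / (1 - θ) / 2 := by field_simp; norm_num
    have : 0 ≤ 1 / θ := by positivity
    have : 0 ≤ 1 / (1 - θ) := div_nonneg zero_le_one (by linarith)
    linarith

open scoped ComplexConjugate in
theorem norm_sum_expChar_le {θ : ℝ} (h0 : 0 < |θ|) (h1 : |θ| < 1) (A B : ℕ) :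
    ‖∑ n ∈ Ioc A B, expChar θ n‖ ≤ 1 / |θ| + 1 / (1 - |θ|) := by
  rcases abs_cases θ with ⟨h, _⟩ | ⟨h, _⟩
  · rw [h] at h0 h1 ⊢
    exact norm_sum_expChar_le_of_pos h0 h1 A B
  · have : ‖∑ n ∈ Ioc A B, expChar θ n‖ = ‖∑ n ∈ Ioc A B, expChar (-θ) n‖ := by
      rw [← Complex.norm_conj]
      congr 1
      rw [map_sum]
      refine Finset.sum_congr rfl fun n _ => ?_
      rw [expChar, expChar, ← Complex.exp_conj]
      congr 1
      simp only [map_mul, Complex.conj_ofReal, Complex.conj_I, map_natCast, map_ofNat]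
      push_cast
      ring
    rw [this]
    rw [h] at h0 h1 ⊢
    exact norm_sum_expChar_le_of_pos h0 h1 A B

theorem sum_one_div_le (n : ℕ) : ∑ s ∈ Ioc 0 n, (1 : ℝ) / s ≤ 1 + Real.log n := by
  have := harmonic_le_one_add_log n
  rw [harmonic_eq_sum_Icc] at this
  push_cast at this
  simp only [one_div]
  exact this

/-- Each distance from `p` is attained at most twice, once on either side. -/
theorem sum_natAbs_sub_le {F : ℕ → ℝ} (hF : ∀ n, 0 ≤ F n) {D p : ℕ} (hp : p < D) :
    ∑ t ∈ (range D).erase p, F ((t : ℤ) - p).natAbs ≤ 2 * ∑ s ∈ Ioc 0 (D - 1), F s := by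
  have e : (range D).erase p = (range p) ∪ Ioo p D := by
    ext t
    simp only [mem_erase, mem_range, mem_union, mem_Ioo]
    omega
  have hd : Disjoint (range p) (Ioo p D) := by
    rw [Finset.disjoint_left]
    intro t
    simp only [mem_range, mem_Ioo]
    omega
  rw [e, Finset.sum_union hd, two_mul]
  refine add_le_add ?_ ?_
  · rw [← Finset.sum_image (g := fun t : ℕ => ((t : ℤ) - p).natAbs) (f := F)]
    · refine Finset.sum_le_sum_of_subset_of_nonneg ?_ fun _ _ _ => hF _
      intro s
      simp only [mem_image, mem_range, mem_Ioc]
      rintro ⟨t, ht, rfl⟩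
      omega
    · intro a ha b hb
      simp only [coe_range, Set.mem_Iio] at ha hb ⊢
      omega
  · rw [← Finset.sum_image (g := fun t : ℕ => ((t : ℤ) - p).natAbs) (f := F)]
    · refine Finset.sum_le_sum_of_subset_of_nonneg ?_ fun _ _ _ => hF _
      intro s
      simp only [mem_image, mem_Ioo, mem_Ioc]
      rintro ⟨t, ht, rfl⟩
      omega
    · intro a ha b hb
      simp only [coe_Ioo, Set.mem_Ioo] at ha hb ⊢
      omega

/-- The additive large sieve for points of `[0, 1)` that are `1 / D`-spaced modulo one. -/
theorem additive_largeSieve {ι : Type*} (I : Finset ι) (α : ι → ℝ) {D : ℕ} (hD : 0 < D)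
    (hα0 : ∀ i ∈ I, 0 ≤ α i) (hα1 : ∀ i ∈ I, α i < 1)
    (hsep : ∀ i ∈ I, ∀ j ∈ I, i ≠ j → 1 ≤ |α i - α j| * D ∧ |α i - α j| * D ≤ D - 1)
    (N : ℕ) (c : ℕ → ℂ) :
    ∑ i ∈ I, ‖∑ n ∈ Ioc 0 N, c n * expChar (α i) n‖ ^ 2
      ≤ (N + 8 * D * (1 + Real.log D)) * ∑ n ∈ Ioc 0 N, ‖c n‖ ^ 2 := by
  classical
  have hDr : (0 : ℝ) < D := by exact_mod_cast hD
  have hD1 : (1 : ℝ) ≤ D := by exact_mod_cast hD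
  have hlog : 0 ≤ Real.log D := Real.log_natCast_nonneg D
  refine sum_norm_sq_le_of_kernel I (Ioc 0 N) (fun i => expChar (α i)) (by positivity) ?_ c
  intro i hi
  -- Cut `[0, 1)` into `D` cells of length `1/D`. The spacing puts at most one point in each cell,
  -- so sums over points are dominated by sums over cells, which are harmonic sums. This loses a
  -- factor `log D`, which is harmless here.
  set p : ι → ℕ := fun j => ⌊α j * D⌋₊ with hp
  have hpl : ∀ j ∈ I, (p j : ℝ) ≤ α j * D := fun j hj =>
    Nat.floor_le (mul_nonneg (hα0 j hj) hDr.le)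
  have hpu : ∀ j ∈ I, α j * D < p j + 1 := fun j hj => Nat.lt_floor_add_one _
  have hpD : ∀ j ∈ I, p j < D := fun j hj => by
    have h1 := hpl j hj
    have h2 := mul_lt_mul_of_pos_right (hα1 j hj) hDr
    rw [one_mul] at h2
    exact_mod_cast h1.trans_lt h2
  have hpne : ∀ j ∈ I, ∀ k ∈ I, j ≠ k → p j ≠ p k := by
    intro j hj k hk hjk h
    have := (hsep j hj k hk hjk).1
    rw [← abs_of_pos hDr, ← abs_mul, sub_mul] at this
    have h1 := hpl j hj
    have h2 := hpu j hj
    have h3 := hpl k hk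
    have h4 := hpu k hk
    rw [h] at h1 h2
    have : |α j * D - α k * D| < 1 := by rw [abs_lt]; constructor <;> linarith
    linarith
  set F : ℕ → ℝ := fun s => 2 * D * (1 / (s : ℝ)) + 2 * D * (1 / ((D - s : ℕ) : ℝ)) with hF
  have hF0 : ∀ s, 0 ≤ F s := fun s => by simp only [hF]; positivity
  have hterm : ∀ j ∈ I.erase i, ‖∑ n ∈ Ioc 0 N, expChar (α i) n * (starRingEnd ℂ) (expChar (α j) n)‖
      ≤ F ((p j : ℤ) - p i).natAbs := by
    intro j hj
    obtain ⟨hji, hjI⟩ := Finset.mem_erase.1 hj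
    obtain ⟨hs1, hs2⟩ := hsep i hi j hjI hji.symm
    simp only [expChar_mul_conj]
    set x := |α i - α j| with hx
    have hx0 : 0 < x := by
      by_contra h
      nlinarith [abs_nonneg (α i - α j)]
    have hx1 : x < 1 := by
      by_contra h
      nlinarith
    refine (norm_sum_expChar_le hx0 hx1 0 N).trans ?_
    set t : ℕ := ((p j : ℤ) - p i).natAbs with ht
    have htr : (t : ℝ) = |(p i : ℝ) - p j| := by
      rw [ht, Nat.cast_natAbs, abs_sub_comm]
      push_cast
      rfl
    have htpos : 1 ≤ t := by
      have := hpne j hjI i hi hji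
      omega
    have htD : t < D := by
      have := hpD j hjI
      have := hpD i hi
      omega
    have htpos' : (1 : ℝ) ≤ t := by exact_mod_cast htpos
    have hxD : x * D = |α i * D - α j * D| := by
      rw [← sub_mul, abs_mul, abs_of_pos hDr]
    have h1 := hpl i hi
    have h2 := hpu i hi
    have h3 := hpl j hjI
    have h4 := hpu j hjI
    -- The scaled distance `xD` differs by at most one from the cell distance `t`. Since also `1 ≤
    -- xD ≤ D - 1`, it follows that `t ≤ 2xD` and `D - t ≤ 2(1 - x)D`, whence the factors 2 in `F`.
    have hd : |x * D - t| ≤ 1 := by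
      rw [hxD, htr]
      refine (abs_abs_sub_abs_le_abs_sub _ _).trans ?_
      rw [abs_le]
      constructor <;> linarith
    obtain ⟨hd1, hd2⟩ := abs_le.1 hd
    have hDt : ((D - t : ℕ) : ℝ) = D - t := by rw [Nat.cast_sub htD.le]
    have hDt1 : (1 : ℝ) ≤ D - t := by
      rw [← hDt]
      exact_mod_cast (by omega : 1 ≤ D - t)
    simp only [hF, hDt]
    refine add_le_add ?_ ?_
    · rw [mul_one_div, div_le_div_iff₀ hx0 (by linarith)]
      nlinarith
    · rw [mul_one_div, div_le_div_iff₀ (by linarith) (by linarith)]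
      nlinarith
  rw [← Finset.add_sum_erase I _ hi]
  refine add_le_add ?_ ?_
  · refine (norm_sum_le _ _).trans ?_
    simp [norm_expChar]
  · refine (Finset.sum_le_sum hterm).trans ?_
    have himg : ∑ j ∈ I.erase i, F ((p j : ℤ) - p i).natAbs
        = ∑ t ∈ (I.erase i).image p, F ((t : ℤ) - p i).natAbs := by
      rw [Finset.sum_image]
      intro j hj k hk h
      by_contra hjk
      exact hpne j (Finset.mem_erase.1 hj).2 k (Finset.mem_erase.1 hk).2 hjk h
    have hsub : (I.erase i).image p ⊆ (range D).erase (p i) := by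
      intro t
      simp only [mem_image, mem_erase, mem_range]
      rintro ⟨j, ⟨hji, hj⟩, rfl⟩
      exact ⟨hpne j hj i hi hji, hpD j hj⟩
    rw [himg]
    refine (Finset.sum_le_sum_of_subset_of_nonneg hsub fun _ _ _ => hF0 _).trans ?_
    refine (sum_natAbs_sub_le hF0 (hpD i hi)).trans ?_
    have hharm : ∑ s ∈ Ioc 0 (D - 1), (1 : ℝ) / s ≤ 1 + Real.log D := by
      refine (sum_one_div_le _).trans ?_
      rcases Nat.eq_zero_or_pos (D - 1) with h | h
      · rw [h]
        simpa using hlog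
      · have : Real.log ((D - 1 : ℕ) : ℝ) ≤ Real.log D :=
          Real.log_le_log (by exact_mod_cast h) (by exact_mod_cast Nat.sub_le _ _)
        linarith
    have hrefl : ∑ s ∈ Ioc 0 (D - 1), (1 : ℝ) / ((D - s : ℕ) : ℝ)
        = ∑ s ∈ Ioc 0 (D - 1), (1 : ℝ) / s := by
      refine Finset.sum_bij' (fun s _ => D - s) (fun s _ => D - s) ?_ ?_ ?_ ?_ ?_
      all_goals intro s hs; simp only [mem_Ioc] at hs ⊢
      all_goals omega
    simp only [hF]
    rw [Finset.sum_add_distrib, ← Finset.mul_sum, ← Finset.mul_sum, hrefl]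
    nlinarith

/-- The additive large sieve for the Farey fractions of order `R`. -/
theorem farey_largeSieve (R N : ℕ) (c : ℕ → ℂ) :
    ∑ q ∈ Ioc 0 R, ∑ a ∈ (range q).filter (Nat.Coprime · q),
        ‖∑ n ∈ Ioc 0 N, c n * expChar ((a : ℝ) / q) n‖ ^ 2
      ≤ (N + 8 * (R ^ 2 : ℕ) * (1 + Real.log (R ^ 2 : ℕ))) * ∑ n ∈ Ioc 0 N, ‖c n‖ ^ 2 := by
  rcases Nat.eq_zero_or_pos R with rfl | hR
  · simp
    positivity
  rw [Finset.sum_sigma']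
  refine additive_largeSieve ((Ioc 0 R).sigma fun q => (range q).filter (Nat.Coprime · q))
    (fun x => (x.2 : ℝ) / x.1) (by positivity) ?_ ?_ ?_ N c
  · rintro ⟨q, a⟩ _
    positivity
  · rintro ⟨q, a⟩ h
    simp only [mem_sigma, mem_Ioc, mem_filter, mem_range] at h ⊢
    rw [div_lt_one (by exact_mod_cast h.1.1)]
    exact_mod_cast h.2.1
  · rintro ⟨q, a⟩ h ⟨q', a'⟩ h' hne
    simp only [mem_sigma, mem_Ioc, mem_filter, mem_range] at h h' ⊢
    obtain ⟨⟨hq0, hqR⟩, haq, hco⟩ := h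
    obtain ⟨⟨hq0', hqR'⟩, haq', hco'⟩ := h'
    have hqr : (0 : ℝ) < q := by exact_mod_cast hq0
    have hqr' : (0 : ℝ) < q' := by exact_mod_cast hq0'
    have hprod : ((q * q' : ℕ) : ℝ) ≤ ((R ^ 2 : ℕ) : ℝ) := by
      rw [sq]
      exact_mod_cast Nat.mul_le_mul hqR hqR'
    -- Distinct reduced fractions differ by `z/(qq')` with `1 ≤ z ≤ qq' - 1`. The upper bound on `z`
    -- is the spacing across the point where `0` and `1` are identified.
    have hkey : |(a : ℝ) / q - a' / q'| = (|(a : ℤ) * q' - a' * q| : ℤ) / (q * q' : ℕ) := by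
      rw [div_sub_div _ _ hqr.ne' hqr'.ne', abs_div, abs_of_pos (mul_pos hqr hqr')]
      push_cast
      rw [mul_comm (q : ℝ) (a' : ℝ)]
    set z : ℤ := |(a : ℤ) * q' - a' * q| with hz
    have hz1 : 1 ≤ z := by
      rw [hz]
      refine Int.one_le_abs fun h0 => hne ?_
      have h0' : a * q' = a' * q := by exact_mod_cast sub_eq_zero.1 h0
      have d1 : q ∣ q' := hco.symm.dvd_of_dvd_mul_left (Dvd.intro_left _ h0'.symm)
      have d2 : q' ∣ q := hco'.symm.dvd_of_dvd_mul_left (Dvd.intro_left _ h0')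
      obtain rfl := Nat.dvd_antisymm d1 d2
      obtain rfl := Nat.eq_of_mul_eq_mul_right hq0 h0'
      rfl
    have hz2 : z ≤ q * q' - 1 := by
      have : z < q * q' := by
        rw [hz, abs_lt]
        have := Nat.mul_lt_mul_of_pos_right haq hq0'
        have := Nat.mul_lt_mul_of_pos_right haq' hq0
        have e : q' * q = q * q' := mul_comm _ _
        rw [e] at this
        constructor <;> · zify at *; nlinarith
      omega
    have hz1' : (1 : ℝ) ≤ z := by exact_mod_cast hz1
    have hz2' : (z : ℝ) ≤ (q * q' : ℕ) - 1 := by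
      have : (z : ℝ) ≤ ((q * q' - 1 : ℤ) : ℝ) := by exact_mod_cast hz2
      push_cast at this ⊢
      exact this
    have hqq : (0 : ℝ) < (q * q' : ℕ) := by exact_mod_cast Nat.mul_pos hq0 hq0'
    rw [hkey, div_mul_eq_mul_div]
    constructor
    · rw [le_div_iff₀ hqq]
      nlinarith
    · rw [div_le_iff₀ hqq]
      nlinarith

/-! ### Gauss sums and the multiplicative large sieve -/

theorem expChar_div_eq {q : ℕ} [NeZero q] (a n : ℕ) :
    expChar ((a : ℝ) / q) n = ZMod.stdAddChar ((a * n : ℕ) : ZMod q) := by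
  have h := ZMod.stdAddChar_coe (N := q) ((a * n : ℕ) : ℤ)
  push_cast at h ⊢
  rw [h, expChar]
  congr 1
  push_cast
  ring

theorem star_apply_eq_inv {q : ℕ} (ψ : DirichletCharacter ℂ q) (x : ZMod q) :
    (starRingEnd ℂ) (ψ x) = ψ⁻¹ x := by
  rw [← MulChar.star_eq_inv]
  rfl

/-- Primitivity makes the shift formula for the Gauss sum valid for every residue `a`, including
those not coprime to `q`. Expanding `|τ(ψ)|²` and summing over all `a` then leaves only `b = 1`, by
orthogonality of additive characters. -/
theorem norm_gaussSum_sq {q : ℕ} [NeZero q] {ψ : DirichletCharacter ℂ q} (hψ : ψ.IsPrimitive) :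
    ‖gaussSum ψ ZMod.stdAddChar‖ ^ 2 = q := by
  have key : gaussSum ψ ZMod.stdAddChar * (starRingEnd ℂ) (gaussSum ψ ZMod.stdAddChar) = q := by
    have h1 : (starRingEnd ℂ) (gaussSum ψ ZMod.stdAddChar)
        = ∑ a : ZMod q, ψ⁻¹ a * ZMod.stdAddChar (-a) := by
      rw [gaussSum, map_sum]
      refine Finset.sum_congr rfl fun a _ => ?_
      rw [map_mul, star_apply_eq_inv, AddChar.map_neg_eq_conj]
    rw [h1, Finset.mul_sum]
    have h2 : ∀ a : ZMod q, gaussSum ψ ZMod.stdAddChar * (ψ⁻¹ a * ZMod.stdAddChar (-a))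
        = ∑ b : ZMod q, ψ b * ZMod.stdAddChar (a * (b - 1)) := by
      intro a
      rw [← mul_assoc, mul_comm (gaussSum _ _), ← gaussSum_mulShift_of_isPrimitive _ hψ,
        gaussSum, Finset.sum_mul]
      refine Finset.sum_congr rfl fun b _ => ?_
      rw [AddChar.mulShift_apply, mul_assoc, ← AddChar.map_add_eq_mul]
      congr 2
      ring
    rw [Finset.sum_congr rfl fun a _ => h2 a, Finset.sum_comm]
    have h3 : ∀ b : ZMod q, ∑ a : ZMod q, ψ b * (ZMod.stdAddChar (a * (b - 1)) : ℂ)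
        = if b = 1 then (q : ℂ) else 0 := by
      intro b
      rw [← Finset.mul_sum, AddChar.sum_mulShift _ (ZMod.isPrimitive_stdAddChar q)]
      by_cases hb : b = 1
      · simp [hb, ZMod.card]
      · simp [hb, sub_eq_zero]
    rw [Finset.sum_congr rfl fun b _ => h3 b]
    simp
  rw [Complex.mul_conj'] at key
  exact_mod_cast key

theorem IsPrimitive_inv {q : ℕ} {ψ : DirichletCharacter ℂ q} (hψ : ψ.IsPrimitive) :
    (ψ⁻¹).IsPrimitive := by
  rw [DirichletCharacter.isPrimitive_def] at hψ ⊢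
  rw [DirichletCharacter.conductor_inv, hψ]

theorem norm_charGaussSum_star {q : ℕ} [NeZero q] {ψ : DirichletCharacter ℂ q}
    (hψ : ψ.IsPrimitive) : ‖charGaussSum (star ψ)‖ = √q := by
  rw [charGaussSum_eq, MulChar.star_eq_inv]
  rw [← norm_gaussSum_sq (IsPrimitive_inv hψ), Real.sqrt_sq (norm_nonneg _)]

/-- The expansion of a primitive character in additive characters. -/
theorem gaussSum_mul_apply {q : ℕ} [NeZero q] {ψ : DirichletCharacter ℂ q} (hψ : ψ.IsPrimitive)
    (n : ℕ) : gaussSum ψ⁻¹ ZMod.stdAddChar * ψ (n : ZMod q)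
      = ∑ a ∈ range q, ψ⁻¹ (a : ZMod q) * expChar ((a : ℝ) / q) n := by
  have h := gaussSum_mulShift_of_isPrimitive (ZMod.stdAddChar (N := q)) (IsPrimitive_inv hψ) n
  rw [inv_inv] at h
  rw [mul_comm, ← h, gaussSum]
  symm
  refine Finset.sum_bij' (fun a _ => (a : ZMod q)) (fun a _ => a.val) ?_ ?_ ?_ ?_ ?_
  · intro a _; exact Finset.mem_univ _
  · intro a _; exact Finset.mem_range.2 (ZMod.val_lt a)
  · intro a ha; exact ZMod.val_cast_of_lt (Finset.mem_range.1 ha)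
  · intro a _; exact ZMod.natCast_zmod_val a
  · intro a _
    rw [expChar_div_eq, AddChar.mulShift_apply]
    push_cast
    rw [mul_comm (n : ZMod q)]

/-- Orthogonality over the full group of characters modulo `q`. This is where the factor `φ(q)`,
cancelled by the weight `q/φ(q)`, comes from. -/
theorem sum_norm_sq_sum_char {q : ℕ} [NeZero q] (S : ℕ → ℂ) :
    ∑ ψ : DirichletCharacter ℂ q, ‖∑ a ∈ range q, ψ⁻¹ (a : ZMod q) * S a‖ ^ 2
      = q.totient * ∑ a ∈ (range q).filter (Nat.Coprime · q), ‖S a‖ ^ 2 := by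
  have hC : ((∑ ψ : DirichletCharacter ℂ q,
      ‖∑ a ∈ range q, ψ⁻¹ (a : ZMod q) * S a‖ ^ 2 : ℝ) : ℂ)
      = ((q.totient * ∑ a ∈ (range q).filter (Nat.Coprime · q), ‖S a‖ ^ 2 : ℝ) : ℂ) := by
    push_cast
    have h1 : ∀ ψ : DirichletCharacter ℂ q,
        ((‖∑ a ∈ range q, ψ⁻¹ (a : ZMod q) * S a‖ : ℂ)) ^ 2
        = ∑ a ∈ range q, ∑ b ∈ range q,
          (S a * (starRingEnd ℂ) (S b)) * (ψ⁻¹ (a : ZMod q) * ψ (b : ZMod q)) := by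
      intro ψ
      rw [← Complex.mul_conj', map_sum, Finset.sum_mul_sum]
      refine Finset.sum_congr rfl fun a _ => Finset.sum_congr rfl fun b _ => ?_
      rw [map_mul, star_apply_eq_inv, inv_inv]
      ring
    rw [Finset.sum_congr rfl fun ψ _ => h1 ψ, Finset.sum_comm, Finset.mul_sum, Finset.sum_filter]
    refine Finset.sum_congr rfl fun a ha => ?_
    rw [Finset.sum_comm]
    simp only [← Finset.mul_sum]
    split_ifs with hco
    · have hu : IsUnit (a : ZMod q) := (ZMod.isUnit_iff_coprime a q).2 hco
      have hinv : ∀ ψ : DirichletCharacter ℂ q, ψ⁻¹ (a : ZMod q) = ψ (a : ZMod q)⁻¹ := by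
        intro ψ
        obtain ⟨u, hu⟩ := hu
        rw [MulChar.inv_apply, ← hu, Ring.inverse_unit, ZMod.inv_coe_unit]
      simp only [hinv, DirichletCharacter.sum_char_inv_mul_char_eq ℂ hu]
      rw [Finset.sum_eq_single_of_mem a ha]
      · rw [if_pos rfl, Complex.mul_conj']
        ring
      · intro b hb hba
        rw [if_neg, mul_zero]
        intro h
        apply hba
        have := (ZMod.natCast_eq_natCast_iff' _ _ _).1 h
        rw [Nat.mod_eq_of_lt (mem_range.1 ha), Nat.mod_eq_of_lt (mem_range.1 hb)] at this
        exact this.symm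
    · have hu : ¬ IsUnit (a : ZMod q) := fun h => hco ((ZMod.isUnit_iff_coprime a q).1 h)
      refine Finset.sum_eq_zero fun b _ => ?_
      rw [Finset.sum_eq_zero, mul_zero]
      intro ψ _
      rw [MulChar.map_nonunit _ hu, zero_mul]
  exact_mod_cast hC

/-- The weighted mean `∑_{Q ≤ q < 2Q} (q / φ(q)) ∑*_ψ F(q, ψ)` over primitive characters. -/
def charMean (Q : ℕ) (F : (q : ℕ) → DirichletCharacter ℂ q → ℝ) : ℝ :=
  ∑ q ∈ Ico Q (2 * Q), (q : ℝ) / q.totient * ∑ ψ ∈ primitiveCharacters q, F q ψ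

/-- The multiplicative large sieve. -/
theorem charMean_norm_sq_le {Q : ℕ} (hQ : 1 ≤ Q) (N : ℕ) (c : ℕ → ℂ) :
    charMean Q (fun q ψ => ‖∑ n ∈ Ioc 0 N, c n * ψ (n : ZMod q)‖ ^ 2)
      ≤ (N + 8 * ((2 * Q) ^ 2 : ℕ) * (1 + Real.log ((2 * Q) ^ 2 : ℕ)))
        * ∑ n ∈ Ioc 0 N, ‖c n‖ ^ 2 := by
  refine le_trans ?_ (farey_largeSieve (2 * Q) N c)
  have hsub : Ico Q (2 * Q) ⊆ Ioc 0 (2 * Q) := by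
    intro q
    simp only [mem_Ico, mem_Ioc]
    omega
  refine le_trans ?_ (Finset.sum_le_sum_of_subset_of_nonneg hsub fun _ _ _ =>
    Finset.sum_nonneg fun _ _ => by positivity)
  refine Finset.sum_le_sum fun q hq => ?_
  have hq0 : 0 < q := by
    have := (mem_Ico.1 hq).1
    omega
  have : NeZero q := ⟨hq0.ne'⟩
  have hqr : (0 : ℝ) < q := by exact_mod_cast hq0
  have hφ : (0 : ℝ) < q.totient := by exact_mod_cast Nat.totient_pos.2 hq0
  set S : ℕ → ℂ := fun a => ∑ n ∈ Ioc 0 N, c n * expChar ((a : ℝ) / q) n with hS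
  -- The Gauss sum of `ψ⁻¹` trades `ψ` for additive characters; dividing by its squared modulus
  -- gives the factor `1/q`.
  have hψ : ∀ ψ ∈ primitiveCharacters q, ‖∑ n ∈ Ioc 0 N, c n * ψ (n : ZMod q)‖ ^ 2
      = (1 / q) * ‖∑ a ∈ range q, ψ⁻¹ (a : ZMod q) * S a‖ ^ 2 := by
    intro ψ hψ
    have hp := (mem_primitiveCharacters ψ).1 hψ
    have e : gaussSum ψ⁻¹ ZMod.stdAddChar * ∑ n ∈ Ioc 0 N, c n * ψ (n : ZMod q)
        = ∑ a ∈ range q, ψ⁻¹ (a : ZMod q) * S a := by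
      have : ∀ n ∈ Ioc 0 N, gaussSum ψ⁻¹ ZMod.stdAddChar * (c n * ψ (n : ZMod q))
          = ∑ a ∈ range q, c n * (ψ⁻¹ (a : ZMod q) * expChar ((a : ℝ) / q) n) := by
        intro n _
        rw [← Finset.mul_sum, ← gaussSum_mul_apply hp]
        ring
      rw [Finset.mul_sum, Finset.sum_congr rfl this, Finset.sum_comm]
      refine Finset.sum_congr rfl fun a _ => ?_
      rw [hS, Finset.mul_sum]
      exact Finset.sum_congr rfl fun n _ => by ring
    rw [← e, norm_mul, mul_pow, norm_gaussSum_sq (IsPrimitive_inv hp)]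
    field_simp
  rw [Finset.sum_congr rfl hψ, ← Finset.mul_sum, ← mul_assoc]
  -- By positivity the imprimitive characters may be added, so that orthogonality over the full
  -- group applies.
  have hle : ∑ ψ ∈ primitiveCharacters q, ‖∑ a ∈ range q, ψ⁻¹ (a : ZMod q) * S a‖ ^ 2
      ≤ q.totient * ∑ a ∈ (range q).filter (Nat.Coprime · q), ‖S a‖ ^ 2 := by
    rw [← sum_norm_sq_sum_char]
    exact Finset.sum_le_sum_of_subset_of_nonneg (Finset.subset_univ _) fun _ _ _ => by positivity
  calc (q : ℝ) / q.totient * (1 / q) * _ ≤ (q : ℝ) / q.totient * (1 / q) *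
        (q.totient * ∑ a ∈ (range q).filter (Nat.Coprime · q), ‖S a‖ ^ 2) := by
        gcongr
    _ = _ := by
        field_simp
        rfl

/-! ### Calculus of the weighted mean over primitive characters -/

theorem charMean_mono {Q : ℕ} {F G : (q : ℕ) → DirichletCharacter ℂ q → ℝ}
    (h : ∀ q, Q ≤ q → q < 2 * Q → ∀ ψ : DirichletCharacter ℂ q, ψ.IsPrimitive → F q ψ ≤ G q ψ) :
    charMean Q F ≤ charMean Q G := by
  refine Finset.sum_le_sum fun q hq => mul_le_mul_of_nonneg_left ?_ (by positivity)
  exact Finset.sum_le_sum fun ψ hψ => h q (mem_Ico.1 hq).1 (mem_Ico.1 hq).2 ψ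
    ((mem_primitiveCharacters ψ).1 hψ)

theorem charMean_add (Q : ℕ) (F G : (q : ℕ) → DirichletCharacter ℂ q → ℝ) :
    charMean Q (fun q ψ => F q ψ + G q ψ) = charMean Q F + charMean Q G := by
  simp only [charMean, Finset.sum_add_distrib, mul_add]

theorem charMean_sum {ι : Type*} (Q : ℕ) (I : Finset ι)
    (F : ι → (q : ℕ) → DirichletCharacter ℂ q → ℝ) :
    charMean Q (fun q ψ => ∑ i ∈ I, F i q ψ) = ∑ i ∈ I, charMean Q (F i) := by
  simp only [charMean]
  rw [Finset.sum_comm]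
  refine Finset.sum_congr rfl fun q _ => ?_
  rw [← Finset.mul_sum, Finset.sum_comm]

theorem charMean_mul_left (Q : ℕ) (c : ℝ) (F : (q : ℕ) → DirichletCharacter ℂ q → ℝ) :
    charMean Q (fun q ψ => c * F q ψ) = c * charMean Q F := by
  simp only [charMean, ← Finset.mul_sum]
  rw [Finset.mul_sum]
  exact Finset.sum_congr rfl fun q _ => by ring

theorem charMean_nonneg {Q : ℕ} {F : (q : ℕ) → DirichletCharacter ℂ q → ℝ}
    (h : ∀ q ψ, 0 ≤ F q ψ) : 0 ≤ charMean Q F :=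
  Finset.sum_nonneg fun q _ => mul_nonneg (by positivity) (Finset.sum_nonneg fun ψ _ => h q ψ)

theorem card_primitiveCharacters_le {q : ℕ} [NeZero q] :
    (primitiveCharacters q).card ≤ q.totient := by
  rw [← DirichletCharacter.card_eq_totient_of_hasEnoughRootsOfUnity ℂ q, Nat.card_eq_fintype_card]
  exact Finset.card_le_univ _

/-- There are at most `φ(q)` primitive characters, which cancels the weight down to `q ≤ 2Q` for
each of the `Q` moduli. -/
theorem charMean_const_le {Q : ℕ} {c : ℝ} (hc : 0 ≤ c) :
    charMean Q (fun _ _ => c) ≤ 2 * (Q : ℝ) ^ 2 * c := by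
  have h : ∀ q ∈ Ico Q (2 * Q), (q : ℝ) / q.totient * ∑ _ψ ∈ primitiveCharacters q, c
      ≤ 2 * Q * c := by
    intro q hq
    have hq := (mem_Ico.1 hq)
    have hq0 : 0 < q := by omega
    have : NeZero q := ⟨hq0.ne'⟩
    have hφ : (0 : ℝ) < q.totient := by exact_mod_cast Nat.totient_pos.2 hq0
    have hcard : ((primitiveCharacters q).card : ℝ) ≤ q.totient := by
      exact_mod_cast card_primitiveCharacters_le
    have hq2 : (q : ℝ) ≤ 2 * Q := by exact_mod_cast hq.2.le
    rw [Finset.sum_const, nsmul_eq_mul]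
    calc (q : ℝ) / q.totient * ((primitiveCharacters q).card * c)
        ≤ q / q.totient * (q.totient * c) := by gcongr
      _ = q * c := by field_simp
      _ ≤ _ := by gcongr
  refine (Finset.sum_le_sum h).trans (le_of_eq ?_)
  rw [Finset.sum_const, nsmul_eq_mul, Nat.card_Ico, show 2 * Q - Q = Q by omega]
  ring

theorem charMean_mul_le {Q : ℕ} {F G : (q : ℕ) → DirichletCharacter ℂ q → ℝ} :
    charMean Q (fun q ψ => F q ψ * G q ψ) ^ 2
      ≤ charMean Q (fun q ψ => F q ψ ^ 2) * charMean Q (fun q ψ => G q ψ ^ 2) := by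
  have e : ∀ H : (q : ℕ) → DirichletCharacter ℂ q → ℝ, charMean Q H
      = ∑ x ∈ (Ico Q (2 * Q)).sigma fun q => primitiveCharacters q,
        (x.1 : ℝ) / x.1.totient * H x.1 x.2 := by
    intro H
    rw [Finset.sum_sigma, charMean]
    exact Finset.sum_congr rfl fun q _ => by rw [Finset.mul_sum]
  rw [e, e, e]
  refine le_trans (le_of_eq ?_) ((Finset.sum_mul_sq_le_sq_mul_sq
    ((Ico Q (2 * Q)).sigma fun q => primitiveCharacters q)
    (fun x : (q : ℕ) × DirichletCharacter ℂ q => √((x.1 : ℝ) / x.1.totient) * F x.1 x.2)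
    (fun x => √((x.1 : ℝ) / x.1.totient) * G x.1 x.2)).trans (le_of_eq ?_))
  · congr 1
    refine Finset.sum_congr rfl fun x _ => ?_
    rw [mul_mul_mul_comm, Real.mul_self_sqrt (by positivity)]
  · congr 1
    all_goals
      refine Finset.sum_congr rfl fun x _ => ?_
      rw [mul_pow, Real.sq_sqrt (by positivity)]

/-! ### Pólya–Vinogradov and partial summation -/

/-- The Pólya–Vinogradov inequality for primitive characters. -/
theorem norm_sum_char_le {q : ℕ} (hq : 2 ≤ q) {ψ : DirichletCharacter ℂ q} (hψ : ψ.IsPrimitive)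
    (A B : ℕ) : ‖∑ n ∈ Ioc A B, ψ (n : ZMod q)‖ ≤ 2 * √q * (1 + Real.log q) := by
  have : NeZero q := ⟨by omega⟩
  have hqr : (0 : ℝ) < q := by exact_mod_cast (by omega : 0 < q)
  have hsq : 0 < √(q : ℝ) := Real.sqrt_pos.2 hqr
  have hτ : ‖gaussSum ψ⁻¹ ZMod.stdAddChar‖ = √q := by
    rw [← norm_gaussSum_sq (IsPrimitive_inv hψ), Real.sqrt_sq (norm_nonneg _)]
  have e : gaussSum ψ⁻¹ ZMod.stdAddChar * ∑ n ∈ Ioc A B, ψ (n : ZMod q)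
      = ∑ a ∈ range q, ψ⁻¹ (a : ZMod q) * ∑ n ∈ Ioc A B, expChar ((a : ℝ) / q) n := by
    rw [Finset.mul_sum, Finset.sum_congr rfl fun n _ => gaussSum_mul_apply hψ n, Finset.sum_comm]
    exact Finset.sum_congr rfl fun a _ => by rw [Finset.mul_sum]
  have hbound : ∀ a ∈ range q, ‖ψ⁻¹ (a : ZMod q) * ∑ n ∈ Ioc A B, expChar ((a : ℝ) / q) n‖
      ≤ if a = 0 then 0 else (q : ℝ) * (1 / a) + q * (1 / ((q - a : ℕ) : ℝ)) := by
    intro a ha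
    have haq := mem_range.1 ha
    split_ifs with h0
    -- The frequency `a = 0` would produce a sum without cancellation, but `ψ⁻¹(0) = 0` because `q ≥
    -- 2`.
    · subst h0
      have : ψ⁻¹ ((0 : ℕ) : ZMod q) = 0 := by
        rw [Nat.cast_zero]
        refine MulChar.map_nonunit _ ?_
        have : Fact (1 < q) := ⟨by omega⟩
        exact not_isUnit_zero
      rw [this]
      simp
    · have ha0 : (0 : ℝ) < a := by exact_mod_cast Nat.pos_of_ne_zero h0
      have haq' : (a : ℝ) < q := by exact_mod_cast haq
      rw [norm_mul]
      refine (mul_le_mul (DirichletCharacter.norm_le_one _ _) (norm_sum_expChar_le_of_pos (by positivity)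
        ((div_lt_one hqr).2 haq') A B) (norm_nonneg _) zero_le_one).trans (le_of_eq ?_)
      rw [Nat.cast_sub haq.le]
      have : (q : ℝ) - a ≠ 0 := by linarith
      field_simp
  have hsum : ‖gaussSum ψ⁻¹ ZMod.stdAddChar * ∑ n ∈ Ioc A B, ψ (n : ZMod q)‖
      ≤ 2 * q * (1 + Real.log q) := by
    rw [e]
    refine (norm_sum_le _ _).trans ((Finset.sum_le_sum hbound).trans ?_)
    have hr : range q = insert 0 (Ioc 0 (q - 1)) := by
      ext a
      simp only [mem_range, mem_insert, mem_Ioc]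
      omega
    rw [hr, Finset.sum_insert (by simp), if_pos rfl, zero_add]
    have : ∀ a ∈ Ioc 0 (q - 1),
        (if a = 0 then 0 else (q : ℝ) * (1 / a) + q * (1 / ((q - a : ℕ) : ℝ)))
        = (q : ℝ) * (1 / a) + q * (1 / ((q - a : ℕ) : ℝ)) := by
      intro a ha
      rw [if_neg]
      have := (mem_Ioc.1 ha).1
      omega
    rw [Finset.sum_congr rfl this, Finset.sum_add_distrib, ← Finset.mul_sum, ← Finset.mul_sum]
    have hrefl : ∑ s ∈ Ioc 0 (q - 1), (1 : ℝ) / ((q - s : ℕ) : ℝ)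
        = ∑ s ∈ Ioc 0 (q - 1), (1 : ℝ) / s := by
      refine Finset.sum_bij' (fun s _ => q - s) (fun s _ => q - s) ?_ ?_ ?_ ?_ ?_
      all_goals intro s hs; simp only [mem_Ioc] at hs ⊢
      all_goals omega
    rw [hrefl]
    have h1 := sum_one_div_le (q - 1)
    have h2 : Real.log ((q - 1 : ℕ) : ℝ) ≤ Real.log q :=
      Real.log_le_log (by exact_mod_cast (by omega : 0 < q - 1)) (by exact_mod_cast Nat.sub_le _ _)
    nlinarith
  rw [norm_mul, hτ] at hsum
  have hq2 : (q : ℝ) = √q * √q := (Real.mul_self_sqrt hqr.le).symm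
  rw [show 2 * (q : ℝ) * (1 + Real.log q) = √q * (2 * √q * (1 + Real.log q)) by
    nth_rewrite 1 [hq2]
    ring] at hsum
  exact le_of_mul_le_mul_left hsum hsq

/-- Partial summation with a monotone weight. -/
theorem norm_sum_monotone_mul_le {f : ℕ → ℝ} (hf : Monotone f) (hf0 : 0 ≤ f 0) {c : ℕ → ℂ}
    {M : ℝ} (hM : ∀ A B, ‖∑ n ∈ Ioc A B, c n‖ ≤ M) (A B : ℕ) :
    ‖∑ n ∈ Ioc A B, (f n : ℂ) * c n‖ ≤ f B * M := by
  have hM0 : 0 ≤ M := (norm_nonneg _).trans (hM 0 0)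
  have hfn : ∀ n, 0 ≤ f n := fun n => hf0.trans (hf (Nat.zero_le n))
  rcases le_total B A with h | h
  · rw [Finset.Ioc_eq_empty (by omega)]
    simpa using mul_nonneg (hfn B) hM0
  -- Abel summation by moving the lower endpoint down from `B`: each step adds the increment of `f`
  -- times a tail sum, and the increments, being nonnegative, telescope.
  have key : ‖∑ n ∈ Ioc A B, (f n : ℂ) * c n - f A * ∑ n ∈ Ioc A B, c n‖ ≤ (f B - f A) * M := by
    induction h using Nat.decreasingInduction with
    | self => simp
    | of_succ A hA ih =>
      have hI : Ioc A B = insert (A + 1) (Ioc (A + 1) B) := by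
        ext n
        simp only [mem_Ioc, mem_insert]
        omega
      have hs : ∀ g : ℕ → ℂ, ∑ n ∈ Ioc A B, g n = g (A + 1) + ∑ n ∈ Ioc (A + 1) B, g n := by
        intro g
        rw [hI, Finset.sum_insert (by simp)]
      have e : ∑ n ∈ Ioc A B, (f n : ℂ) * c n - f A * ∑ n ∈ Ioc A B, c n
          = (∑ n ∈ Ioc (A + 1) B, (f n : ℂ) * c n - f (A + 1) * ∑ n ∈ Ioc (A + 1) B, c n)
            + ((f (A + 1) - f A : ℝ) : ℂ) * ∑ n ∈ Ioc A B, c n := by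
        rw [hs, hs c]
        push_cast
        ring
      rw [e]
      have hd : 0 ≤ f (A + 1) - f A := sub_nonneg.2 (hf (Nat.le_succ A))
      have h2 : ‖((f (A + 1) - f A : ℝ) : ℂ) * ∑ n ∈ Ioc A B, c n‖ ≤ (f (A + 1) - f A) * M := by
        rw [norm_mul, Complex.norm_real, Real.norm_of_nonneg hd]
        exact mul_le_mul_of_nonneg_left (hM A B) hd
      refine (norm_add_le _ _).trans ((add_le_add ih h2).trans (le_of_eq ?_))
      ring
  have h2 : ‖(f A : ℂ) * ∑ n ∈ Ioc A B, c n‖ ≤ f A * M := by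
    rw [norm_mul, Complex.norm_real, Real.norm_of_nonneg (hfn A)]
    exact mul_le_mul_of_nonneg_left (hM A B) (hfn A)
  calc ‖∑ n ∈ Ioc A B, (f n : ℂ) * c n‖
      = ‖(∑ n ∈ Ioc A B, (f n : ℂ) * c n - f A * ∑ n ∈ Ioc A B, c n)
        + f A * ∑ n ∈ Ioc A B, c n‖ := by rw [sub_add_cancel]
    _ ≤ (f B - f A) * M + f A * M := (norm_add_le _ _).trans (add_le_add key h2)
    _ = f B * M := by ring

/-! ### A Perron formula with an absolutely integrable kernel -/

theorem integral_one_add_abs_rpow {b : ℝ} (hb : 0 < b) :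
    ∫ t : ℝ, (1 + |t|) ^ (-(1 + b)) = 2 / b := by
  rw [integral_comp_abs (f := fun t : ℝ => (1 + t) ^ (-(1 + b)))]
  have hd : ∀ x ∈ Set.Ici (0 : ℝ),
      HasDerivAt (fun t : ℝ => -(1 + t) ^ (-b) / b) ((1 + x) ^ (-(1 + b))) x := by
    intro x hx
    have hx0 : (0 : ℝ) ≤ x := hx
    have h := ((hasDerivAt_id x).const_add 1).rpow_const (p := -b) (Or.inl (by simp; linarith))
    have h2 := h.neg.div_const b
    have e : -(1 * -b * (1 + id x) ^ (-b - 1)) / b = (1 + x) ^ (-(1 + b)) := by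
      rw [show -b - 1 = -(1 + b) by ring]
      simp only [id]
      field_simp
    rw [e] at h2
    exact h2
  have ht : Filter.Tendsto (fun t : ℝ => -(1 + t) ^ (-b) / b) Filter.atTop (nhds (-0 / b)) := by
    refine Filter.Tendsto.div_const (Filter.Tendsto.neg ?_) b
    exact (tendsto_rpow_neg_atTop hb).comp (Filter.tendsto_atTop_add_const_left _ _ Filter.tendsto_id)
  have := MeasureTheory.integral_Ioi_of_hasDerivAt_of_nonneg' hd
    (fun x hx => Real.rpow_nonneg (by have : (0 : ℝ) < x := hx; linarith) _) ht
  rw [this]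
  simp
  field_simp

theorem integrable_one_add_abs_rpow {b : ℝ} (hb : 0 < b) :
    MeasureTheory.Integrable fun t : ℝ => (1 + |t|) ^ (-(1 + b)) := by
  have := integrable_one_add_norm (E := ℝ) (μ := MeasureTheory.volume) (r := 1 + b) (by simpa)
  simpa [Real.norm_eq_abs] using this

/-- The tent `(1 - t)₊` on the positive half-line. -/
def unitTent : ℝ → ℂ := Set.indicator (Set.Ioc 0 1) fun t => 1 - (t : ℂ)

theorem hasMellin_unitTent {s : ℂ} (hs : 0 < s.re) : HasMellin unitTent s (1 / (s * (s + 1))) := by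
  have h1 := hasMellin_one_Ioc hs
  have h2 := hasMellin_cpow_Ioc 1 (s := s) (by simp; linarith)
  have h := hasMellin_sub h1.1 h2.1
  rw [h1.2, h2.2] at h
  have e1 : (fun t => Set.indicator (Set.Ioc 0 1) (fun _ => 1 : ℝ → ℂ) t
      - Set.indicator (Set.Ioc 0 1) (fun t => (t : ℂ) ^ (1 : ℂ) : ℝ → ℂ) t) = unitTent := by
    funext t
    by_cases ht : t ∈ Set.Ioc (0 : ℝ) 1
    · simp [unitTent, ht]
    · simp [unitTent, ht]
  have hs0 : s ≠ 0 := by rintro rfl; simp at hs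
  have hs1 : s + 1 ≠ 0 := by
    intro h
    have := congrArg Complex.re h
    simp at this
    linarith
  rw [e1] at h
  have e2 : 1 / s - 1 / (s + 1) = 1 / (s * (s + 1)) := by
    rw [div_sub_div _ _ hs0 hs1]
    congr 1
    ring
  rwa [e2] at h

theorem unitTent_of_pos {t : ℝ} (ht : 0 < t) : unitTent t = ((max (1 - t) 0 : ℝ) : ℂ) := by
  by_cases h1 : t ≤ 1
  · rw [unitTent, Set.indicator_of_mem (show t ∈ Set.Ioc (0 : ℝ) 1 from ⟨ht, h1⟩), max_eq_left (by linarith)]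
    push_cast
    rfl
  · rw [unitTent, Set.indicator_of_notMem (fun h => h1 h.2), max_eq_right (by linarith)]
    simp

theorem continuousAt_unitTent {t : ℝ} (ht : 0 < t) : ContinuousAt unitTent t := by
  have : ContinuousAt (fun t : ℝ => ((max (1 - t) 0 : ℝ) : ℂ)) t := by fun_prop
  refine this.congr ?_
  filter_upwards [lt_mem_nhds ht] with u hu
  exact (unitTent_of_pos hu).symm

/-- The function equal to `1` on `(0, N]`, to `0` on `[N + 1, ∞)`, and linear between. -/
def ramp (N : ℕ) (t : ℝ) : ℂ :=
  ((N : ℝ) + 1) • unitTent (((N : ℝ) + 1)⁻¹ * t) - (N : ℝ) • unitTent ((N : ℝ)⁻¹ * t)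

/-- For positive `t` the ramp is `(N + 1 - t)₊ - (N - t)₊`, a difference of two dilated tents.
Continuity is what gains the second factor `s + 1` in the denominator, hence absolute convergence.
-/
theorem hasMellin_ramp {N : ℕ} (hN : 1 ≤ N) {s : ℂ} (hs : 0 < s.re) :
    HasMellin (ramp N) s
      ((((N + 1 : ℝ) : ℂ) ^ (s + 1) - ((N : ℝ) : ℂ) ^ (s + 1)) / (s * (s + 1))) := by
  have scale : ∀ a : ℝ, 0 < a → HasMellin (fun t => a • unitTent (a⁻¹ * t)) s
      ((a : ℂ) ^ (s + 1) / (s * (s + 1))) := by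
    intro a ha
    have h := hasMellin_unitTent hs
    have h1 : MellinConvergent (fun t => unitTent (a⁻¹ * t)) s :=
      (MellinConvergent.comp_mul_left (inv_pos.2 ha)).2 h.1
    have h2 := hasMellin_const_smul h1 a
    rw [mellin_comp_mul_left _ _ (inv_pos.2 ha), h.2] at h2
    convert h2 using 1
    have ha' : (a : ℂ) ≠ 0 := by exact_mod_cast ha.ne'
    have : ((a⁻¹ : ℝ) : ℂ) ^ (-s) = (a : ℂ) ^ s := by
      rw [Complex.ofReal_inv, Complex.inv_cpow _ _ (by
        rw [Complex.arg_ofReal_of_nonneg ha.le]; exact Real.pi_pos.ne), Complex.cpow_neg, inv_inv]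
    rw [this, Complex.cpow_add _ _ ha', Complex.cpow_one, Complex.real_smul, smul_eq_mul]
    ring
  have hN0 : (0 : ℝ) < N := by exact_mod_cast hN
  have h1 := scale (N + 1) (by positivity)
  have h2 := scale N hN0
  have h := hasMellin_sub h1.1 h2.1
  rw [h1.2, h2.2, ← sub_div] at h
  exact h

/-- The descent takes place strictly between consecutive integers, so at positive integers the
continuous ramp is exactly the sharp cutoff and the Perron formula has no error term. -/
theorem ramp_natCast {N : ℕ} (hN : 1 ≤ N) {r : ℕ} (hr : 1 ≤ r) :
    ramp N r = if r ≤ N then 1 else 0 := by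
  have hN0 : (0 : ℝ) < N := by exact_mod_cast hN
  have hr0 : (0 : ℝ) < r := by exact_mod_cast hr
  rw [ramp, unitTent_of_pos (by positivity), unitTent_of_pos (by positivity)]
  split_ifs with h
  · have hrN : (r : ℝ) ≤ N := by exact_mod_cast h
    rw [max_eq_left, max_eq_left]
    · rw [Complex.real_smul, Complex.real_smul, ← Complex.ofReal_mul, ← Complex.ofReal_mul,
        ← Complex.ofReal_sub, ← Complex.ofReal_one]
      congr 1
      field_simp
      ring
    · rw [inv_mul_eq_div, sub_nonneg, div_le_one hN0]
      exact hrN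
    · rw [inv_mul_eq_div, sub_nonneg, div_le_one (by positivity)]
      linarith
  · have hrN : (N : ℝ) + 1 ≤ r := by exact_mod_cast (not_le.1 h)
    rw [max_eq_right, max_eq_right]
    · simp
    · rw [inv_mul_eq_div, sub_nonpos, one_le_div hN0]
      linarith
    · rw [inv_mul_eq_div, sub_nonpos, one_le_div (by positivity)]
      exact hrN

theorem continuousAt_ramp {N : ℕ} (hN : 1 ≤ N) {t : ℝ} (ht : 0 < t) :
    ContinuousAt (ramp N) t := by
  have hN0 : (0 : ℝ) < N := by exact_mod_cast hN
  have h : ∀ a : ℝ, 0 < a → ContinuousAt (fun t => a • unitTent (a⁻¹ * t)) t := by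
    intro a ha
    have h1 : ContinuousAt (fun t : ℝ => a⁻¹ * t) t := by fun_prop
    have h2 : ContinuousAt unitTent (a⁻¹ * t) := continuousAt_unitTent (by positivity)
    exact (ContinuousAt.comp (f := fun t : ℝ => a⁻¹ * t) h2 h1).const_smul a
  exact (h (N + 1) (by positivity)).sub (h N hN0)

/-- The mean value inequality on `[N, N + 1]`. Compared with bounding the two powers separately it
saves a factor of about `N`, at the cost of `|s + 1|`; this is the useful bound for small `|s|`. -/
theorem norm_cpow_add_one_sub_le {N : ℕ} (hN : 1 ≤ N) {s : ℂ} (hs : 0 < s.re) :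
    ‖((N + 1 : ℝ) : ℂ) ^ (s + 1) - ((N : ℝ) : ℂ) ^ (s + 1)‖ ≤ ‖s + 1‖ * (N + 1 : ℝ) ^ s.re := by
  have hN0 : (0 : ℝ) < N := by exact_mod_cast hN
  have hd : ∀ x ∈ Set.Icc (N : ℝ) (N + 1), HasDerivWithinAt (fun u : ℝ => (u : ℂ) ^ (s + 1))
      ((s + 1) * (x : ℂ) ^ s) (Set.Icc (N : ℝ) (N + 1)) x := by
    intro x hx
    have hx0 : 0 < x := hN0.trans_le hx.1
    have h := (hasDerivAt_id (x : ℂ)).cpow_const (c := s + 1)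
      (by simp [Complex.ofReal_mem_slitPlane, hx0])
    have h2 := h.comp_ofReal
    simp only [id, add_sub_cancel_right, mul_one] at h2
    exact h2.hasDerivWithinAt
  have := (convex_Icc (N : ℝ) (N + 1)).norm_image_sub_le_of_norm_hasDerivWithin_le hd
    (C := ‖s + 1‖ * (N + 1 : ℝ) ^ s.re) (fun x hx => by
      have hx0 : 0 < x := hN0.trans_le hx.1
      rw [norm_mul, Complex.norm_cpow_eq_rpow_re_of_pos hx0]
      gcongr
      exact hx.2)
    (Set.left_mem_Icc.2 (by linarith)) (Set.right_mem_Icc.2 (by linarith))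
  simpa using this

/-- The numerator bound for the kernel of the truncated Perron formula. -/
theorem norm_mellin_ramp_le {N : ℕ} (hN : 1 ≤ N) {L : ℝ} (hL : 1 ≤ L)
    (hNL : (N : ℝ) + 1 ≤ Real.exp L) (t : ℝ) :
    ‖mellin (ramp N) (((1 / L : ℝ) : ℂ) + t * Complex.I)‖
      ≤ 64 * L ^ 2 * (1 + |t|) ^ (-(1 + 1 / L)) := by
  have hL0 : 0 < L := by linarith
  set σ : ℝ := 1 / L with hσ
  have hσ0 : 0 < σ := by positivity
  have hσ1 : σ ≤ 1 := by rw [hσ, div_le_one hL0]; exact hL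
  set s : ℂ := (σ : ℂ) + t * Complex.I with hs
  have hre : s.re = σ := by simp [hs]
  have him : s.im = t := by simp [hs]
  have hspos : 0 < s.re := by rw [hre]; exact hσ0
  have hexp : Real.exp 1 ≤ 2.72 := by linarith [Real.exp_one_lt_d9]
  have hexp0 : 0 < Real.exp 1 := Real.exp_pos 1
  have hNσ : ((N : ℝ) + 1) ^ σ ≤ Real.exp 1 := by
    calc ((N : ℝ) + 1) ^ σ ≤ (Real.exp L) ^ σ := by gcongr
      _ = Real.exp 1 := by
        rw [← Real.exp_mul, hσ, mul_one_div_cancel hL0.ne']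
  have hn1 : σ ≤ ‖s‖ := by
    have := Complex.abs_re_le_norm s
    rw [hre, abs_of_pos hσ0] at this
    exact this
  have hn2 : |t| ≤ ‖s‖ := by
    have := Complex.abs_im_le_norm s
    rwa [him] at this
  have hs0 : 0 < ‖s‖ := hσ0.trans_le hn1
  have hs1 : ‖s‖ ≤ ‖s + 1‖ := by
    rw [Complex.norm_def, Complex.norm_def]
    refine Real.sqrt_le_sqrt ?_
    rw [Complex.normSq_apply, Complex.normSq_apply]
    simp only [Complex.add_re, Complex.one_re, Complex.add_im, Complex.one_im, add_zero]
    nlinarith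
  have hs10 : 0 < ‖s + 1‖ := hs0.trans_le hs1
  set G : ℝ := ‖((N + 1 : ℝ) : ℂ) ^ (s + 1) - ((N : ℝ) : ℂ) ^ (s + 1)‖ with hG
  have hN0 : (0 : ℝ) < N := by exact_mod_cast hN
  have hG1 : G ≤ ‖s + 1‖ * Real.exp 1 := by
    refine (norm_cpow_add_one_sub_le hN hspos).trans ?_
    rw [hre]
    gcongr
  have hG2 : G ≤ 2 * (Real.exp L * Real.exp 1) := by
    have hb : ∀ a : ℝ, 0 < a → a ≤ N + 1 → ‖(a : ℂ) ^ (s + 1)‖ ≤ Real.exp L * Real.exp 1 := by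
      intro a ha haN
      rw [Complex.norm_cpow_eq_rpow_re_of_pos ha]
      have : (s + 1).re = 1 + σ := by simp [hre, add_comm]
      rw [this, Real.rpow_add ha, Real.rpow_one]
      have h1 : a ^ σ ≤ Real.exp 1 := (Real.rpow_le_rpow ha.le haN hσ0.le).trans hNσ
      have h2 : a ≤ Real.exp L := haN.trans hNL
      gcongr
    refine (norm_sub_le _ _).trans ?_
    have h1 := hb (N + 1) (by positivity) le_rfl
    have h2 := hb N hN0 (by linarith)
    linarith
  rw [(hasMellin_ramp hN hspos).2, norm_div, norm_mul, ← hG]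
  have hmain : G / (‖s‖ * ‖s + 1‖) ≤ 16 * ‖s‖ ^ (-(1 + σ)) := by
    rw [div_le_iff₀ (by positivity)]
    have e : ‖s‖ ^ (-(1 + σ)) * ‖s‖ = ‖s‖ ^ (-σ) := by
      nth_rewrite 2 [← Real.rpow_one ‖s‖]
      rw [← Real.rpow_add hs0]
      congr 1
      ring
    rw [mul_assoc, ← mul_assoc _ ‖s‖, e]
    -- For `|s| ≤ e^L` the mean value bound gives `1/|s|`, and `|s|^σ ≤ e` supplies the missing
    -- decay for free. Beyond `e^L` the separate bounds give `e^L/|s|²`, and `e^L ≤ e |s|^(1 - σ)`.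
    -- With `σ = 1/L` both are of size `|s|^(-1-σ)`, independently of `N`.
    rcases le_total ‖s‖ (Real.exp L) with h | h
    · have h1 : 1 ≤ Real.exp 1 * ‖s‖ ^ (-σ) := by
        rw [Real.rpow_neg hs0.le, ← div_eq_mul_inv, one_le_div (by positivity)]
        calc ‖s‖ ^ σ ≤ (Real.exp L) ^ σ := by gcongr
          _ = Real.exp 1 := by
            rw [← Real.exp_mul, hσ, mul_one_div_cancel hL0.ne']
      have h0 : 0 ≤ ‖s‖ ^ (-σ) := by positivity
      calc G ≤ ‖s + 1‖ * Real.exp 1 := hG1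
        _ ≤ ‖s + 1‖ * Real.exp 1 * (Real.exp 1 * ‖s‖ ^ (-σ)) :=
          le_mul_of_one_le_right (by positivity) h1
        _ = (Real.exp 1 * Real.exp 1) * (‖s‖ ^ (-σ) * ‖s + 1‖) := by ring
        _ ≤ 16 * (‖s‖ ^ (-σ) * ‖s + 1‖) := by
          gcongr
          nlinarith
    · have h1 : Real.exp L ≤ Real.exp 1 * (‖s‖ ^ (-σ) * ‖s‖) := by
        have e2 : ‖s‖ ^ (-σ) * ‖s‖ = ‖s‖ ^ (1 - σ) := by
          nth_rewrite 2 [← Real.rpow_one ‖s‖]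
          rw [← Real.rpow_add hs0]
          congr 1
          ring
        rw [e2]
        calc Real.exp L = Real.exp 1 * (Real.exp L) ^ (1 - σ) := by
              rw [← Real.exp_mul, ← Real.exp_add]
              congr 1
              rw [hσ]
              field_simp
              ring
          _ ≤ _ := by
            gcongr
      have h0 : 0 ≤ ‖s‖ ^ (-σ) := by positivity
      have h2 : Real.exp L ≤ Real.exp 1 * (‖s‖ ^ (-σ) * ‖s + 1‖) := by
        refine h1.trans ?_
        gcongr
      have h3 : 0 ≤ ‖s‖ ^ (-σ) * ‖s + 1‖ := by positivity
      calc G ≤ 2 * (Real.exp L * Real.exp 1) := hG2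
        _ ≤ 2 * (Real.exp 1 * (‖s‖ ^ (-σ) * ‖s + 1‖) * Real.exp 1) := by gcongr
        _ = (2 * Real.exp 1 * Real.exp 1) * (‖s‖ ^ (-σ) * ‖s + 1‖) := by ring
        _ ≤ 16 * (‖s‖ ^ (-σ) * ‖s + 1‖) := by
          gcongr
          nlinarith
  refine hmain.trans ?_
  -- Averages `|s| ≥ |t|` with `|s| ≥ 1/L`, the latter being needed near `t = 0`.
  have hlow : (1 + |t|) / (2 * L) ≤ ‖s‖ := by
    rw [div_le_iff₀ (by positivity)]
    have : 1 ≤ ‖s‖ * L := by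
      rw [hσ, div_le_iff₀ hL0] at hn1
      exact hn1
    nlinarith [abs_nonneg t]
  have ht1 : 0 < 1 + |t| := by positivity
  have h5 : ‖s‖ ^ (-(1 + σ)) ≤ ((1 + |t|) / (2 * L)) ^ (-(1 + σ)) :=
    Real.rpow_le_rpow_of_nonpos (by positivity) hlow (by linarith)
  have h6 : ((1 + |t|) / (2 * L)) ^ (-(1 + σ)) = (2 * L) ^ (1 + σ) * (1 + |t|) ^ (-(1 + σ)) := by
    rw [Real.div_rpow ht1.le (by positivity), Real.rpow_neg (by positivity : 0 ≤ 2 * L),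
      div_inv_eq_mul, mul_comm]
  have h7 : (2 * L) ^ (1 + σ) ≤ 4 * L ^ 2 := by
    calc (2 * L) ^ (1 + σ) ≤ (2 * L) ^ (2 : ℝ) :=
          Real.rpow_le_rpow_of_exponent_le (by linarith) (by linarith)
      _ = 4 * L ^ 2 := by
          rw [Real.rpow_two]
          ring
  calc 16 * ‖s‖ ^ (-(1 + σ)) ≤ 16 * (4 * L ^ 2 * (1 + |t|) ^ (-(1 + σ))) := by
        rw [h6] at h5
        refine mul_le_mul_of_nonneg_left (h5.trans ?_) (by norm_num)
        gcongr
    _ = _ := by ring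

/-- A truncated Perron formula with a majorant of the kernel that does not depend on the length
of the sum. -/
theorem exists_perron_kernel {N : ℕ} (hN : 1 ≤ N) {L : ℝ} (hL : 1 ≤ L)
    (hNL : (N : ℝ) + 1 ≤ Real.exp L) :
    ∃ w : ℝ → ℂ, Continuous w ∧ (∀ t, ‖w t‖ ≤ 64 * L ^ 2 * (1 + |t|) ^ (-(1 + 1 / L))) ∧
      ∀ r : ℕ, 1 ≤ r → ∫ t : ℝ, w t * (r : ℂ) ^ (-(((1 / L : ℝ) : ℂ) + t * Complex.I))
        = if r ≤ N then 1 else 0 := by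
  have hL0 : 0 < L := by linarith
  set σ : ℝ := 1 / L with hσ
  have hσ0 : 0 < σ := by positivity
  have hN0 : (0 : ℝ) < N := by exact_mod_cast hN
  have hcont : Continuous fun t : ℝ => mellin (ramp N) ((σ : ℂ) + t * Complex.I) := by
    have e : (fun t : ℝ => mellin (ramp N) ((σ : ℂ) + t * Complex.I)) = fun t : ℝ =>
        (((N + 1 : ℝ) : ℂ) ^ ((σ : ℂ) + t * Complex.I + 1)
          - ((N : ℝ) : ℂ) ^ ((σ : ℂ) + t * Complex.I + 1)) /
          (((σ : ℂ) + t * Complex.I) * ((σ : ℂ) + t * Complex.I + 1)) := by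
      funext t
      exact (hasMellin_ramp hN (by simpa using hσ0)).2
    rw [e]
    have h1 : ((N + 1 : ℝ) : ℂ) ≠ 0 := by exact_mod_cast (by positivity : (N + 1 : ℝ) ≠ 0)
    have h2 : ((N : ℝ) : ℂ) ≠ 0 := by exact_mod_cast hN0.ne'
    refine Continuous.div ?_ (by fun_prop) ?_
    · refine Continuous.sub ?_ ?_
      · exact Continuous.const_cpow (by fun_prop) (Or.inl h1)
      · exact Continuous.const_cpow (by fun_prop) (Or.inl h2)
    · intro t
      refine mul_ne_zero ?_ ?_
      all_goals
        intro h
        have := congrArg Complex.re h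
        simp at this
        linarith
  have hpi : (1 : ℝ) / (2 * Real.pi) ≤ 1 := by
    rw [div_le_one (by positivity)]
    linarith [Real.pi_gt_three]
  refine ⟨fun t => (1 / (2 * Real.pi) : ℝ) • mellin (ramp N) ((σ : ℂ) + t * Complex.I),
    by fun_prop, fun t => ?_, fun r hr => ?_⟩
  · rw [norm_smul, Real.norm_of_nonneg (by positivity)]
    refine (mul_le_of_le_one_left (norm_nonneg _) hpi).trans ?_
    exact norm_mellin_ramp_le hN hL hNL t
  · have hr0 : (0 : ℝ) < r := by exact_mod_cast hr
    have hint : Complex.VerticalIntegrable (mellin (ramp N)) σ := by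
      refine MeasureTheory.Integrable.mono' (((integrable_one_add_abs_rpow hσ0).const_mul
        (64 * L ^ 2))) hcont.aestronglyMeasurable ?_
      exact Filter.Eventually.of_forall fun t => norm_mellin_ramp_le hN hL hNL t
    have h := mellinInv_mellin_eq σ (ramp N) hr0
      (hasMellin_ramp hN (s := (σ : ℂ)) (by simpa using hσ0)).1 hint (continuousAt_ramp hN hr0)
    rw [ramp_natCast hN hr, mellinInv, ← MeasureTheory.integral_smul] at h
    rw [← h]
    congr 1
    funext t
    simp only [Complex.real_smul, smul_eq_mul, Complex.ofReal_natCast]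
    ring

/-! ### Moments of the divisor function and divisor-bounded functions -/

theorem sum_Ioc_sum_divisorsAntidiagonal {M : Type*} [AddCommMonoid M] (F : ℕ → ℕ → M) (N : ℕ) :
    ∑ n ∈ Ioc 0 N, ∑ x ∈ n.divisorsAntidiagonal, F x.1 x.2
      = ∑ x ∈ (Ioc 0 N ×ˢ Ioc 0 N) with x.1 * x.2 ≤ N, F x.1 x.2 := by
  rw [Finset.sum_sigma']
  refine Finset.sum_bij' (fun x _ => x.2) (fun x _ => ⟨x.1 * x.2, x⟩) ?_ ?_ ?_ ?_ ?_
  · rintro ⟨n, x⟩ h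
    simp only [mem_sigma, mem_Ioc, Nat.mem_divisorsAntidiagonal, mem_filter, mem_product] at h ⊢
    obtain ⟨⟨h1, h2⟩, h3, -⟩ := h
    have hx1 : 0 < x.1 := Nat.pos_of_ne_zero fun h => by simp [h] at h3; omega
    have hx2 : 0 < x.2 := Nat.pos_of_ne_zero fun h => by simp [h] at h3; omega
    have := Nat.le_mul_of_pos_right x.1 hx2
    have := Nat.le_mul_of_pos_left x.2 hx1
    omega
  · rintro x h
    simp only [mem_sigma, mem_Ioc, Nat.mem_divisorsAntidiagonal, mem_filter, mem_product] at h ⊢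
    obtain ⟨⟨⟨h1, h2⟩, h3, h4⟩, h5⟩ := h
    have := Nat.mul_pos h1 h3
    exact ⟨⟨this, h5⟩, trivial, this.ne'⟩
  · rintro ⟨n, x⟩ h
    simp only [mem_sigma, Nat.mem_divisorsAntidiagonal] at h
    obtain ⟨-, rfl, -⟩ := h
    rfl
  · rintro x _
    rfl
  · rintro x _
    rfl

/-- The number of divisors, as a real number. -/
def tau (n : ℕ) : ℝ := (n.divisors.card : ℝ)

theorem tau_nonneg (n : ℕ) : 0 ≤ tau n := Nat.cast_nonneg _

theorem one_le_tau {n : ℕ} (hn : n ≠ 0) : 1 ≤ tau n := by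
  have : 0 < n.divisors.card := Finset.card_pos.2 ⟨1, by simp [hn]⟩
  rw [tau]
  exact_mod_cast this

theorem tau_mul_le (m n : ℕ) : tau (m * n) ≤ tau m * tau n := by
  classical
  rw [tau, tau, tau, ← Nat.cast_mul, Nat.divisors_mul]
  exact_mod_cast Finset.card_mul_le

theorem tau_le_of_dvd {m n : ℕ} (hn : n ≠ 0) (h : m ∣ n) : tau m ≤ tau n := by
  rw [tau, tau]
  exact_mod_cast Finset.card_le_card (Nat.divisors_subset_of_dvd hn h)

theorem card_divisorsAntidiagonal_eq_tau (n : ℕ) : (n.divisorsAntidiagonal.card : ℝ) = tau n := by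
  rw [tau, ← Nat.map_div_right_divisors, Finset.card_map]

/-- Induction on the exponent: one factor `τ(n)` counts the factorizations `n = uv`, and
submultiplicativity splits the rest, so each sum is at most the square of the previous one. The
exponent of the logarithm therefore doubles. -/
theorem sum_tau_pow_div_le (j N : ℕ) :
    ∑ n ∈ Ioc 0 N, tau n ^ j / n ≤ (1 + Real.log N) ^ (2 ^ j) := by
  induction j with
  | zero => simpa using sum_one_div_le N
  | succ j ih =>
    have h0 : 0 ≤ ∑ n ∈ Ioc 0 N, tau n ^ j / n :=
      Finset.sum_nonneg fun n _ => div_nonneg (pow_nonneg (tau_nonneg n) j) (Nat.cast_nonneg n)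
    have hF : ∀ x : ℕ × ℕ, 0 ≤ (tau x.1 ^ j / x.1) * (tau x.2 ^ j / x.2) := fun x =>
      mul_nonneg (div_nonneg (pow_nonneg (tau_nonneg _) j) (Nat.cast_nonneg _))
        (div_nonneg (pow_nonneg (tau_nonneg _) j) (Nat.cast_nonneg _))
    calc ∑ n ∈ Ioc 0 N, tau n ^ (j + 1) / n
        ≤ ∑ n ∈ Ioc 0 N, ∑ x ∈ n.divisorsAntidiagonal,
            (tau x.1 ^ j / x.1) * (tau x.2 ^ j / x.2) := by
          refine Finset.sum_le_sum fun n hn => ?_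
          have e : tau n ^ (j + 1) / n = ∑ x ∈ n.divisorsAntidiagonal, tau n ^ j / n := by
            rw [Finset.sum_const, nsmul_eq_mul, card_divisorsAntidiagonal_eq_tau]
            ring
          rw [e]
          refine Finset.sum_le_sum fun x hx => ?_
          obtain ⟨rfl, -⟩ := Nat.mem_divisorsAntidiagonal.1 hx
          rw [div_mul_div_comm, ← mul_pow, Nat.cast_mul]
          gcongr
          · exact tau_nonneg _
          · exact tau_mul_le _ _
      _ = ∑ x ∈ (Ioc 0 N ×ˢ Ioc 0 N) with x.1 * x.2 ≤ N,
            (tau x.1 ^ j / x.1) * (tau x.2 ^ j / x.2) :=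
          sum_Ioc_sum_divisorsAntidiagonal
            (fun a b => (tau a ^ j / a) * (tau b ^ j / b)) N
      _ ≤ ∑ x ∈ Ioc 0 N ×ˢ Ioc 0 N, (tau x.1 ^ j / x.1) * (tau x.2 ^ j / x.2) :=
          Finset.sum_le_sum_of_subset_of_nonneg (Finset.filter_subset _ _) fun x _ _ => hF x
      _ = (∑ n ∈ Ioc 0 N, tau n ^ j / n) ^ 2 := by
          rw [sq, Finset.sum_mul_sum, Finset.sum_product]
      _ ≤ ((1 + Real.log N) ^ (2 ^ j)) ^ 2 := pow_le_pow_left₀ h0 ih 2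
      _ = _ := by rw [← pow_mul, pow_succ]

theorem sum_tau_pow_le (j N : ℕ) :
    ∑ n ∈ Ioc 0 N, tau n ^ j ≤ N * (1 + Real.log N) ^ (2 ^ j) := by
  refine le_trans ?_ (mul_le_mul_of_nonneg_left (sum_tau_pow_div_le j N) (Nat.cast_nonneg N))
  rw [Finset.mul_sum]
  refine Finset.sum_le_sum fun n hn => ?_
  have hn := mem_Ioc.1 hn
  have hn0 : (0 : ℝ) < n := by exact_mod_cast hn.1
  have hnN : (n : ℝ) ≤ N := by exact_mod_cast hn.2
  rw [mul_div_assoc', le_div_iff₀ hn0, mul_comm]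
  exact mul_le_mul_of_nonneg_right hnN (pow_nonneg (tau_nonneg n) j)

/-- The bound `|f(n)| ≤ B τ(n)^j` for `n ≤ Z`. -/
def DivisorBounded (Z B : ℝ) (j : ℕ) (f : ArithmeticFunction ℝ) : Prop :=
  ∀ n : ℕ, (n : ℝ) ≤ Z → |f n| ≤ B * tau n ^ j

theorem DivisorBounded.mul {Z B B' : ℝ} {j j' : ℕ} {f g : ArithmeticFunction ℝ}
    (hB : 0 ≤ B) (hf : DivisorBounded Z B j f) (hg : DivisorBounded Z B' j' g) :
    DivisorBounded Z (B * B') (j + j' + 1) (f * g) := by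
  intro n hn
  rw [ArithmeticFunction.mul_apply]
  have hb : ∀ x ∈ n.divisorsAntidiagonal, |f x.1 * g x.2| ≤ B * B' * tau n ^ (j + j') := by
    intro x hx
    obtain ⟨hxn, hn0⟩ := Nat.mem_divisorsAntidiagonal.1 hx
    have h1 : x.1 ∣ n := Dvd.intro _ hxn
    have h2 : x.2 ∣ n := Dvd.intro_left _ hxn
    have hz1 : (x.1 : ℝ) ≤ Z := le_trans (by exact_mod_cast Nat.le_of_dvd (by omega) h1) hn
    have hz2 : (x.2 : ℝ) ≤ Z := le_trans (by exact_mod_cast Nat.le_of_dvd (by omega) h2) hn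
    have hB' : 0 ≤ B' * tau x.2 ^ j' := (abs_nonneg _).trans (hg _ hz2)
    have hx20 : 0 < tau x.2 :=
      lt_of_lt_of_le one_pos (one_le_tau (ne_zero_of_dvd_ne_zero hn0 h2))
    have hB0 : 0 ≤ B' := nonneg_of_mul_nonneg_left hB' (pow_pos hx20 _)
    rw [abs_mul]
    calc |f x.1| * |g x.2| ≤ (B * tau x.1 ^ j) * (B' * tau x.2 ^ j') :=
          mul_le_mul (hf _ hz1) (hg _ hz2) (abs_nonneg _)
            (mul_nonneg hB (pow_nonneg (tau_nonneg _) _))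
      _ ≤ (B * tau n ^ j) * (B' * tau n ^ j') := by
          have := tau_nonneg x.1
          have := tau_nonneg x.2
          have := tau_nonneg n
          have := tau_le_of_dvd hn0 h1
          have := tau_le_of_dvd hn0 h2
          gcongr
      _ = _ := by ring
  refine (Finset.abs_sum_le_sum_abs _ _).trans ((Finset.sum_le_sum hb).trans (le_of_eq ?_))
  rw [Finset.sum_const, nsmul_eq_mul, card_divisorsAntidiagonal_eq_tau]
  ring

theorem DivisorBounded.mono {Z B B' : ℝ} {j j' : ℕ} {f : ArithmeticFunction ℝ}
    (hf : DivisorBounded Z B j f) (hB0 : 0 ≤ B) (hB : B ≤ B') (hj : j ≤ j') :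
    DivisorBounded Z B' j' f := by
  intro n hn
  rcases eq_or_ne n 0 with rfl | h0
  · simpa using mul_nonneg (hB0.trans hB) (pow_nonneg (tau_nonneg 0) j')
  · have h1 := one_le_tau h0
    refine (hf n hn).trans ?_
    have := pow_le_pow_right₀ h1 hj
    have h2 : 0 ≤ tau n ^ j := by positivity
    exact mul_le_mul hB this h2 (hB0.trans hB)

/-! ### Convolutions at multiples of a fixed integer -/

/-- Dividing `uv = md` by `gcd(u, d)` gives `av = mb` with `a`, `b` coprime, so `b ∣ v`. The
coprimality condition makes the splitting of `d` between `u` and `v` unique, which is what allows a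
bijection in `mul_apply_mul`. -/
theorem exists_factor_of_mul_eq_mul {u v m d : ℕ} (hd : d ≠ 0) (h : u * v = m * d) :
    ∃ a b c, Nat.Coprime a b ∧ b ≠ 0 ∧ Nat.gcd u d * b = d ∧ a * c = m ∧
      u = a * Nat.gcd u d ∧ v = c * b ∧ d / Nat.gcd u d = b ∧ u / Nat.gcd u d = a ∧ v / b = c := by
  obtain ⟨a, b, hco, hu, hd'⟩ := Nat.exists_coprime u d
  have hg : 0 < Nat.gcd u d := Nat.gcd_pos_of_pos_right _ (Nat.pos_of_ne_zero hd)
  have hb : b ≠ 0 := fun hb => hd (by rw [hd', hb, zero_mul])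
  have h1 : a * v = m * b := by
    refine Nat.eq_of_mul_eq_mul_right hg ?_
    calc a * v * Nat.gcd u d = (a * Nat.gcd u d) * v := by ring
      _ = m * (b * Nat.gcd u d) := by rw [← hu, ← hd', h]
      _ = m * b * Nat.gcd u d := by ring
  obtain ⟨c, rfl⟩ : b ∣ v := hco.symm.dvd_of_dvd_mul_left (Dvd.intro_left _ h1.symm)
  refine ⟨a, b, c, hco, hb, by rw [mul_comm]; exact hd'.symm, ?_, hu, by ring, ?_, ?_, ?_⟩
  · refine Nat.eq_of_mul_eq_mul_right (Nat.pos_of_ne_zero hb) ?_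
    rw [← h1]
    ring
  · exact Nat.div_eq_of_eq_mul_left hg hd'
  · exact Nat.div_eq_of_eq_mul_left hg hu
  · exact Nat.mul_div_cancel_left _ (Nat.pos_of_ne_zero hb)

/-- The value of a Dirichlet convolution at a multiple of `d`. -/
theorem mul_apply_mul (f g : ArithmeticFunction ℝ) {m d : ℕ} (hm : m ≠ 0) (hd : d ≠ 0) :
    (f * g) (m * d) = ∑ p ∈ d.divisorsAntidiagonal, ∑ x ∈ m.divisorsAntidiagonal,
      if Nat.Coprime x.1 p.2 then f (x.1 * p.1) * g (x.2 * p.2) else 0 := by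
  rw [ArithmeticFunction.mul_apply, ← Finset.sum_product', ← Finset.sum_filter]
  symm
  refine Finset.sum_bij' (fun z _ => (z.2.1 * z.1.1, z.2.2 * z.1.2))
    (fun z _ => ((Nat.gcd z.1 d, d / Nat.gcd z.1 d),
      (z.1 / Nat.gcd z.1 d, z.2 / (d / Nat.gcd z.1 d)))) ?_ ?_ ?_ ?_ ?_
  · rintro ⟨⟨p, q⟩, ⟨x, y⟩⟩ h
    simp only [mem_filter, mem_product, Nat.mem_divisorsAntidiagonal] at h ⊢
    obtain ⟨⟨⟨rfl, -⟩, rfl, -⟩, -⟩ := h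
    exact ⟨by ring, mul_ne_zero hm hd⟩
  · rintro ⟨u, v⟩ h
    simp only [mem_filter, mem_product, Nat.mem_divisorsAntidiagonal] at h ⊢
    obtain ⟨huv, -⟩ := h
    obtain ⟨a, b, c, hco, hb, hgb, hac, -, -, e1, e2, e3⟩ := exists_factor_of_mul_eq_mul hd huv
    rw [e1, e2, e3]
    exact ⟨⟨⟨hgb, hd⟩, hac, hm⟩, hco⟩
  · rintro ⟨⟨p, q⟩, ⟨x, y⟩⟩ h
    simp only [mem_filter, mem_product, Nat.mem_divisorsAntidiagonal] at h ⊢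
    obtain ⟨⟨⟨rfl, -⟩, rfl, -⟩, hco⟩ := h
    have hp : 0 < p := Nat.pos_of_ne_zero fun h => by simp [h] at hd
    have hq : 0 < q := Nat.pos_of_ne_zero fun h => by simp [h] at hd
    have hgcd : Nat.gcd (x * p) (p * q) = p := by
      rw [mul_comm p q, Nat.gcd_mul_right, hco.gcd_eq_one, one_mul]
    rw [hgcd, Nat.mul_div_cancel_left _ hp, Nat.mul_div_cancel _ hp, Nat.mul_div_cancel _ hq]
  · rintro ⟨u, v⟩ h
    simp only [Nat.mem_divisorsAntidiagonal] at h
    obtain ⟨a, b, c, hco, hb, hgb, hac, hu, hv, e1, e2, e3⟩ := exists_factor_of_mul_eq_mul hd h.1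
    simp only [e1, e2, e3]
    rw [← hu, ← hv]
  · rintro ⟨⟨p, q⟩, ⟨x, y⟩⟩ _
    rfl

/-! ### Removing a variable length of summation from a mean value -/

/-- The majorant of the kernel in the truncated Perron formula. -/
def perronMajorant (L t : ℝ) : ℝ := 64 * L ^ 2 * (1 + |t|) ^ (-(1 + 1 / L))

theorem perronMajorant_nonneg (L t : ℝ) : 0 ≤ perronMajorant L t := by
  unfold perronMajorant
  positivity

theorem integrable_perronMajorant {L : ℝ} (hL : 0 < L) :
    MeasureTheory.Integrable (perronMajorant L) :=
  (integrable_one_add_abs_rpow (b := 1 / L) (by positivity)).const_mul _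

theorem integral_perronMajorant {L : ℝ} (hL : 0 < L) :
    ∫ t, perronMajorant L t = 128 * L ^ 3 := by
  unfold perronMajorant
  rw [MeasureTheory.integral_const_mul, integral_one_add_abs_rpow (by positivity)]
  field_simp
  norm_num

/-- The point `1 / L + it`. -/
def perronPoint (L t : ℝ) : ℂ := ((1 / L : ℝ) : ℂ) + t * Complex.I

theorem norm_natCast_cpow_le {L : ℝ} (hL : 0 < L) (t : ℝ) {r : ℕ} (hr : 1 ≤ r) :
    ‖(r : ℂ) ^ (-perronPoint L t)‖ ≤ 1 := by
  rw [Complex.norm_natCast_cpow_of_pos hr]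
  refine Real.rpow_le_one_of_one_le_of_nonpos (by exact_mod_cast hr) ?_
  simp [perronPoint]
  positivity

theorem continuous_natCast_cpow (L : ℝ) {r : ℕ} (hr : 1 ≤ r) :
    Continuous fun t : ℝ => (r : ℂ) ^ (-perronPoint L t) := by
  refine Continuous.const_cpow ?_ (Or.inl (by exact_mod_cast (by omega : r ≠ 0)))
  unfold perronPoint
  fun_prop

section Perron

variable {ι : Type*} (I : Finset ι) (c : ι → ℂ) (r : ι → ℕ) {L : ℝ}

theorem continuous_sum_mul_cpow (hr : ∀ i ∈ I, 1 ≤ r i) :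
    Continuous fun t : ℝ => ∑ i ∈ I, c i * (r i : ℂ) ^ (-perronPoint L t) :=
  continuous_finsetSum _ fun i hi => continuous_const.mul (continuous_natCast_cpow L (hr i hi))

theorem integrable_perronMajorant_mul (hL : 0 < L) (hr : ∀ i ∈ I, 1 ≤ r i) :
    MeasureTheory.Integrable fun t : ℝ =>
      perronMajorant L t * ‖∑ i ∈ I, c i * (r i : ℂ) ^ (-perronPoint L t)‖ := by
  refine (integrable_perronMajorant hL).mul_bdd (c := ∑ i ∈ I, ‖c i‖)
    (continuous_sum_mul_cpow I c r hr).norm.aestronglyMeasurable ?_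
  refine Filter.Eventually.of_forall fun t => ?_
  rw [norm_norm]
  refine (norm_sum_le _ _).trans (Finset.sum_le_sum fun i hi => ?_)
  rw [norm_mul]
  exact mul_le_of_le_one_right (norm_nonneg _) (norm_natCast_cpow_le hL t (hr i hi))

/-- The kernel depends on `N` but its majorant does not. Once absolute values are taken, the
right-hand side is free of `N`, which may then vary with the modulus. The case `N = 0` is separate
because the ramp needs `N ≥ 1`. -/
theorem norm_sum_filter_le_integral (hL : 1 ≤ L) (hr : ∀ i ∈ I, 1 ≤ r i) {N : ℕ}
    (hN : (N : ℝ) + 1 ≤ Real.exp L) :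
    ‖∑ i ∈ I, if r i ≤ N then c i else 0‖
      ≤ ∫ t, perronMajorant L t * ‖∑ i ∈ I, c i * (r i : ℂ) ^ (-perronPoint L t)‖ := by
  have hL0 : 0 < L := by linarith
  rcases Nat.eq_zero_or_pos N with rfl | hN1
  · rw [Finset.sum_eq_zero fun i hi => if_neg (by have := hr i hi; omega), norm_zero]
    exact MeasureTheory.integral_nonneg fun t =>
      mul_nonneg (perronMajorant_nonneg L t) (norm_nonneg _)
  obtain ⟨w, hwc, hwb, hw⟩ := exists_perron_kernel hN1 hL hN
  have hint : ∀ i ∈ I, MeasureTheory.Integrable fun t : ℝ =>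
      c i * (w t * (r i : ℂ) ^ (-perronPoint L t)) := by
    intro i hi
    refine (MeasureTheory.Integrable.mono' (integrable_perronMajorant hL0)
      (hwc.mul (continuous_natCast_cpow L (hr i hi))).aestronglyMeasurable ?_).const_mul _
    refine Filter.Eventually.of_forall fun t => ?_
    rw [Pi.mul_apply, norm_mul]
    exact (mul_le_of_le_one_right (norm_nonneg _)
      (norm_natCast_cpow_le hL0 t (hr i hi))).trans (hwb t)
  have e : ∑ i ∈ I, (if r i ≤ N then c i else 0)
      = ∫ t, w t * ∑ i ∈ I, c i * (r i : ℂ) ^ (-perronPoint L t) := by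
    have e1 : (fun t => w t * ∑ i ∈ I, c i * (r i : ℂ) ^ (-perronPoint L t))
        = fun t => ∑ i ∈ I, c i * (w t * (r i : ℂ) ^ (-perronPoint L t)) := by
      funext t
      rw [Finset.mul_sum]
      exact Finset.sum_congr rfl fun i _ => by ring
    rw [e1, MeasureTheory.integral_finsetSum _ hint]
    refine Finset.sum_congr rfl fun i hi => ?_
    rw [MeasureTheory.integral_const_mul]
    have := hw (r i) (hr i hi)
    simp only [perronPoint]
    rw [this]
    split_ifs <;> simp
  rw [e]
  refine (MeasureTheory.norm_integral_le_integral_norm _).trans ?_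
  refine MeasureTheory.integral_mono_of_nonneg (Filter.Eventually.of_forall fun t => norm_nonneg _)
    (integrable_perronMajorant_mul I c r hL0 hr) (Filter.Eventually.of_forall fun t => ?_)
  simp only [norm_mul]
  exact mul_le_mul_of_nonneg_right (hwb t) (norm_nonneg _)

/-- Removing the condition `r ≤ N`, with `N` depending on the modulus, from a mean value. -/
theorem charMean_norm_sum_filter_le {Q : ℕ} (c : (q : ℕ) → DirichletCharacter ℂ q → ι → ℂ)
    (hL : 1 ≤ L) (hr : ∀ i ∈ I, 1 ≤ r i) {N : ℕ → ℕ}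
    (hN : ∀ q, q < 2 * Q → (N q : ℝ) + 1 ≤ Real.exp L) {G : ℝ}
    (hG : ∀ t, charMean Q (fun q ψ => ‖∑ i ∈ I, c q ψ i * (r i : ℂ) ^ (-perronPoint L t)‖) ≤ G) :
    charMean Q (fun q ψ => ‖∑ i ∈ I, if r i ≤ N q then c q ψ i else 0‖) ≤ 128 * L ^ 3 * G := by
  have hL0 : 0 < L := by linarith
  have hint := fun q (ψ : DirichletCharacter ℂ q) =>
    integrable_perronMajorant_mul I (c q ψ) r hL0 hr
  calc charMean Q (fun q ψ => ‖∑ i ∈ I, if r i ≤ N q then c q ψ i else 0‖)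
      ≤ charMean Q (fun q ψ => ∫ t, perronMajorant L t *
          ‖∑ i ∈ I, c q ψ i * (r i : ℂ) ^ (-perronPoint L t)‖) :=
        charMean_mono fun q _ hq ψ _ => norm_sum_filter_le_integral I (c q ψ) r hL hr (hN q hq)
    _ = ∫ t, charMean Q (fun q ψ => perronMajorant L t *
          ‖∑ i ∈ I, c q ψ i * (r i : ℂ) ^ (-perronPoint L t)‖) := by
        simp only [charMean]
        rw [MeasureTheory.integral_finsetSum]
        · refine Finset.sum_congr rfl fun q _ => ?_
          rw [MeasureTheory.integral_const_mul, MeasureTheory.integral_finsetSum]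
          exact fun ψ _ => hint q ψ
        · exact fun q _ => (MeasureTheory.integrable_finsetSum _ fun ψ _ => hint q ψ).const_mul _
    _ ≤ ∫ t, perronMajorant L t * G := by
        refine MeasureTheory.integral_mono_of_nonneg
          (Filter.Eventually.of_forall fun t => charMean_nonneg fun q ψ =>
            mul_nonneg (perronMajorant_nonneg L t) (norm_nonneg _))
          ((integrable_perronMajorant hL0).mul_const G)
          (Filter.Eventually.of_forall fun t => ?_)
        simp only [charMean_mul_left]
        exact mul_le_mul_of_nonneg_left (hG t) (perronMajorant_nonneg L t)
    _ = 128 * L ^ 3 * G := by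
        rw [MeasureTheory.integral_mul_const, integral_perronMajorant hL0]

end Perron

/-! ### Bilinear sums through the large sieve -/

/-- The sum of `α(a) β(b) χ(ab)` over `ab ≤ N`. -/
def bilinSum (α β χ : ℕ → ℂ) (N : ℕ) : ℂ :=
  ∑ x ∈ (Ioc 0 N ×ˢ Ioc 0 N) with x.1 * x.2 ≤ N, α x.1 * β x.2 * χ (x.1 * x.2)

theorem bilinSum_eq {α β χ : ℕ → ℂ} {N A B : ℕ}
    (h : ∀ a b, 1 ≤ a → 1 ≤ b → a * b ≤ N → α a ≠ 0 → β b ≠ 0 → a ≤ A ∧ b ≤ B) :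
    bilinSum α β χ N = ∑ x ∈ Ioc 0 A ×ˢ Ioc 0 B,
      if x.1 * x.2 ≤ N then α x.1 * β x.2 * χ (x.1 * x.2) else 0 := by
  rw [bilinSum, Finset.sum_filter]
  refine Finset.sum_congr_of_eq_on_inter ?_ ?_ fun _ _ _ => rfl
  · intro x hx hx'
    simp only [mem_product, mem_Ioc] at hx hx'
    by_contra hne
    rw [ite_eq_right_iff, not_forall] at hne
    obtain ⟨hN, hne⟩ := hne
    have h1 := left_ne_zero_of_mul hne
    have := h x.1 x.2 hx.1.1 hx.2.1 hN (left_ne_zero_of_mul h1) (right_ne_zero_of_mul h1)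
    exact hx' ⟨⟨hx.1.1, this.1⟩, hx.2.1, this.2⟩
  · intro x hx hx'
    simp only [mem_product, mem_Ioc] at hx hx'
    refine if_neg fun hN => hx' ?_
    have := Nat.le_mul_of_pos_right x.1 hx.2.1
    have := Nat.le_mul_of_pos_left x.2 hx.1.1
    omega

theorem log_natCast_le_of_le {Z LL : ℝ} (hLL : 0 ≤ LL) (hZ : Real.log Z ≤ LL) {n : ℕ}
    (hn : (n : ℝ) ≤ Z) : Real.log n ≤ LL := by
  rcases Nat.eq_zero_or_pos n with rfl | h
  · simpa using hLL
  · exact (Real.log_le_log (by exact_mod_cast h) hn).trans hZ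

/-- The large sieve followed by the moment of order `2c` of `τ`: the exponent `4 ^ c` is `2 ^ (2c)`,
doubled because `1 + log K` is bounded by `LL ^ 2`. The slack in `log K ≤ LL + 1` accommodates
dyadic blocks of length `2M`. -/
theorem charMean_dirichletPolynomial_sq_le {LL A : ℝ} (hLL : 2 ≤ LL) {Q K c : ℕ}
    (hQ : 1 ≤ Q) (hQL : Real.log (2 * Q : ℕ) ≤ LL) (hK : Real.log K ≤ LL + 1) {α : ℕ → ℂ}
    (hα : ∀ n, 1 ≤ n → ‖α n‖ ≤ A * tau n ^ c) :
    charMean Q (fun q ψ => ‖∑ n ∈ Ioc 0 K, α n * ψ (n : ZMod q)‖ ^ 2)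
      ≤ LL ^ (8 + 2 * 4 ^ c) * A ^ 2 * ((K + Q ^ 2) * K) := by
  have hLL1 : 1 ≤ LL := by linarith
  refine (charMean_norm_sq_le hQ K α).trans ?_
  have h1 : 8 * (((2 * Q) ^ 2 : ℕ) : ℝ) * (1 + Real.log ((2 * Q) ^ 2 : ℕ)) ≤ LL ^ 8 * Q ^ 2 := by
    have e : Real.log (((2 * Q) ^ 2 : ℕ) : ℝ) = 2 * Real.log (2 * Q : ℕ) := by
      rw [Nat.cast_pow, Real.log_pow]
      norm_num
    rw [e]
    have h3 : 1 + 2 * Real.log (2 * Q : ℕ) ≤ LL ^ 3 := by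
      have h4 : 4 * LL ≤ LL ^ 3 := by
        rw [pow_succ]
        exact mul_le_mul_of_nonneg_right (by nlinarith) (by linarith)
      linarith
    have h5 : (32 : ℝ) ≤ LL ^ 5 := by
      calc (32 : ℝ) = 2 ^ 5 := by norm_num
        _ ≤ LL ^ 5 := by gcongr
    push_cast
    push_cast at h3
    calc 8 * (2 * (Q : ℝ)) ^ 2 * (1 + 2 * Real.log (2 * Q)) ≤ 8 * (2 * (Q : ℝ)) ^ 2 * LL ^ 3 := by
          gcongr
      _ = 32 * (LL ^ 3 * Q ^ 2) := by ring
      _ ≤ LL ^ 5 * (LL ^ 3 * Q ^ 2) := by gcongr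
      _ = _ := by ring
  have h2 : ∑ n ∈ Ioc 0 K, ‖α n‖ ^ 2 ≤ A ^ 2 * (K * LL ^ (2 * 4 ^ c)) := by
    calc ∑ n ∈ Ioc 0 K, ‖α n‖ ^ 2 ≤ ∑ n ∈ Ioc 0 K, A ^ 2 * tau n ^ (2 * c) := by
          refine Finset.sum_le_sum fun n hn => ?_
          refine (pow_le_pow_left₀ (norm_nonneg _) (hα n (mem_Ioc.1 hn).1) 2).trans (le_of_eq ?_)
          ring
      _ ≤ A ^ 2 * (K * (1 + Real.log K) ^ (2 ^ (2 * c))) := by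
          rw [← Finset.mul_sum]
          exact mul_le_mul_of_nonneg_left (sum_tau_pow_le _ _) (by positivity)
      _ ≤ A ^ 2 * (K * (LL ^ 2) ^ (2 ^ (2 * c))) := by
          have h0 : 0 ≤ Real.log K := Real.log_natCast_nonneg K
          have : 1 + Real.log K ≤ LL ^ 2 := by nlinarith
          gcongr
      _ = _ := by
          rw [← pow_mul, pow_mul 2 2 c]
          norm_num
  have h8 : (1 : ℝ) ≤ LL ^ 8 := one_le_pow₀ hLL1
  have hs0 : 0 ≤ ∑ n ∈ Ioc 0 K, ‖α n‖ ^ 2 := Finset.sum_nonneg fun _ _ => by positivity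
  calc _ ≤ (LL ^ 8 * (K + Q ^ 2)) * (A ^ 2 * (K * LL ^ (2 * 4 ^ c))) := by
        refine mul_le_mul ?_ h2 hs0 (by positivity)
        have : (K : ℝ) ≤ LL ^ 8 * K := le_mul_of_one_le_left (Nat.cast_nonneg _) h8
        linarith
    _ = _ := by ring

/-- The product is `MK (MK + Q²(M + K) + Q⁴)`. The hyperbola condition bounds `MK` by `X`, and the
condition that neither variable exceeds `U²` controls the cross term, whose square root becomes `√X
U Q`. -/
theorem large_sieve_product_le {M K Q U X : ℝ} (hM : 0 ≤ M) (hK : 0 ≤ K) (hQ : 0 ≤ Q) (hU : 0 ≤ U)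
    (hX : 0 ≤ X) (hMU : M ≤ U ^ 2) (hKU : K ≤ U ^ 2) (hMK : M * K ≤ X) :
    ((M + Q ^ 2) * M) * ((K + Q ^ 2) * K) ≤ 2 * (X + √X * U * Q + √X * Q ^ 2) ^ 2 := by
  have hs := Real.sq_sqrt hX
  set s := √X with hs'
  have hs0 : 0 ≤ s := Real.sqrt_nonneg X
  have h1 : ((M + Q ^ 2) * M) * ((K + Q ^ 2) * K)
      = (M * K) * (M * K + Q ^ 2 * (M + K) + Q ^ 4) := by ring
  have h2 : (M * K) * (M * K + Q ^ 2 * (M + K) + Q ^ 4) ≤ X * (X + Q ^ 2 * (2 * U ^ 2) + Q ^ 4) := by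
    have : M + K ≤ 2 * U ^ 2 := by linarith
    gcongr
  rw [h1]
  refine h2.trans ?_
  rw [← hs]
  have a1 : 0 ≤ s ^ 2 * (s * U * Q) := by positivity
  have a2 : 0 ≤ s ^ 2 * (s * Q ^ 2) := by positivity
  have a3 : 0 ≤ (s * U * Q) * (s * Q ^ 2) := by positivity
  have a4 : 0 ≤ s ^ 4 := by positivity
  have a5 : 0 ≤ s ^ 2 * Q ^ 4 := by positivity
  nlinarith

/-- The mean value of a bilinear sum whose first variable is in a dyadic block. -/
theorem charMean_bilinSum_dyadic_le {U LL X A B : ℝ} (hU : 1 ≤ U) (hLL : 2 ≤ LL)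
    (hUL : Real.log (U ^ 3) ≤ LL) (hX : 1 ≤ X) (hXU : X ≤ U ^ 3) (hA : 0 ≤ A) (hB : 0 ≤ B)
    {Q c M : ℕ} (hQ : 1 ≤ Q) (hQU : ((2 * Q : ℕ) : ℝ) ≤ U ^ 3) (hM : 1 ≤ M) (hMU : (M : ℝ) ≤ U ^ 2)
    {N : ℕ → ℕ} (hN : ∀ q, q < 2 * Q → (N q : ℝ) ≤ X) {α β : ℕ → ℂ}
    (hα : ∀ n, 1 ≤ n → ‖α n‖ ≤ A * tau n ^ c) (hβ : ∀ n, 1 ≤ n → ‖β n‖ ≤ B * tau n ^ c)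
    (hαs : ∀ n, α n ≠ 0 → M ≤ n ∧ n < 2 * M) (hβs : ∀ n, β n ≠ 0 → (n : ℝ) ≤ U ^ 2) :
    charMean Q (fun q ψ => ‖bilinSum α β (fun n => ψ (n : ZMod q)) (N q)‖)
      ≤ LL ^ (23 + 2 * 4 ^ c) * (A * B) * (X + √X * U * Q + √X * Q ^ 2) := by
  have hU0 : 0 ≤ U := by linarith
  have hMr : (1 : ℝ) ≤ M := by exact_mod_cast hM
  -- With the first variable at least `M`, the condition `ab ≤ X` confines the second to `X/M`; this
  -- is the reason for the dyadic block, since it keeps `MK ≤ X` after the two variables are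
  -- separated.
  set K : ℕ := ⌊min (U ^ 2) (X / M)⌋₊ with hK
  have hmin0 : 0 ≤ min (U ^ 2) (X / M) := le_min (by positivity) (by positivity)
  have hKmin : (K : ℝ) ≤ min (U ^ 2) (X / M) := Nat.floor_le hmin0
  have hKU : (K : ℝ) ≤ U ^ 2 := hKmin.trans (min_le_left _ _)
  have hMK : (M : ℝ) * K ≤ X := by
    have := hKmin.trans (min_le_right _ _)
    rw [le_div_iff₀ (by linarith)] at this
    linarith
  have hU23 : U ^ 2 ≤ U ^ 3 := pow_le_pow_right₀ hU (by norm_num)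
  have hL : (1 : ℝ) ≤ 2 * LL := by linarith
  -- The Perron parameter is `2 * LL` rather than `LL` to leave room for the `+ 1` in `N + 1`.
  have hNL : ∀ q, q < 2 * Q → (N q : ℝ) + 1 ≤ Real.exp (2 * LL) := by
    intro q hq
    have h1 : U ^ 3 ≤ Real.exp LL := by
      rwa [← Real.log_le_iff_le_exp (by positivity)]
    have h2 : (2 : ℝ) ≤ Real.exp LL := by linarith [Real.add_one_le_exp LL]
    have h3 := hN q hq
    rw [two_mul, Real.exp_add]
    nlinarith
  set E : ℝ := X + √X * U * Q + √X * Q ^ 2 with hE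
  have hE0 : 0 ≤ E := by positivity
  set I : Finset (ℕ × ℕ) := Ioc 0 (2 * M) ×ˢ Ioc 0 K with hI
  have hrI : ∀ x ∈ I, 1 ≤ x.1 * x.2 := by
    intro x hx
    simp only [hI, mem_product, mem_Ioc] at hx
    exact Nat.mul_pos hx.1.1 hx.2.1
  have hlogQ : Real.log (2 * Q : ℕ) ≤ LL := log_natCast_le_of_le (by linarith) hUL hQU
  have hlogK : Real.log K ≤ LL + 1 :=
    (log_natCast_le_of_le (by linarith) hUL (hKU.trans hU23)).trans (by linarith)
  have hlogM : Real.log (2 * M : ℕ) ≤ LL + 1 := by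
    push_cast
    rw [Real.log_mul two_ne_zero (by linarith)]
    have := log_natCast_le_of_le (by linarith) hUL (hMU.trans hU23)
    linarith [Real.log_two_lt_d9]
  have hG : ∀ t, charMean Q (fun q ψ => ‖∑ x ∈ I, (α x.1 * β x.2 *
      ψ ((x.1 * x.2 : ℕ) : ZMod q)) * ((x.1 * x.2 : ℕ) : ℂ) ^ (-perronPoint (2 * LL) t)‖)
      ≤ LL ^ (10 + 2 * 4 ^ c) * (A * B) * E := by
    intro t
    set z : ℂ := -perronPoint (2 * LL) t with hz
    -- The factor `(ab)^(-s)` from the Perron integral splits between the two variables and has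
    -- modulus at most one, so it is absorbed in the coefficients uniformly in `t`.
    have twist : ∀ {γ : ℕ → ℂ} {D : ℝ}, (∀ n, 1 ≤ n → ‖γ n‖ ≤ D * tau n ^ c) →
        ∀ n, 1 ≤ n → ‖γ n * (n : ℂ) ^ z‖ ≤ D * tau n ^ c := by
      intro γ D hγ n hn
      rw [norm_mul]
      exact (mul_le_of_le_one_right (norm_nonneg _)
        (norm_natCast_cpow_le (by linarith) t hn)).trans (hγ n hn)
    have e : (fun (q : ℕ) (ψ : DirichletCharacter ℂ q) => ‖∑ x ∈ I, (α x.1 * β x.2 *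
        ψ ((x.1 * x.2 : ℕ) : ZMod q)) * ((x.1 * x.2 : ℕ) : ℂ) ^ z‖)
        = fun q ψ => ‖∑ n ∈ Ioc 0 (2 * M), α n * (n : ℂ) ^ z * ψ (n : ZMod q)‖
          * ‖∑ n ∈ Ioc 0 K, β n * (n : ℂ) ^ z * ψ (n : ZMod q)‖ := by
      funext q ψ
      rw [← norm_mul, Finset.sum_mul_sum, ← Finset.sum_product']
      congr 1
      refine Finset.sum_congr rfl fun x _ => ?_
      rw [Nat.cast_mul, map_mul, Nat.cast_mul, Complex.natCast_mul_natCast_cpow]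
      ring
    rw [e]
    refine (sq_le_sq₀ (charMean_nonneg fun _ _ => by positivity) (by positivity)).1 ?_
    refine charMean_mul_le.trans ?_
    have h1 := charMean_dirichletPolynomial_sq_le hLL hQ hlogQ hlogM (twist hα)
    have h2 := charMean_dirichletPolynomial_sq_le hLL hQ hlogQ hlogK (twist hβ)
    have h3 : (((2 * M : ℕ) : ℝ) + (Q : ℝ) ^ 2) * ((2 * M : ℕ) : ℝ)
        ≤ 4 * (((M : ℝ) + Q ^ 2) * M) := by
      push_cast
      have : 0 ≤ (Q : ℝ) ^ 2 * M := by positivity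
      nlinarith
    have h4 := large_sieve_product_le (Q := Q) (by positivity : (0 : ℝ) ≤ M)
      (by positivity : (0 : ℝ) ≤ K) (by positivity) hU0 (by linarith : 0 ≤ X) hMU hKU hMK
    calc _ ≤ (LL ^ (8 + 2 * 4 ^ c) * A ^ 2 * (((2 * M : ℕ) + (Q : ℝ) ^ 2) * (2 * M : ℕ))) *
          (LL ^ (8 + 2 * 4 ^ c) * B ^ 2 * ((K + (Q : ℝ) ^ 2) * K)) :=
          mul_le_mul h1 h2 (charMean_nonneg fun _ _ => by positivity) (by positivity)
      _ ≤ (LL ^ (8 + 2 * 4 ^ c) * A ^ 2 * (4 * (((M : ℝ) + Q ^ 2) * M))) *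
          (LL ^ (8 + 2 * 4 ^ c) * B ^ 2 * ((K + (Q : ℝ) ^ 2) * K)) := by gcongr
      _ = 4 * ((LL ^ (8 + 2 * 4 ^ c)) ^ 2 * (A * B) ^ 2) *
          ((((M : ℝ) + Q ^ 2) * M) * ((K + (Q : ℝ) ^ 2) * K)) := by ring
      _ ≤ 4 * ((LL ^ (8 + 2 * 4 ^ c)) ^ 2 * (A * B) ^ 2) * (2 * E ^ 2) := by gcongr
      _ = 8 * ((LL ^ (8 + 2 * 4 ^ c)) ^ 2 * (A * B) ^ 2 * E ^ 2) := by ring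
      _ ≤ LL ^ 4 * ((LL ^ (8 + 2 * 4 ^ c)) ^ 2 * (A * B) ^ 2 * E ^ 2) := by
          have : (8 : ℝ) ≤ LL ^ 4 := by
            calc (8 : ℝ) ≤ 2 ^ 4 := by norm_num
              _ ≤ LL ^ 4 := by gcongr
          gcongr
      _ = _ := by
          rw [show 10 + 2 * 4 ^ c = 2 + (8 + 2 * 4 ^ c) by ring, pow_add LL 2]
          ring
  have hmain := charMean_norm_sum_filter_le I (fun x => x.1 * x.2)
    (fun q ψ x => α x.1 * β x.2 * ψ ((x.1 * x.2 : ℕ) : ZMod q)) hL hrI hNL hG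
  refine (charMean_mono fun q _ hq ψ _ => le_of_eq ?_).trans (hmain.trans ?_)
  · rw [bilinSum_eq (A := 2 * M) (B := K)]
    · intro a b ha hb hab hαa hβb
      obtain ⟨h1, h2⟩ := hαs a hαa
      refine ⟨h2.le, Nat.le_floor (le_min (hβs b hβb) ?_)⟩
      rw [le_div_iff₀ (by linarith)]
      have h3 : ((b * M : ℕ) : ℝ) ≤ N q := by
        exact_mod_cast (Nat.mul_le_mul_left b h1).trans (by rwa [mul_comm])
      push_cast at h3
      exact h3.trans (hN q hq)
  · calc 128 * (2 * LL) ^ 3 * (LL ^ (10 + 2 * 4 ^ c) * (A * B) * E)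
        = 1024 * (LL ^ 3 * LL ^ (10 + 2 * 4 ^ c) * (A * B) * E) := by ring
      _ ≤ LL ^ 10 * (LL ^ 3 * LL ^ (10 + 2 * 4 ^ c) * (A * B) * E) := by
          have : (1024 : ℝ) ≤ LL ^ 10 := by
            calc (1024 : ℝ) = 2 ^ 10 := by norm_num
              _ ≤ LL ^ 10 := by gcongr
          gcongr
      _ = _ := by
          ring

/-- The mean value of a bilinear sum. -/
theorem charMean_bilinSum_le {U LL X A B : ℝ} (hU : 1 ≤ U) (hLL : 2 ≤ LL)
    (hUL : Real.log (U ^ 3) ≤ LL) (hX : 1 ≤ X) (hXU : X ≤ U ^ 3) (hA : 0 ≤ A) (hB : 0 ≤ B)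
    {Q c : ℕ} (hQ : 1 ≤ Q) (hQU : ((2 * Q : ℕ) : ℝ) ≤ U ^ 3)
    {N : ℕ → ℕ} (hN : ∀ q, q < 2 * Q → (N q : ℝ) ≤ X) {α β : ℕ → ℂ}
    (hα : ∀ n, 1 ≤ n → ‖α n‖ ≤ A * tau n ^ c) (hβ : ∀ n, 1 ≤ n → ‖β n‖ ≤ B * tau n ^ c)
    (hαs : ∀ n, α n ≠ 0 → (n : ℝ) ≤ U ^ 2) (hβs : ∀ n, β n ≠ 0 → (n : ℝ) ≤ U ^ 2) :
    charMean Q (fun q ψ => ‖bilinSum α β (fun n => ψ (n : ZMod q)) (N q)‖)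
      ≤ LL ^ (25 + 2 * 4 ^ c) * (A * B) * (X + √X * U * Q + √X * Q ^ 2) := by
  have hU0 : 0 ≤ U := by linarith
  have hU21 : 1 ≤ U ^ 2 := one_le_pow₀ hU
  set J : ℕ := Nat.log 2 ⌊U ^ 2⌋₊ + 1 with hJ
  set γ : ℕ → ℕ → ℂ := fun i n => if n ≠ 0 ∧ Nat.log 2 n = i then α n else 0 with hγ
  have hdec : ∀ q (ψ : DirichletCharacter ℂ q),
      bilinSum α β (fun n => ψ (n : ZMod q)) (N q)
      = ∑ i ∈ range J, bilinSum (γ i) β (fun n => ψ (n : ZMod q)) (N q) := by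
    intro q ψ
    simp only [bilinSum]
    rw [Finset.sum_comm]
    refine Finset.sum_congr rfl fun x hx => ?_
    simp only [mem_filter, mem_product, mem_Ioc] at hx
    rw [← Finset.sum_mul, ← Finset.sum_mul]
    congr 2
    by_cases h0 : α x.1 = 0
    · rw [h0, Finset.sum_eq_zero]
      intro i _
      simp [hγ, h0]
    · have hlt : Nat.log 2 x.1 ∈ range J := by
        rw [mem_range, hJ, Nat.lt_succ_iff]
        exact Nat.log_mono_right (Nat.le_floor (hαs _ h0))
      rw [Finset.sum_eq_single_of_mem _ hlt]
      · simp only [hγ]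
        rw [if_pos (by simp; omega)]
      · intro i _ hi
        simp only [hγ]
        exact if_neg fun h => hi h.2.symm
  have hblock : ∀ i ∈ range J,
      charMean Q (fun q ψ => ‖bilinSum (γ i) β (fun n => ψ (n : ZMod q)) (N q)‖)
      ≤ LL ^ (23 + 2 * 4 ^ c) * (A * B) * (X + √X * U * Q + √X * Q ^ 2) := by
    intro i hi
    refine charMean_bilinSum_dyadic_le (M := 2 ^ i) hU hLL hUL hX hXU hA hB hQ hQU
      Nat.one_le_two_pow ?_ hN ?_ hβ ?_ hβs
    · have h1 : i ≤ Nat.log 2 ⌊U ^ 2⌋₊ := Nat.lt_succ_iff.1 (mem_range.1 hi)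
      have h2 : 2 ^ i ≤ ⌊U ^ 2⌋₊ := Nat.pow_le_of_le_log (by
        have : 1 ≤ ⌊U ^ 2⌋₊ := Nat.le_floor (by exact_mod_cast hU21)
        omega) h1
      exact (Nat.le_floor_iff (by positivity)).1 h2
    · intro n hn
      simp only [hγ]
      split_ifs
      · exact hα n hn
      · rw [norm_zero]
        have := tau_nonneg n
        positivity
    · intro n hn
      simp only [hγ, ne_eq, ite_eq_right_iff, not_forall] at hn
      obtain ⟨⟨h0, h1⟩, -⟩ := hn
      rw [← h1]
      refine ⟨Nat.pow_log_le_self 2 h0, ?_⟩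
      have := Nat.lt_pow_succ_log_self (b := 2) one_lt_two n
      rwa [pow_succ, mul_comm] at this
  -- As `1 / log 2 < 1.5`, there are at most `1.5 LL + 1` blocks, and this is at most `LL ^ 2`
  -- exactly from `LL = 2` on.
  have hcard : (J : ℝ) ≤ LL ^ 2 := by
    have h1 : (Nat.log 2 ⌊U ^ 2⌋₊ : ℝ) ≤ Real.logb 2 ⌊U ^ 2⌋₊ := Real.natLog_le_logb _ _
    have h2 : Real.log ⌊U ^ 2⌋₊ ≤ LL := log_natCast_le_of_le (by linarith) hUL
      ((Nat.floor_le (by positivity)).trans (pow_le_pow_right₀ hU (by norm_num)))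
    have h3 : Real.logb 2 ⌊U ^ 2⌋₊ ≤ LL * 1.5 := by
      rw [Real.logb, div_le_iff₀ (Real.log_pos one_lt_two)]
      nlinarith [Real.log_two_gt_d9]
    rw [hJ]
    push_cast
    nlinarith
  have hE0 : 0 ≤ X + √X * U * Q + √X * Q ^ 2 := by positivity
  calc _ ≤ charMean Q (fun q ψ => ∑ i ∈ range J,
        ‖bilinSum (γ i) β (fun n => ψ (n : ZMod q)) (N q)‖) :=
        charMean_mono fun q _ _ ψ _ => by
          rw [hdec]
          exact norm_sum_le _ _
    _ = ∑ i ∈ range J, charMean Q (fun q ψ =>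
        ‖bilinSum (γ i) β (fun n => ψ (n : ZMod q)) (N q)‖) := charMean_sum Q _ _
    _ ≤ ∑ i ∈ range J, LL ^ (23 + 2 * 4 ^ c) * (A * B) * (X + √X * U * Q + √X * Q ^ 2) :=
        Finset.sum_le_sum hblock
    _ = J * (LL ^ (23 + 2 * 4 ^ c) * (A * B) * (X + √X * U * Q + √X * Q ^ 2)) := by
        rw [Finset.sum_const, card_range, nsmul_eq_mul]
    _ ≤ LL ^ 2 * (LL ^ (23 + 2 * 4 ^ c) * (A * B) * (X + √X * U * Q + √X * Q ^ 2)) := by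
        gcongr
    _ = _ := by
        rw [show 25 + 2 * 4 ^ c = 2 + (23 + 2 * 4 ^ c) by ring, pow_add LL 2]
        ring

/-! ### The mean value property and convolutions of two short functions -/

/-- The bound for the mean value of a convolution over the primitive characters with conductor in
`[Q, 2Q)`, up to logarithms. -/
def meanBound (U X : ℝ) (Q : ℕ) : ℝ := X + √X * U * Q + √X * Q ^ 2 + U * Q ^ 2 * √Q

/-- The mean value estimate for the sums of `a(md) ψ(m)` with `m ≤ N(q) ≤ X`. -/
def HasMeanBound (U LL : ℝ) (C : ℕ) (a : ArithmeticFunction ℝ) : Prop :=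
  ∀ (Q d : ℕ) (X : ℝ) (N : ℕ → ℕ), 2 ≤ Q → ((2 * Q : ℕ) : ℝ) ≤ U ^ 3 → 1 ≤ d → 1 ≤ X →
    X * d ≤ U ^ 3 → (∀ q, q < 2 * Q → (N q : ℝ) ≤ X) →
    charMean Q (fun q ψ => ‖∑ m ∈ Ioc 0 (N q), (a (m * d) : ℂ) * ψ (m : ZMod q)‖)
      ≤ LL ^ C * tau d ^ C * meanBound U X Q

section HasMeanBound

variable {U LL : ℝ} {C C' : ℕ} {a b : ArithmeticFunction ℝ}

theorem meanBound_nonneg (hU : 0 ≤ U) {X : ℝ} (hX : 0 ≤ X) (Q : ℕ) : 0 ≤ meanBound U X Q := by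
  unfold meanBound
  positivity

/-- Only arguments `md ≤ Xd ≤ U³` occur, so values beyond `U³` are irrelevant. -/
theorem HasMeanBound.congr (h : HasMeanBound U LL C a)
    (hab : ∀ n : ℕ, (n : ℝ) ≤ U ^ 3 → b n = a n) : HasMeanBound U LL C b := by
  intro Q d X N hQ hQU hd hX hXd hN
  refine le_trans (le_of_eq ?_) (h Q d X N hQ hQU hd hX hXd hN)
  unfold charMean
  refine Finset.sum_congr rfl fun q hq => ?_
  congr 1
  refine Finset.sum_congr rfl fun ψ _ => ?_
  beta_reduce
  congr 1
  refine Finset.sum_congr rfl fun m hm => ?_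
  rw [hab]
  refine le_trans ?_ hXd
  rw [Nat.cast_mul]
  have h1 : (m : ℝ) ≤ N q := by exact_mod_cast (mem_Ioc.1 hm).2
  exact mul_le_mul_of_nonneg_right (h1.trans (hN q (mem_Ico.1 hq).2)) (Nat.cast_nonneg _)

theorem HasMeanBound.neg (h : HasMeanBound U LL C a) : HasMeanBound U LL C (-a) := by
  intro Q d X N hQ hQU hd hX hXd hN
  refine le_trans (le_of_eq ?_) (h Q d X N hQ hQU hd hX hXd hN)
  congr 1
  funext q ψ
  have e : ∑ m ∈ Ioc 0 (N q), (((-a) (m * d) : ℝ) : ℂ) * ψ (m : ZMod q)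
      = -∑ m ∈ Ioc 0 (N q), (a (m * d) : ℂ) * ψ (m : ZMod q) := by
    rw [← Finset.sum_neg_distrib]
    exact Finset.sum_congr rfl fun m _ => by simp
  rw [e, norm_neg]

theorem HasMeanBound.add (hU : 1 ≤ U) (hLL : 2 ≤ LL) (ha : HasMeanBound U LL C a)
    (hb : HasMeanBound U LL C' b) : HasMeanBound U LL (max C C' + 1) (a + b) := by
  intro Q d X N hQ hQU hd hX hXd hN
  have h1 := ha Q d X N hQ hQU hd hX hXd hN
  have h2 := hb Q d X N hQ hQU hd hX hXd hN
  have hE := meanBound_nonneg (by linarith : 0 ≤ U) (by linarith : 0 ≤ X) Q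
  have hLL1 : 1 ≤ LL := by linarith
  have hτ := one_le_tau (n := d) (by omega)
  have hm : ∀ D, D ≤ max C C' → LL ^ D * tau d ^ D * meanBound U X Q
      ≤ LL ^ max C C' * tau d ^ (max C C' + 1) * meanBound U X Q := by
    intro D hD
    have i1 := pow_le_pow_right₀ hLL1 hD
    have i2 := pow_le_pow_right₀ hτ (hD.trans (Nat.le_succ _))
    gcongr
  calc _ ≤ charMean Q (fun q ψ => ‖∑ m ∈ Ioc 0 (N q), (a (m * d) : ℂ) * ψ (m : ZMod q)‖
        + ‖∑ m ∈ Ioc 0 (N q), (b (m * d) : ℂ) * ψ (m : ZMod q)‖) := by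
        refine charMean_mono fun q _ _ ψ _ => ?_
        refine le_trans (le_of_eq ?_) (norm_add_le _ _)
        rw [← Finset.sum_add_distrib]
        congr 1
        refine Finset.sum_congr rfl fun m _ => ?_
        rw [ArithmeticFunction.add_apply]
        push_cast
        ring
    _ ≤ LL ^ max C C' * tau d ^ (max C C' + 1) * meanBound U X Q
        + LL ^ max C C' * tau d ^ (max C C' + 1) * meanBound U X Q := by
        rw [charMean_add]
        exact add_le_add (h1.trans (hm C (le_max_left _ _))) (h2.trans (hm C' (le_max_right _ _)))
    _ = 2 * (LL ^ max C C' * tau d ^ (max C C' + 1) * meanBound U X Q) := by ring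
    _ ≤ LL * (LL ^ max C C' * tau d ^ (max C C' + 1) * meanBound U X Q) := by gcongr
    _ = _ := by ring

end HasMeanBound

theorem bilinSum_congr {α β α' β' χ : ℕ → ℂ} {N : ℕ}
    (h : ∀ a b, 1 ≤ a → 1 ≤ b → a * b ≤ N → α a * β b = α' a * β' b) :
    bilinSum α β χ N = bilinSum α' β' χ N := by
  refine Finset.sum_congr rfl fun x hx => ?_
  simp only [mem_filter, mem_product, mem_Ioc] at hx
  rw [h x.1 x.2 hx.1.1.1 hx.1.2.1 hx.2]

/-- The sum of a convolution over multiples of `d` as a sum of bilinear sums. -/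
theorem sum_mul_apply_mul_eq (f g : ArithmeticFunction ℝ) (χ : ℕ → ℂ) {d : ℕ} (hd : 1 ≤ d) (N : ℕ) :
    ∑ m ∈ Ioc 0 N, ((f * g) (m * d) : ℂ) * χ m
      = ∑ p ∈ d.divisorsAntidiagonal,
        bilinSum (fun a => if Nat.Coprime a p.2 then (f (a * p.1) : ℂ) else 0)
          (fun b => (g (b * p.2) : ℂ)) χ N := by
  simp only [bilinSum]
  have h1 : ∀ p ∈ d.divisorsAntidiagonal,
      ∑ x ∈ (Ioc 0 N ×ˢ Ioc 0 N) with x.1 * x.2 ≤ N,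
        (if Nat.Coprime x.1 p.2 then (f (x.1 * p.1) : ℂ) else 0) * (g (x.2 * p.2) : ℂ)
          * χ (x.1 * x.2)
      = ∑ m ∈ Ioc 0 N, ∑ x ∈ m.divisorsAntidiagonal,
        (if Nat.Coprime x.1 p.2 then (f (x.1 * p.1) : ℂ) else 0) * (g (x.2 * p.2) : ℂ)
          * χ (x.1 * x.2) := fun p _ => (sum_Ioc_sum_divisorsAntidiagonal (fun a b =>
        (if Nat.Coprime a p.2 then (f (a * p.1) : ℂ) else 0) * (g (b * p.2) : ℂ)
          * χ (a * b)) N).symm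
  rw [Finset.sum_congr rfl h1, Finset.sum_comm]
  refine Finset.sum_congr rfl fun m hm => ?_
  rw [mul_apply_mul f g (by have := (mem_Ioc.1 hm).1; omega) (by omega), Complex.ofReal_sum,
    Finset.sum_mul]
  refine Finset.sum_congr rfl fun p _ => ?_
  rw [Complex.ofReal_sum, Finset.sum_mul]
  refine Finset.sum_congr rfl fun x hx => ?_
  rw [(Nat.mem_divisorsAntidiagonal.1 hx).1]
  split_ifs <;> simp

theorem charMean_sum_antidiagonal_le {Q d : ℕ} {G : ℝ}
    {S : (q : ℕ) → DirichletCharacter ℂ q → ℂ}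
    {B : ℕ × ℕ → (q : ℕ) → DirichletCharacter ℂ q → ℂ}
    (hS : ∀ q, q < 2 * Q → ∀ ψ : DirichletCharacter ℂ q,
      S q ψ = ∑ p ∈ d.divisorsAntidiagonal, B p q ψ)
    (hB : ∀ p ∈ d.divisorsAntidiagonal, charMean Q (fun q ψ => ‖B p q ψ‖) ≤ G) :
    charMean Q (fun q ψ => ‖S q ψ‖) ≤ tau d * G := by
  calc charMean Q (fun q ψ => ‖S q ψ‖)
      ≤ charMean Q (fun q ψ => ∑ p ∈ d.divisorsAntidiagonal, ‖B p q ψ‖) :=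
        charMean_mono fun q _ hq ψ _ => by
          rw [hS q hq]
          exact norm_sum_le _ _
    _ ≤ ∑ p ∈ d.divisorsAntidiagonal, G := by
        rw [charMean_sum]
        exact Finset.sum_le_sum hB
    _ = tau d * G := by
        rw [Finset.sum_const, nsmul_eq_mul, card_divisorsAntidiagonal_eq_tau]

theorem DivisorBounded.abs_apply_mul_le {Z B : ℝ} (hB : 0 ≤ B) {c : ℕ} {f : ArithmeticFunction ℝ}
    (hf : DivisorBounded Z B c f) {a p d : ℕ} (hd : d ≠ 0) (hp : p ∣ d)
    (h : ((a * p : ℕ) : ℝ) ≤ Z) : |f (a * p)| ≤ B * tau d ^ c * tau a ^ c := by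
  refine (hf _ h).trans ?_
  have h1 := tau_mul_le a p
  have h2 := tau_le_of_dvd hd hp
  have := tau_nonneg a
  have := tau_nonneg p
  have := tau_nonneg (a * p)
  calc B * tau (a * p) ^ c ≤ B * (tau a * tau p) ^ c := by gcongr
    _ ≤ B * (tau a * tau d) ^ c := by gcongr
    _ = _ := by ring

/-- The mean value of a convolution of two functions supported, effectively, on `[1, U²]`. -/
theorem hasMeanBound_mul_of_support {U LL : ℝ} (hU : 1 ≤ U) (hLL : 2 ≤ LL)
    (hUL : Real.log (U ^ 3) ≤ LL) {c : ℕ} {f g : ArithmeticFunction ℝ}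
    (hf : DivisorBounded (U ^ 3) (LL ^ c) c f) (hg : DivisorBounded (U ^ 3) (LL ^ c) c g)
    (hs : ∀ u v : ℕ, ((u * v : ℕ) : ℝ) ≤ U ^ 3 → f u ≠ 0 → g v ≠ 0 →
      (u : ℝ) ≤ U ^ 2 ∧ (v : ℝ) ≤ U ^ 2) :
    HasMeanBound U LL (25 + 2 * 4 ^ c + 2 * c) (f * g) := by
  intro Q d X N hQ hQU hd hX hXd hN
  have hU23 : U ^ 2 ≤ U ^ 3 := pow_le_pow_right₀ hU (by norm_num)
  have hd1 : (1 : ℝ) ≤ d := by exact_mod_cast hd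
  have hXU : X ≤ U ^ 3 := (le_mul_of_one_le_right (by linarith) hd1).trans hXd
  have hτ := one_le_tau (n := d) (by omega)
  have hLL1 : 1 ≤ LL := by linarith
  have hD0 : 0 ≤ LL ^ c * tau d ^ c := by positivity
  -- Truncation at `U²` changes nothing: the arguments that occur together satisfy `(a p₁)(b p₂) =
  -- (ab) d ≤ U³`, so `hs` puts both below `U²` whenever the term is nonzero. It does supply the
  -- unconditional supports that the bilinear estimate needs.
  set α : ℕ × ℕ → ℕ → ℂ := fun p a =>
    if Nat.Coprime a p.2 ∧ ((a * p.1 : ℕ) : ℝ) ≤ U ^ 2 then (f (a * p.1) : ℂ) else 0 with hα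
  set β : ℕ × ℕ → ℕ → ℂ := fun p b =>
    if ((b * p.2 : ℕ) : ℝ) ≤ U ^ 2 then (g (b * p.2) : ℂ) else 0 with hβ
  have hS : ∀ q, q < 2 * Q → ∀ ψ : DirichletCharacter ℂ q,
      ∑ m ∈ Ioc 0 (N q), ((f * g) (m * d) : ℂ) * ψ (m : ZMod q)
      = ∑ p ∈ d.divisorsAntidiagonal, bilinSum (α p) (β p) (fun n => ψ (n : ZMod q)) (N q) := by
    intro q hq ψ
    rw [sum_mul_apply_mul_eq f g (fun n => ψ (n : ZMod q)) hd]
    refine Finset.sum_congr rfl fun p hp => bilinSum_congr fun a b _ _ hab => ?_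
    have hpd := (Nat.mem_divisorsAntidiagonal.1 hp).1
    have hle : (((a * p.1) * (b * p.2) : ℕ) : ℝ) ≤ U ^ 3 := by
      have e : (a * p.1) * (b * p.2) = (a * b) * d := by rw [← hpd]; ring
      rw [e, Nat.cast_mul]
      have : ((a * b : ℕ) : ℝ) ≤ N q := by exact_mod_cast hab
      exact (mul_le_mul_of_nonneg_right (this.trans (hN q hq)) (Nat.cast_nonneg _)).trans hXd
    simp only [hα, hβ]
    by_cases h1 : f (a * p.1) = 0
    · simp [h1]
    by_cases h2 : g (b * p.2) = 0
    · simp [h2]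
    obtain ⟨h3, h4⟩ := hs _ _ hle h1 h2
    rw [if_pos h4]
    congr 1
    exact if_congr (by simp only [h3, and_true]) rfl rfl
  refine (charMean_sum_antidiagonal_le hS (G := LL ^ (25 + 2 * 4 ^ c) *
    ((LL ^ c * tau d ^ c) * (LL ^ c * tau d ^ c)) * meanBound U X Q) fun p hp => ?_).trans ?_
  · obtain ⟨hpd, hd0⟩ := Nat.mem_divisorsAntidiagonal.1 hp
    have hp1 : p.1 ∣ d := Dvd.intro _ hpd
    have hp2 : p.2 ∣ d := Dvd.intro_left _ hpd
    have hp10 : 1 ≤ p.1 := Nat.pos_of_dvd_of_pos hp1 hd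
    have hp20 : 1 ≤ p.2 := Nat.pos_of_dvd_of_pos hp2 hd
    refine (charMean_bilinSum_le hU hLL hUL hX hXU hD0 hD0 (c := c) (by omega) hQU hN ?_ ?_ ?_
      ?_).trans ?_
    · intro n _
      simp only [hα]
      split_ifs with h
      · rw [Complex.norm_real]
        exact hf.abs_apply_mul_le (by positivity) hd0 hp1 (h.2.trans hU23)
      · rw [norm_zero]
        have := tau_nonneg n
        positivity
    · intro n _
      simp only [hβ]
      split_ifs with h
      · rw [Complex.norm_real]
        exact hg.abs_apply_mul_le (by positivity) hd0 hp2 (h.trans hU23)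
      · rw [norm_zero]
        have := tau_nonneg n
        positivity
    · intro n hn
      simp only [hα, ne_eq, ite_eq_right_iff, not_forall] at hn
      obtain ⟨⟨-, h⟩, -⟩ := hn
      exact le_trans (by exact_mod_cast Nat.le_mul_of_pos_right n hp10) h
    · intro n hn
      simp only [hβ, ne_eq, ite_eq_right_iff, not_forall] at hn
      obtain ⟨h, -⟩ := hn
      exact le_trans (by exact_mod_cast Nat.le_mul_of_pos_right n hp20) h
    · refine mul_le_mul_of_nonneg_left ?_ (by positivity)
      unfold meanBound
      have : 0 ≤ U * Q ^ 2 * √Q := by positivity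
      linarith
  · have hE := meanBound_nonneg (by linarith : 0 ≤ U) (by linarith : 0 ≤ X) Q
    calc tau d * (LL ^ (25 + 2 * 4 ^ c) * ((LL ^ c * tau d ^ c) * (LL ^ c * tau d ^ c)) *
          meanBound U X Q)
        = LL ^ (25 + 2 * 4 ^ c + 2 * c) * tau d ^ (2 * c + 1) * meanBound U X Q := by ring
      _ ≤ _ := by
        have : tau d ^ (2 * c + 1) ≤ tau d ^ (25 + 2 * 4 ^ c + 2 * c) :=
          pow_le_pow_right₀ hτ (by omega)
        gcongr

/-! ### Convolutions with a long monotone factor -/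

/-- The restriction of an arithmetic function to `n ≤ x`. -/
def lowPart (x : ℝ) (f : ArithmeticFunction ℝ) : ArithmeticFunction ℝ :=
  ⟨fun n => if (n : ℝ) ≤ x then f n else 0, by simp⟩

/-- The restriction of an arithmetic function to `n > x`. -/
def highPart (x : ℝ) (f : ArithmeticFunction ℝ) : ArithmeticFunction ℝ :=
  ⟨fun n => if (n : ℝ) ≤ x then 0 else f n, by simp⟩

theorem lowPart_apply (x : ℝ) (f : ArithmeticFunction ℝ) (n : ℕ) :
    lowPart x f n = if (n : ℝ) ≤ x then f n else 0 := rfl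

theorem highPart_apply (x : ℝ) (f : ArithmeticFunction ℝ) (n : ℕ) :
    highPart x f n = if (n : ℝ) ≤ x then 0 else f n := rfl

theorem lowPart_add_highPart (x : ℝ) (f : ArithmeticFunction ℝ) :
    lowPart x f + highPart x f = f := by
  ext n
  rw [ArithmeticFunction.add_apply, lowPart_apply, highPart_apply]
  split_ifs <;> simp

theorem le_of_lowPart_ne_zero {x : ℝ} {f : ArithmeticFunction ℝ} {n : ℕ}
    (h : lowPart x f n ≠ 0) : (n : ℝ) ≤ x := by
  by_contra hn
  exact h (if_neg hn)

theorem lt_of_highPart_ne_zero {x : ℝ} {f : ArithmeticFunction ℝ} {n : ℕ}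
    (h : highPart x f n ≠ 0) : x < n := by
  by_contra hn
  exact h (if_pos (not_lt.1 hn))

theorem DivisorBounded.lowPart {Z B : ℝ} {c : ℕ} {f : ArithmeticFunction ℝ}
    (hf : DivisorBounded Z B c f) (x : ℝ) : DivisorBounded Z B c (lowPart x f) := by
  intro n hn
  rw [lowPart_apply]
  have := hf n hn
  split_ifs
  · exact this
  · rw [abs_zero]
    exact (abs_nonneg _).trans this

theorem DivisorBounded.highPart {Z B : ℝ} {c : ℕ} {f : ArithmeticFunction ℝ}
    (hf : DivisorBounded Z B c f) (x : ℝ) : DivisorBounded Z B c (highPart x f) := by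
  intro n hn
  rw [highPart_apply]
  have := hf n hn
  split_ifs
  · rw [abs_zero]
    exact (abs_nonneg _).trans this
  · exact this

/-- Cancellation is used in the second variable only; the first is summed in absolute value. -/
theorem norm_bilinSum_le {α β : ℕ → ℂ} {q : ℕ} (ψ : DirichletCharacter ℂ q) {N K : ℕ} {G : ℝ}
    (hα : ∀ a, α a ≠ 0 → a ≤ K)
    (hβ : ∀ a, 1 ≤ a → ‖∑ b ∈ Ioc 0 (N / a), β b * ψ (b : ZMod q)‖ ≤ G) :
    ‖bilinSum α β (fun n => ψ (n : ZMod q)) N‖ ≤ (∑ a ∈ Ioc 0 K, ‖α a‖) * G := by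
  rw [bilinSum_eq (A := K) (B := N) fun a b ha hb hab hαa _ =>
    ⟨hα a hαa, (Nat.le_mul_of_pos_left b ha).trans hab⟩, Finset.sum_product, Finset.sum_mul]
  refine (norm_sum_le _ _).trans (Finset.sum_le_sum fun a ha => ?_)
  have ha1 := (mem_Ioc.1 ha).1
  have e : ∑ b ∈ Ioc 0 N, (if a * b ≤ N then α a * β b * ψ ((a * b : ℕ) : ZMod q) else 0)
      = (α a * ψ (a : ZMod q)) * ∑ b ∈ Ioc 0 (N / a), β b * ψ (b : ZMod q) := by
    rw [← Finset.sum_filter, Finset.mul_sum]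
    refine Finset.sum_congr ?_ fun b _ => ?_
    · ext b
      simp only [mem_filter, mem_Ioc, Nat.le_div_iff_mul_le ha1, mul_comm b a]
      constructor
      · rintro ⟨⟨h1, h2⟩, h3⟩
        exact ⟨h1, h3⟩
      · rintro ⟨h1, h2⟩
        exact ⟨⟨h1, (Nat.le_mul_of_pos_left b ha1).trans h2⟩, h2⟩
    · rw [Nat.cast_mul, map_mul]
      ring
  simp only []
  rw [e, norm_mul, norm_mul]
  refine mul_le_mul ?_ (hβ a ha1) (norm_nonneg _) (norm_nonneg _)
  exact mul_le_of_le_one_right (norm_nonneg _) (DirichletCharacter.norm_le_one _ _)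

/-- The mean value of a convolution with a monotone function restricted to `n > U²`. -/
theorem hasMeanBound_mul_highPart {U LL : ℝ} (hU : 1 ≤ U) (hLL : 2 ≤ LL)
    (hUL : Real.log (U ^ 3) ≤ LL) {c : ℕ} {f s : ArithmeticFunction ℝ}
    (hf : DivisorBounded (U ^ 3) (LL ^ c) c f) (hs : Monotone s)
    (hsb : ∀ n : ℕ, (n : ℝ) ≤ U ^ 3 → |s n| ≤ LL) :
    HasMeanBound U LL (c + 2 * 2 ^ c + 6) (f * highPart (U ^ 2) s) := by
  intro Q d X N hQ hQU hd hX hXd hN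
  have hU13 : U ≤ U ^ 3 := by
    calc U = U ^ 1 := (pow_one U).symm
      _ ≤ U ^ 3 := pow_le_pow_right₀ hU (by norm_num)
  have hτ := one_le_tau (n := d) (by omega)
  have hLL1 : 1 ≤ LL := by linarith
  have hU0 : 0 ≤ U := by linarith
  set K : ℕ := ⌊U⌋₊ with hK
  have hKU : (K : ℝ) ≤ U := Nat.floor_le hU0
  set g := highPart (U ^ 2) s with hg
  -- Since `b p₂ > U²` and the product of the two arguments is at most `U³`, the argument `a p₁` can
  -- be truncated at `U`.
  set α : ℕ × ℕ → ℕ → ℂ := fun p a =>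
    if Nat.Coprime a p.2 ∧ ((a * p.1 : ℕ) : ℝ) ≤ U then (f (a * p.1) : ℂ) else 0 with hα
  set β : ℕ × ℕ → ℕ → ℂ := fun p b => (g (b * p.2) : ℂ) with hβ
  have hS : ∀ q, q < 2 * Q → ∀ ψ : DirichletCharacter ℂ q,
      ∑ m ∈ Ioc 0 (N q), ((f * g) (m * d) : ℂ) * ψ (m : ZMod q)
      = ∑ p ∈ d.divisorsAntidiagonal, bilinSum (α p) (β p) (fun n => ψ (n : ZMod q)) (N q) := by
    intro q hq ψ
    rw [sum_mul_apply_mul_eq f g (fun n => ψ (n : ZMod q)) hd]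
    refine Finset.sum_congr rfl fun p hp => bilinSum_congr fun a b _ _ hab => ?_
    have hpd := (Nat.mem_divisorsAntidiagonal.1 hp).1
    have hle : (((a * p.1) * (b * p.2) : ℕ) : ℝ) ≤ U ^ 3 := by
      have e : (a * p.1) * (b * p.2) = (a * b) * d := by rw [← hpd]; ring
      rw [e, Nat.cast_mul]
      have : ((a * b : ℕ) : ℝ) ≤ N q := by exact_mod_cast hab
      exact (mul_le_mul_of_nonneg_right (this.trans (hN q hq)) (Nat.cast_nonneg _)).trans hXd
    simp only [hα, hβ]
    by_cases h2 : g (b * p.2) = 0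
    · simp [h2]
    have h3 : U ^ 2 < ((b * p.2 : ℕ) : ℝ) := lt_of_highPart_ne_zero h2
    have h4 : ((a * p.1 : ℕ) : ℝ) ≤ U := by
      by_contra h
      push Not at h
      rw [Nat.cast_mul] at hle
      have : U * U ^ 2 < ((a * p.1 : ℕ) : ℝ) * ((b * p.2 : ℕ) : ℝ) := by gcongr
      nlinarith
    congr 1
    exact if_congr (by simp only [h4, and_true]) rfl rfl
  have hlogK : Real.log K ≤ LL := log_natCast_le_of_le (by linarith) hUL (hKU.trans hU13)
  have hlogK0 : 0 ≤ Real.log K := Real.log_natCast_nonneg K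
  -- The factors are the total weight of the characters, the absolute sum of `α` over `a ≤ U`, the
  -- largest value of `s`, and the Pólya–Vinogradov bound.
  refine (charMean_sum_antidiagonal_le hS (G := 2 * (Q : ℝ) ^ 2 *
    ((LL ^ c * tau d ^ c * (U * LL ^ (2 * 2 ^ c))) * (LL * (LL ^ 4 * √Q)))) fun p hp => ?_).trans ?_
  · obtain ⟨hpd, hd0⟩ := Nat.mem_divisorsAntidiagonal.1 hp
    have hp1 : p.1 ∣ d := Dvd.intro _ hpd
    have hp2 : p.2 ∣ d := Dvd.intro_left _ hpd
    have hp10 : 1 ≤ p.1 := Nat.pos_of_dvd_of_pos hp1 hd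
    have hp20 : 1 ≤ p.2 := Nat.pos_of_dvd_of_pos hp2 hd
    refine le_trans (charMean_mono fun q hq1 hq2 ψ hψ => ?_) (charMean_const_le (by positivity))
    have hPV : 2 * √(q : ℝ) * (1 + Real.log q) ≤ LL ^ 4 * √Q := by
      have hq2' : (q : ℝ) ≤ (2 * Q : ℕ) := by exact_mod_cast hq2.le
      have h1 : Real.log q ≤ LL := log_natCast_le_of_le (by linarith) hUL (hq2'.trans hQU)
      have h2 : √(q : ℝ) ≤ 2 * √Q := by
        rw [Real.sqrt_le_left (by positivity), mul_pow, Real.sq_sqrt (Nat.cast_nonneg _)]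
        push_cast at hq2'
        have : (0 : ℝ) ≤ Q := Nat.cast_nonneg _
        linarith
      have h3 : (0 : ℝ) ≤ Real.log q := Real.log_natCast_nonneg q
      have h4 : (8 : ℝ) ≤ LL ^ 3 := by
        calc (8 : ℝ) = 2 ^ 3 := by norm_num
          _ ≤ LL ^ 3 := by gcongr
      calc 2 * √(q : ℝ) * (1 + Real.log q) ≤ 2 * (2 * √Q) * (2 * LL) := by
            gcongr
            linarith
        _ = 8 * (LL * √Q) := by ring
        _ ≤ LL ^ 3 * (LL * √Q) := by gcongr
        _ = _ := by ring
    refine (norm_bilinSum_le ψ (K := K) (G := LL * (LL ^ 4 * √Q)) ?_ ?_).trans ?_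
    · intro n hn
      simp only [hα, ne_eq, ite_eq_right_iff, not_forall] at hn
      obtain ⟨⟨-, h⟩, -⟩ := hn
      exact (Nat.le_mul_of_pos_right n hp10).trans (Nat.le_floor h)
    · intro a ha
      -- The restriction `b p₂ > U²` is the same as `b > A`, so the inner sum runs over an interval
      -- with the monotone weight `s(b p₂)`.
      set A : ℕ := ⌊U ^ 2 / p.2⌋₊ with hA
      have hp2r : (0 : ℝ) < p.2 := by exact_mod_cast hp20
      have hiff : ∀ b : ℕ, ((b * p.2 : ℕ) : ℝ) ≤ U ^ 2 ↔ b ≤ A := by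
        intro b
        rw [hA, Nat.le_floor_iff (by positivity), le_div_iff₀ hp2r, Nat.cast_mul]
      have e : ∑ b ∈ Ioc 0 (N q / a), β p b * ψ (b : ZMod q)
          = ∑ b ∈ Ioc A (N q / a), (s (b * p.2) : ℂ) * ψ (b : ZMod q) := by
        have h1 : ∀ b ∈ Ioc 0 (N q / a), β p b * ψ (b : ZMod q)
            = if A < b then (s (b * p.2) : ℂ) * ψ (b : ZMod q) else 0 := by
          intro b _
          simp only [hβ, hg, highPart_apply, hiff]
          by_cases h : b ≤ A
          · rw [if_pos h, if_neg (by omega)]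
            simp
          · rw [if_neg h, if_pos (by omega)]
        rw [Finset.sum_congr rfl h1, ← Finset.sum_filter]
        refine Finset.sum_congr ?_ fun _ _ => rfl
        ext b
        simp only [mem_filter, mem_Ioc]
        omega
      rw [e]
      have hmono : Monotone fun b : ℕ => s (b * p.2) := fun x y hxy =>
        hs (Nat.mul_le_mul_right _ hxy)
      have hle : (((N q / a) * p.2 : ℕ) : ℝ) ≤ U ^ 3 := by
        refine le_trans ?_ hXd
        rw [Nat.cast_mul]
        refine mul_le_mul ?_ (by exact_mod_cast Nat.le_of_dvd hd hp2) (Nat.cast_nonneg _)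
          (by linarith)
        exact le_trans (by exact_mod_cast Nat.div_le_self _ _) (hN q hq2)
      have := norm_sum_monotone_mul_le hmono (by simp) (c := fun b => ψ (b : ZMod q))
        (norm_sum_char_le (hQ.trans hq1) hψ) A (N q / a)
      refine this.trans ?_
      exact mul_le_mul ((le_abs_self _).trans (hsb _ hle)) hPV
        (by have := Real.log_natCast_nonneg q; positivity) (by linarith)
    · refine mul_le_mul_of_nonneg_right ?_ (by positivity)
      calc ∑ a ∈ Ioc 0 K, ‖α p a‖ ≤ ∑ a ∈ Ioc 0 K, LL ^ c * tau d ^ c * tau a ^ c := by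
            refine Finset.sum_le_sum fun n _ => ?_
            simp only [hα]
            split_ifs with h
            · rw [Complex.norm_real]
              exact hf.abs_apply_mul_le (by positivity) hd0 hp1 (h.2.trans hU13)
            · rw [norm_zero]
              have := tau_nonneg n
              positivity
        _ ≤ LL ^ c * tau d ^ c * (K * (1 + Real.log K) ^ (2 ^ c)) := by
            rw [← Finset.mul_sum]
            exact mul_le_mul_of_nonneg_left (sum_tau_pow_le _ _) (by positivity)
        _ ≤ LL ^ c * tau d ^ c * (U * (LL ^ 2) ^ (2 ^ c)) := by
            have : 1 + Real.log K ≤ LL ^ 2 := by nlinarith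
            gcongr
        _ = _ := by rw [← pow_mul]
  · have hE : 0 ≤ U * (Q : ℝ) ^ 2 * √Q := by positivity
    have hEle : U * (Q : ℝ) ^ 2 * √Q ≤ meanBound U X Q := by
      unfold meanBound
      have : 0 ≤ X + √X * U * Q + √X * Q ^ 2 := by positivity
      linarith
    calc _ = 2 * (LL ^ (c + 2 * 2 ^ c + 5) * tau d ^ (c + 1) * (U * (Q : ℝ) ^ 2 * √Q)) := by ring
      _ ≤ LL * (LL ^ (c + 2 * 2 ^ c + 5) * tau d ^ (c + 1) * (U * (Q : ℝ) ^ 2 * √Q)) := by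
        gcongr
      _ = LL ^ (c + 2 * 2 ^ c + 6) * tau d ^ (c + 1) * (U * (Q : ℝ) ^ 2 * √Q) := by ring
      _ ≤ _ := by
        have : tau d ^ (c + 1) ≤ tau d ^ (c + 2 * 2 ^ c + 6) := pow_le_pow_right₀ hτ (by omega)
        gcongr

/-! ### Decomposition of a product of several factors -/

/-- A factor of a convolution that is either supported on `[1, U²]` or monotone. -/
def IsFactor (U LL : ℝ) (f : ArithmeticFunction ℝ) : Prop :=
  (∀ n : ℕ, (n : ℝ) ≤ U ^ 3 → |f n| ≤ LL) ∧ ((∀ n, f n ≠ 0 → (n : ℝ) ≤ U ^ 2) ∨ Monotone f)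

theorem IsFactor.divisorBounded {U LL : ℝ} {f : ArithmeticFunction ℝ} (hf : IsFactor U LL f) :
    DivisorBounded (U ^ 3) (LL ^ 1) 0 f := fun n hn => by simpa using hf.1 n hn

theorem DivisorBounded.mono_pow {Z LL : ℝ} (hLL : 1 ≤ LL) {i j k : ℕ} {f : ArithmeticFunction ℝ}
    (hf : DivisorBounded Z (LL ^ i) j f) (hi : i ≤ k) (hj : j ≤ k) :
    DivisorBounded Z (LL ^ k) k f :=
  hf.mono (by positivity) (pow_le_pow_right₀ hLL hi) hj

theorem DivisorBounded.mul_pow {Z LL : ℝ} (hLL : 1 ≤ LL) {i j i' j' k : ℕ}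
    {f g : ArithmeticFunction ℝ} (hf : DivisorBounded Z (LL ^ i) j f)
    (hg : DivisorBounded Z (LL ^ i') j' g) (hi : i + i' ≤ k) (hj : j + j' + 1 ≤ k) :
    DivisorBounded Z (LL ^ k) k (f * g) := by
  have h := hf.mul (by positivity) hg
  rw [← pow_add] at h
  exact h.mono_pow hLL hi hj

theorem divisorBounded_one {Z : ℝ} : DivisorBounded Z 1 0 1 := by
  intro n _
  rw [ArithmeticFunction.one_apply]
  split_ifs <;> simp

theorem divisorBounded_list_prod {U LL : ℝ} (hLL : 1 ≤ LL) (l : List (ArithmeticFunction ℝ))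
    (hl : ∀ f ∈ l, IsFactor U LL f) :
    DivisorBounded (U ^ 3) (LL ^ l.length) l.length l.prod := by
  induction l with
  | nil => simpa using divisorBounded_one
  | cons f l ih =>
    rw [List.prod_cons, List.length_cons]
    exact (hl f (by simp)).divisorBounded.mul_pow hLL
      (ih fun g hg => hl g (by simp [hg])) (by omega) (by omega)

theorem exists_of_mul_apply_ne_zero {f g : ArithmeticFunction ℝ} {n : ℕ} (h : (f * g) n ≠ 0) :
    ∃ u v, u * v = n ∧ f u ≠ 0 ∧ g v ≠ 0 := by
  rw [ArithmeticFunction.mul_apply] at h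
  obtain ⟨x, hx, hne⟩ := Finset.exists_ne_zero_of_sum_ne_zero h
  exact ⟨x.1, x.2, (Nat.mem_divisorsAntidiagonal.1 hx).1, left_ne_zero_of_mul hne,
    right_ne_zero_of_mul hne⟩

theorem le_sq_of_mul_le_cube {U : ℝ} (hU : 1 ≤ U) {u v : ℕ} (h : ((u * v : ℕ) : ℝ) ≤ U ^ 3)
    (hu : U < u) : (v : ℝ) ≤ U ^ 2 := by
  by_contra hv
  push Not at hv
  rw [Nat.cast_mul] at h
  have : U * U ^ 2 < (u : ℝ) * v := by gcongr
  nlinarith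

/-- Mean values of convolutions of a short function with admissible factors. -/
theorem exists_hasMeanBound_mul_list_prod (r : ℕ) : ∀ c : ℕ, ∃ C : ℕ, ∀ U LL : ℝ, 1 ≤ U → 2 ≤ LL →
    Real.log (U ^ 3) ≤ LL → ∀ l : List (ArithmeticFunction ℝ), l.length = r →
    (∀ f ∈ l, IsFactor U LL f) → ∀ F : ArithmeticFunction ℝ,
    DivisorBounded (U ^ 3) (LL ^ c) c F → (∀ n, F n ≠ 0 → (n : ℝ) ≤ U) →
    HasMeanBound U LL C (F * l.prod) := by
  induction r with
  | zero =>
    intro c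
    refine ⟨25 + 2 * 4 ^ c + 2 * c, fun U LL hU hLL hUL l hl _ F hF hFs => ?_⟩
    obtain rfl := List.length_eq_zero_iff.1 hl
    have hU12 : U ≤ U ^ 2 := by nlinarith
    refine hasMeanBound_mul_of_support hU hLL hUL hF
      ((divisorBounded_one (Z := U ^ 3)).mono zero_le_one (one_le_pow₀ (by linarith)) (by omega)) ?_
    intro u v _ hu hv
    refine ⟨(hFs u hu).trans hU12, ?_⟩
    have : v = 1 := by
      by_contra h
      exact hv (ArithmeticFunction.one_apply_ne h)
    rw [this]
    simpa using hU.trans hU12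
  | succ r ih =>
    intro c
    obtain ⟨C₁, hC₁⟩ := ih (c + 1)
    set k := c + r + 2 with hk
    set C₂ := 25 + 2 * 4 ^ k + 2 * k with hC₂
    set C₃ := k + 2 * 2 ^ k + 6 with hC₃
    -- Mirrors the three applications of `HasMeanBound.add` at the end; it depends only on `r` and
    -- `c`.
    refine ⟨max (max (max C₁ C₂ + 1) C₂ + 1) (max C₃ 0) + 1,
      fun U LL hU hLL hUL l hl hlf F hF hFs => ?_⟩
    obtain ⟨f, l, rfl⟩ := List.exists_cons_of_length_eq_add_one hl
    have hlen : l.length = r := by simpa using hl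
    have hf : IsFactor U LL f := hlf f (by simp)
    have hlf' : ∀ g ∈ l, IsFactor U LL g := fun g hg => hlf g (by simp [hg])
    have hLL1 : 1 ≤ LL := by linarith
    have hU12 : U ≤ U ^ 2 := by nlinarith
    set R := l.prod with hR
    have hRb : DivisorBounded (U ^ 3) (LL ^ r) r R := hlen ▸ divisorBounded_list_prod hLL1 l hlf'
    set f₀ := lowPart U f with hf₀
    set f₁ := lowPart (U ^ 2) (highPart U f) with hf₁
    set f₂ := highPart (U ^ 2) f with hf₂
    -- The next factor is cut at `U` and `U²`. The low part is merged into the short function `F`,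
    -- the middle part already makes a bilinear sum with everything else, and the high part is
    -- either zero or monotone.
    have hsplit : f = f₀ + f₁ + f₂ := by
      ext n
      simp only [hf₀, hf₁, hf₂, ArithmeticFunction.add_apply, lowPart_apply, highPart_apply]
      by_cases h1 : (n : ℝ) ≤ U
      · simp [h1, h1.trans hU12]
      · by_cases h2 : (n : ℝ) ≤ U ^ 2 <;> simp [h1, h2]
    have hf₀b : DivisorBounded (U ^ 3) (LL ^ 1) 0 f₀ := hf.divisorBounded.lowPart U
    have hf₁b : DivisorBounded (U ^ 3) (LL ^ 1) 0 f₁ := (hf.divisorBounded.highPart U).lowPart _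
    have hFf : DivisorBounded (U ^ 3) (LL ^ (c + 1)) (c + 1) (F * f₀) :=
      hF.mul_pow hLL1 hf₀b (by omega) (by omega)
    have hFR : DivisorBounded (U ^ 3) (LL ^ k) k (F * R) :=
      hF.mul_pow hLL1 hRb (by omega) (by omega)
    have h1 : HasMeanBound U LL C₁ (lowPart U (F * f₀) * R) :=
      hC₁ U LL hU hLL hUL l hlen hlf' _ (hFf.lowPart U) fun n hn => le_of_lowPart_ne_zero hn
    have h2 : HasMeanBound U LL C₂ (highPart U (F * f₀) * R) := by
      refine hasMeanBound_mul_of_support hU hLL hUL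
        ((hFf.highPart U).mono_pow hLL1 (by omega) (by omega))
        (hRb.mono_pow hLL1 (by omega) (by omega)) ?_
      -- The merged function `F * f₀` lives on `[1, U²]`, both pieces being at most `U`. Where it
      -- exceeds `U` the cofactor is at most `U²`, so this is bilinear; where it stays below `U` the
      -- induction continues.
      intro u v huv hu hv
      have hlt := lt_of_highPart_ne_zero hu
      refine ⟨?_, le_sq_of_mul_le_cube hU huv hlt⟩
      have hne : (F * f₀) u ≠ 0 := by
        rw [highPart_apply, if_neg (not_le.2 hlt)] at hu
        exact hu
      obtain ⟨a, b, rfl, ha, hb⟩ := exists_of_mul_apply_ne_zero hne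
      rw [Nat.cast_mul, sq]
      exact mul_le_mul (hFs a ha) (le_of_lowPart_ne_zero hb) (Nat.cast_nonneg _) (by linarith)
    have h3 : HasMeanBound U LL C₂ (f₁ * (F * R)) := by
      refine hasMeanBound_mul_of_support hU hLL hUL (hf₁b.mono_pow hLL1 (by omega) (by omega))
        hFR ?_
      intro u v huv hu _
      have hle := le_of_lowPart_ne_zero hu
      rw [hf₁, lowPart_apply, if_pos hle] at hu
      exact ⟨hle, le_sq_of_mul_le_cube hU huv (lt_of_highPart_ne_zero hu)⟩
    have h4 : HasMeanBound U LL (max C₃ 0) ((F * R) * f₂) := by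
      rw [Nat.max_zero]
      rcases hf.2 with hshort | hmono
      · have hz : f₂ = 0 := by
          ext n
          rw [hf₂, highPart_apply, ArithmeticFunction.zero_apply]
          split_ifs with h
          · rfl
          · by_contra hne
            exact h (hshort n hne)
        rw [hz, mul_zero]
        intro Q d X N hQ hQU hd hX hXd hN
        have hE := meanBound_nonneg (by linarith : 0 ≤ U) (by linarith : 0 ≤ X) Q
        have := tau_nonneg d
        simp [charMean]
        positivity
      · exact hasMeanBound_mul_highPart hU hLL hUL hFR hmono hf.1
    have hall := ((h1.add hU hLL h2).add hU hLL h3).add hU hLL h4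
    refine hall.congr fun n _ => ?_
    congr 1
    rw [List.prod_cons, ← hR]
    calc F * (f * R) = F * ((f₀ + f₁ + f₂) * R) := by rw [← hsplit]
      _ = (F * f₀) * R + f₁ * (F * R) + (F * R) * f₂ := by ring
      _ = (lowPart U (F * f₀) + highPart U (F * f₀)) * R + f₁ * (F * R) + (F * R) * f₂ := by
          rw [lowPart_add_highPart]
      _ = _ := by ring

/-! ### Vaughan's identity for the Möbius function -/

/-- The Möbius function with real values. -/
def moebiusReal : ArithmeticFunction ℝ := (moebius : ArithmeticFunction ℝ)

/-- The constant function `1` with real values. -/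
def zetaReal : ArithmeticFunction ℝ := (zeta : ArithmeticFunction ℝ)

theorem moebiusReal_mul_zetaReal : moebiusReal * zetaReal = 1 := coe_moebius_mul_coe_zeta

theorem abs_moebiusReal_le (n : ℕ) : |moebiusReal n| ≤ 1 := by
  rw [moebiusReal, ArithmeticFunction.intCoe_apply]
  exact_mod_cast abs_moebius_le_one

theorem zetaReal_apply (n : ℕ) : zetaReal n = if n = 0 then 0 else 1 := by
  rw [zetaReal, ArithmeticFunction.natCoe_apply, ArithmeticFunction.zeta_apply]
  split_ifs <;> simp

theorem isFactor_zetaReal {U LL : ℝ} (hLL : 1 ≤ LL) : IsFactor U LL zetaReal := by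
  refine ⟨fun n _ => ?_, Or.inr fun m n hmn => ?_⟩
  · rw [zetaReal_apply]
    split_ifs
    · simp; linarith
    · simpa using hLL
  · rw [zetaReal_apply, zetaReal_apply]
    split_ifs with h1 h2
    · exact le_rfl
    · exact zero_le_one
    · omega
    · exact le_rfl

theorem isFactor_log {U LL : ℝ} (hLL : 0 ≤ LL) (hUL : Real.log (U ^ 3) ≤ LL) :
    IsFactor U LL ArithmeticFunction.log := by
  refine ⟨fun n hn => ?_, Or.inr fun m n hmn => ?_⟩
  · rw [log_apply, abs_of_nonneg (Real.log_natCast_nonneg n)]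
    exact log_natCast_le_of_le hLL hUL hn
  · rw [log_apply, log_apply]
    rcases Nat.eq_zero_or_pos m with rfl | hm
    · simpa using Real.log_natCast_nonneg n
    · exact Real.log_le_log (by exact_mod_cast hm) (by exact_mod_cast hmn)

/-- For `n ≤ U` every divisor of `n` is at most `U`, so the truncated Möbius function still inverts
the constant function there. -/
theorem one_sub_lowPart_mul_zeta_apply {U : ℝ} {n : ℕ} (hn : (n : ℝ) ≤ U) :
    (1 - lowPart U moebiusReal * zetaReal) n = 0 := by
  have : (lowPart U moebiusReal * zetaReal) n = (moebiusReal * zetaReal) n := by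
    rw [ArithmeticFunction.mul_apply, ArithmeticFunction.mul_apply]
    refine Finset.sum_congr rfl fun x hx => ?_
    obtain ⟨hxn, hn0⟩ := Nat.mem_divisorsAntidiagonal.1 hx
    rw [lowPart_apply, if_pos]
    exact le_trans (by exact_mod_cast Nat.le_of_dvd (by omega) (Dvd.intro _ hxn)) hn
  rw [sub_eq_add_neg, ArithmeticFunction.add_apply, ArithmeticFunction.neg_apply, this,
    moebiusReal_mul_zetaReal, add_neg_cancel]

/-- Mean values of convolutions of the Möbius function with admissible factors. -/
theorem exists_hasMeanBound_moebius_mul (r : ℕ) : ∃ C : ℕ, ∀ U LL : ℝ, 1 ≤ U → 2 ≤ LL →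
    Real.log (U ^ 3) ≤ LL → ∀ l : List (ArithmeticFunction ℝ), l.length = r →
    (∀ f ∈ l, IsFactor U LL f) → HasMeanBound U LL C (moebiusReal * l.prod) := by
  obtain ⟨C₁, hC₁⟩ := exists_hasMeanBound_mul_list_prod r 1
  obtain ⟨C₂, hC₂⟩ := exists_hasMeanBound_mul_list_prod (r + 2) 1
  set k := r + 3 with hk
  set C₃ := 25 + 2 * 4 ^ k + 2 * k with hC₃
  refine ⟨max (max (max C₁ C₁ + 1) C₂ + 1) C₃ + 1, fun U LL hU hLL hUL l hl hlf => ?_⟩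
  have hLL1 : 1 ≤ LL := by linarith
  have hU12 : U ≤ U ^ 2 := by nlinarith
  set M := lowPart U moebiusReal with hM
  set R := l.prod with hR
  have hμb : DivisorBounded (U ^ 3) (LL ^ 0) 0 moebiusReal := fun n _ => by
    simpa using abs_moebiusReal_le n
  have hMb : DivisorBounded (U ^ 3) (LL ^ 0) 0 M := hμb.lowPart U
  have hRb : DivisorBounded (U ^ 3) (LL ^ r) r R := hl ▸ divisorBounded_list_prod hLL1 l hlf
  have hMs : ∀ n, M n ≠ 0 → (n : ℝ) ≤ U := fun n hn => le_of_lowPart_ne_zero hn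
  have hMf : IsFactor U LL M := by
    refine ⟨fun n hn => ?_, Or.inl fun n hn => (hMs n hn).trans hU12⟩
    have := hMb n hn
    simp only [pow_zero, mul_one] at this
    linarith
  have h1 : HasMeanBound U LL C₁ (M * R) :=
    hC₁ U LL hU hLL hUL l hl hlf M (hMb.mono_pow hLL1 (by omega) (by omega)) hMs
  -- One copy of `M` serves as the short function and the other as an admissible factor, so the list
  -- grows by two.
  have h2 : HasMeanBound U LL C₂ (M * (M * (zetaReal * R))) := by
    have := hC₂ U LL hU hLL hUL (M :: zetaReal :: l) (by simp [hl]) (by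
      intro f hf
      simp only [List.mem_cons] at hf
      rcases hf with rfl | rfl | hf
      · exact hMf
      · exact isFactor_zetaReal hLL1
      · exact hlf f hf) M (hMb.mono_pow hLL1 (by omega) (by omega)) hMs
    simpa only [List.prod_cons] using this
  have h3 : HasMeanBound U LL C₃ (highPart U moebiusReal * ((1 - M * zetaReal) * R)) := by
    have hb : DivisorBounded (U ^ 3) (LL ^ 1) 1 (1 - M * zetaReal) := by
      intro n hn
      have i1 := hMb.mul (by positivity)
        (isFactor_zetaReal (U := U) (LL := 1) le_rfl).divisorBounded n hn
      have i2 := (divisorBounded_one (Z := U ^ 3)) n hn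
      rw [sub_eq_add_neg, ArithmeticFunction.add_apply, ArithmeticFunction.neg_apply,
        ← sub_eq_add_neg]
      refine (abs_sub _ _).trans ?_
      rcases eq_or_ne n 0 with rfl | h0
      · simp [tau]
      · have := one_le_tau h0
        simp only [pow_zero, pow_one, mul_one, zero_add, one_mul] at i1 i2 ⊢
        nlinarith
    refine hasMeanBound_mul_of_support hU hLL hUL
      ((hμb.highPart U).mono_pow hLL1 (by omega) (by omega))
      (hb.mul_pow hLL1 hRb (by omega) (by omega)) ?_
    -- Both functions vanish on `[1, U]`, the second because `1 - M * ζ` does; with `uv ≤ U³` each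
    -- variable is then at most `U²`.
    intro u v huv hu hv
    refine ⟨?_, le_sq_of_mul_le_cube hU huv (lt_of_highPart_ne_zero hu)⟩
    refine le_sq_of_mul_le_cube (u := v) hU (by rwa [mul_comm]) ?_
    obtain ⟨a, b, rfl, ha, hb⟩ := exists_of_mul_apply_ne_zero hv
    have hb0 : 1 ≤ b := Nat.one_le_iff_ne_zero.2 fun h => by
      rw [h] at hb
      simp at hb
    have hUa : U < a := by
      by_contra h
      exact ha (one_sub_lowPart_mul_zeta_apply (not_lt.1 h))
    exact hUa.trans_le (by exact_mod_cast Nat.le_mul_of_pos_right a hb0)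
  have hall := ((h1.add hU hLL h1).add hU hLL h2.neg).add hU hLL h3
  refine hall.congr fun n _ => ?_
  congr 1
  have hhigh : highPart U moebiusReal = moebiusReal - M := by
    rw [eq_sub_iff_add_eq, add_comm, hM, lowPart_add_highPart]
  have hμζ := moebiusReal_mul_zetaReal
  rw [hhigh]
  -- With `M` the truncation of `μ` and `μ * ζ = 1`, the identity is `μ = 2M - M * M * ζ + (μ - M) *
  -- (1 - M * ζ)`, convolved with `R`.
  linear_combination (M * R) * hμζ

/-! ### The arithmetic weights -/

/-- From `n = ∑ φ(d)` over `d ∣ n`, where every `φ(d)` is at most `φ(n)`. -/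
theorem one_div_totient_le {n : ℕ} (hn : n ≠ 0) : 1 / (n.totient : ℝ) ≤ tau n / n := by
  have hφ : (0 : ℝ) < n.totient := by exact_mod_cast Nat.totient_pos.2 (Nat.pos_of_ne_zero hn)
  have hn0 : (0 : ℝ) < n := by exact_mod_cast Nat.pos_of_ne_zero hn
  rw [div_le_div_iff₀ hφ hn0, one_mul]
  have h : n ≤ n.divisors.card * n.totient := by
    calc n = ∑ d ∈ n.divisors, d.totient := (Nat.sum_totient n).symm
      _ ≤ ∑ d ∈ n.divisors, n.totient := Finset.sum_le_sum fun d hd =>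
          Nat.le_of_dvd (Nat.totient_pos.2 (Nat.pos_of_ne_zero hn))
            (Nat.totient_dvd_of_dvd (Nat.dvd_of_mem_divisors hd))
      _ = _ := by rw [Finset.sum_const, smul_eq_mul]
  rw [tau]
  exact_mod_cast h

/-- A nonzero `ψ(d/l)` makes `d/l` coprime to `q`, and `l ∣ k` is coprime to `q` as well. Hence `d`
is coprime to `q`, and `d ∣ kq` gives `d ∣ k`. -/
theorem delta_eq_zero {q k d : ℕ} (ψ : DirichletCharacter ℂ q) (hkq : Nat.Coprime k q)
    (hd : d ∣ k * q) (hdk : ¬ d ∣ k) : delta q k d ψ = 0 := by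
  refine Finset.sum_eq_zero fun l hl => ?_
  have hlg := Nat.dvd_of_mem_divisors hl
  have hld : l ∣ d := hlg.trans (Nat.gcd_dvd_left _ _)
  have hlk : l ∣ k := hlg.trans (Nat.gcd_dvd_right _ _)
  have hz : ψ ((d / l : ℕ) : ZMod q) = 0 := by
    refine MulChar.map_nonunit _ fun hu => hdk ?_
    have h1 : Nat.Coprime (d / l) q := (ZMod.isUnit_iff_coprime _ _).1 hu
    have h2 : Nat.Coprime l q := hkq.coprime_dvd_left hlk
    have h3 : Nat.Coprime d q := by
      rw [← Nat.mul_div_cancel' hld]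
      exact h2.mul_left h1
    exact h3.dvd_of_dvd_mul_right hd
  rw [hz]
  ring

/-- Supermultiplicativity of `φ` separates `φ(q)`, and `1/φ(k/l) ≤ τ(k) l/k` with `l ≤ d`. The
second factor `τ(k)` counts the terms. -/
theorem norm_delta_le {q k d : ℕ} (ψ : DirichletCharacter ℂ q) (hq : q ≠ 0) (hk : k ≠ 0)
    (hdk : d ∣ k) : ‖delta q k d ψ‖ ≤ tau k ^ 2 * d / (k * q.totient) := by
  have hk0 : (0 : ℝ) < k := by exact_mod_cast Nat.pos_of_ne_zero hk
  have hφ : (0 : ℝ) < q.totient := by exact_mod_cast Nat.totient_pos.2 (Nat.pos_of_ne_zero hq)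
  have hd0 : d ≠ 0 := ne_zero_of_dvd_ne_zero hk hdk
  have hμ : ∀ n : ℕ, ‖((moebius n : ℤ) : ℂ)‖ ≤ 1 := by
    intro n
    rw [Complex.norm_intCast]
    exact_mod_cast abs_moebius_le_one
  have hterm : ∀ l ∈ (Nat.gcd d k).divisors,
      ‖(moebius (d / l) : ℂ) / (Nat.totient (k * q / l) : ℂ)
        * (star ψ) (-((k / l : ℕ) : ZMod q)) * ψ ((d / l : ℕ) : ZMod q) * (moebius (k / l) : ℂ)‖
      ≤ tau k * d / (k * q.totient) := by
    intro l hl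
    have hlg := Nat.dvd_of_mem_divisors hl
    have hld : l ∣ d := hlg.trans (Nat.gcd_dvd_left _ _)
    have hlk : l ∣ k := hlg.trans (Nat.gcd_dvd_right _ _)
    have hl0 : 0 < l := Nat.pos_of_ne_zero (ne_zero_of_dvd_ne_zero hk hlk)
    have hlr : (0 : ℝ) < l := by exact_mod_cast hl0
    have hkl0 : k / l ≠ 0 := (Nat.div_pos (Nat.le_of_dvd (Nat.pos_of_ne_zero hk) hlk) hl0).ne'
    have hφ2 : (0 : ℝ) < (k / l).totient := by
      exact_mod_cast Nat.totient_pos.2 (Nat.pos_of_ne_zero hkl0)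
    have e : k * q / l = k / l * q := Nat.div_mul_right_comm hlk q |>.symm
    have h1 : ‖(Nat.totient (k * q / l) : ℂ)‖⁻¹ ≤ tau k * d / (k * q.totient) := by
      rw [Complex.norm_natCast, e]
      have h2 : ((k / l).totient : ℝ) * q.totient ≤ ((k / l * q).totient : ℝ) := by
        exact_mod_cast Nat.totient_super_multiplicative (k / l) q
      have h3 := one_div_totient_le hkl0
      have h4 : tau (k / l) ≤ tau k := tau_le_of_dvd hk (Nat.div_dvd_of_dvd hlk)
      have h5 : (l : ℝ) ≤ d := by exact_mod_cast Nat.le_of_dvd (Nat.pos_of_ne_zero hd0) hld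
      rw [Nat.cast_div hlk hlr.ne'] at h3
      have hτ := tau_nonneg k
      calc (((k / l * q).totient : ℝ))⁻¹ ≤ (((k / l).totient : ℝ) * q.totient)⁻¹ := by gcongr
        _ = (1 / ((k / l).totient : ℝ)) * (1 / q.totient) := by
            rw [mul_inv, one_div, one_div]
        _ ≤ (tau (k / l) / (k / l)) * (1 / q.totient) := by gcongr
        _ = tau (k / l) * l / (k * q.totient) := by field_simp
        _ ≤ _ := by gcongr
    have h2 : ‖(star ψ) (-((k / l : ℕ) : ZMod q))‖ ≤ 1 := DirichletCharacter.norm_le_one _ _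
    have h3 : ‖ψ ((d / l : ℕ) : ZMod q)‖ ≤ 1 := DirichletCharacter.norm_le_one _ _
    rw [norm_mul, norm_mul, norm_mul, norm_div, div_eq_mul_inv]
    calc _ ≤ 1 * (tau k * d / (k * q.totient)) * 1 * 1 * 1 := by
          have := tau_nonneg k
          gcongr
          · exact hμ _
          · exact hμ _
      _ = _ := by ring
  refine (norm_sum_le _ _).trans ((Finset.sum_le_sum hterm).trans ?_)
  rw [Finset.sum_const, nsmul_eq_mul]
  have h1 : ((Nat.gcd d k).divisors.card : ℝ) ≤ tau k :=
    tau_le_of_dvd hk (Nat.gcd_dvd_right _ _)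
  have := tau_nonneg k
  calc _ ≤ tau k * (tau k * d / (k * q.totient)) := by gcongr
    _ = _ := by ring

/-- The innermost sum in `sumLargeModuli`. -/
def innerSum (a : ArithmeticFunction ℝ) (T : ℝ) (k d q : ℕ) (ψ : DirichletCharacter ℂ q) : ℂ :=
  ∑ m ∈ Icc 1 ⌊(k * q : ℝ) * T / (2 * Real.pi * d)⌋₊, (a (m * d) : ℂ) * ψ (m : ZMod q)

/-- A nonzero `b(kq)` makes `kq` squarefree, hence `k` and `q` coprime, and the divisors of `kq`
reduce to those of `k`. -/
theorem norm_sum_divisors_delta_le {a b : ArithmeticFunction ℝ} {B T : ℝ}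
    (hb : ∀ n, |b n| ≤ B) (hbs : ∀ n, b n ≠ 0 → Squarefree n) {k q : ℕ} (hk : k ≠ 0) (hq : q ≠ 0)
    (ψ : DirichletCharacter ℂ q) :
    ‖(b (k * q) : ℂ) / ((k * q : ℕ) : ℂ) * ∑ d ∈ (k * q).divisors, delta q k d ψ *
        innerSum a T k d q ψ‖
      ≤ B * ∑ d ∈ k.divisors, tau k ^ 2 * d / k ^ 2 * (1 / (q * q.totient))
        * ‖innerSum a T k d q ψ‖ := by
  have hk0 : (0 : ℝ) < k := by exact_mod_cast Nat.pos_of_ne_zero hk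
  have hq0 : (0 : ℝ) < q := by exact_mod_cast Nat.pos_of_ne_zero hq
  have hB : 0 ≤ B := (abs_nonneg _).trans (hb 0)
  by_cases hz : b (k * q) = 0
  · rw [hz]
    simp only [Complex.ofReal_zero, zero_div, zero_mul, norm_zero]
    refine mul_nonneg hB (Finset.sum_nonneg fun d _ => ?_)
    positivity
  have hco : Nat.Coprime k q := Nat.coprime_of_squarefree_mul (hbs _ hz)
  have hsum : ‖∑ d ∈ (k * q).divisors, delta q k d ψ * innerSum a T k d q ψ‖
      ≤ ∑ d ∈ k.divisors, tau k ^ 2 * d / (k * q.totient) * ‖innerSum a T k d q ψ‖ := by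
    have e : ∑ d ∈ (k * q).divisors, delta q k d ψ * innerSum a T k d q ψ
        = ∑ d ∈ k.divisors, delta q k d ψ * innerSum a T k d q ψ := by
      symm
      refine Finset.sum_subset (Nat.divisors_subset_of_dvd (mul_ne_zero hk hq)
        (Dvd.intro _ rfl)) fun d hd hdk => ?_
      rw [delta_eq_zero ψ hco (Nat.dvd_of_mem_divisors hd)
        (fun h => hdk (Nat.mem_divisors.2 ⟨h, hk⟩)), zero_mul]
    rw [e]
    refine (norm_sum_le _ _).trans (Finset.sum_le_sum fun d hd => ?_)
    rw [norm_mul]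
    exact mul_le_mul_of_nonneg_right (norm_delta_le ψ hq hk (Nat.dvd_of_mem_divisors hd))
      (norm_nonneg _)
  rw [norm_mul, norm_div, Complex.norm_real, Complex.norm_natCast, Real.norm_eq_abs]
  calc |b (k * q)| / ((k * q : ℕ) : ℝ) * _
      ≤ B / ((k * q : ℕ) : ℝ) *
        ∑ d ∈ k.divisors, tau k ^ 2 * d / (k * q.totient) * ‖innerSum a T k d q ψ‖ := by
        gcongr
        exact hb _
    _ = _ := by
        rw [Finset.mul_sum, Finset.mul_sum]
        refine Finset.sum_congr rfl fun d _ => ?_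
        push_cast
        field_simp

/-! ### Summation over moduli, divisors and `k` -/

/-- Here `R` plays the part of `k/d`. Division by `Q^(3/2)` leaves `T/√Q`, `√T U`, `√T Q` and `U Q`;
only the first needs `Q` large, and it alone produces `√η`. -/
theorem meanBound_div_le {U T y η H R X : ℝ} {Q : ℕ} (hU : 0 ≤ U) (hT : 0 ≤ T) (hη : 0 < η)
    (hR : 1 ≤ R) (hQ : 1 ≤ Q) (hηQ : η ≤ 2 * Q) (hQy : (Q : ℝ) ≤ y) (hX : 0 ≤ X)
    (hXR : X ≤ R * Q * T) (h1 : √T * U ≤ H) (h2 : √T * y ≤ H) (h3 : U * y ≤ H) :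
    meanBound U X Q / (Q * √Q) ≤ 3 * (R * (T / √η + H)) := by
  have hQ0 : (0 : ℝ) < Q := by exact_mod_cast hQ
  have hs : 0 < √(Q : ℝ) := Real.sqrt_pos.2 hQ0
  have hs2 : √(Q : ℝ) * √Q = Q := Real.mul_self_sqrt hQ0.le
  have hsη : 0 < √η := Real.sqrt_pos.2 hη
  have hy : 0 ≤ y := hQ0.le.trans hQy
  have hsX : √X ≤ R * (√Q * √T) := by
    calc √X ≤ √(R ^ 2 * (Q * T)) := by
          refine Real.sqrt_le_sqrt (hXR.trans ?_)
          have : 0 ≤ R * Q * T := by positivity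
          nlinarith
      _ = _ := by
          rw [Real.sqrt_mul (by positivity), Real.sqrt_sq (by linarith), Real.sqrt_mul hQ0.le]
  have hηs : √η ≤ 2 * √Q := by
    rw [Real.sqrt_le_left (by positivity), mul_pow, Real.sq_sqrt hQ0.le]
    linarith
  have t1 : X ≤ (Q * √Q) * (2 * (R * (T / √η))) := by
    refine hXR.trans ?_
    have : 1 ≤ √Q * (2 / √η) := by
      rw [mul_div_assoc', one_le_div hsη]
      linarith
    calc R * Q * T ≤ R * Q * T * (√Q * (2 / √η)) := le_mul_of_one_le_right (by positivity) this
      _ = _ := by ring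
  have t2 : √X * U * Q ≤ (Q * √Q) * (R * H) := by
    calc √X * U * Q ≤ (R * (√Q * √T)) * U * Q := by gcongr
      _ = (Q * √Q) * (R * (√T * U)) := by ring
      _ ≤ _ := by gcongr
  have t3 : √X * Q ^ 2 ≤ (Q * √Q) * (R * H) := by
    calc √X * Q ^ 2 ≤ (R * (√Q * √T)) * Q ^ 2 := by gcongr
      _ = (Q * √Q) * (R * (√T * Q)) := by ring
      _ ≤ (Q * √Q) * (R * (√T * y)) := by gcongr
      _ ≤ _ := by gcongr
  have hH : 0 ≤ H := le_trans (by positivity) h1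
  have t4 : U * Q ^ 2 * √Q ≤ (Q * √Q) * (R * H) := by
    calc U * Q ^ 2 * √Q = (Q * √Q) * (U * Q) := by ring
      _ ≤ (Q * √Q) * (1 * (U * y)) := by
          rw [one_mul]
          gcongr
      _ ≤ _ := by gcongr
  rw [div_le_iff₀ (by positivity)]
  unfold meanBound
  have : 0 ≤ (Q * √Q) * (R * (T / √η)) := by positivity
  nlinarith

theorem innerSum_eq (a : ArithmeticFunction ℝ) (T : ℝ) (k d q : ℕ) (ψ : DirichletCharacter ℂ q) :
    innerSum a T k d q ψ = ∑ m ∈ Ioc 0 ⌊(k * q : ℝ) * T / (2 * Real.pi * d)⌋₊,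
      (a (m * d) : ℂ) * ψ (m : ZMod q) := by
  rw [innerSum, ← Finset.Icc_add_one_left_eq_Ioc, zero_add]

theorem charMean_innerSum_le {U LL T y η H : ℝ} {C : ℕ} {a : ArithmeticFunction ℝ} (hU : 1 ≤ U)
    (hLL : 2 ≤ LL) (hyT : U ^ 3 = y * T) (hT : 4 ≤ T) (hη : 1 ≤ η)
    (hy : 1 ≤ y) (h1 : √T * U ≤ H) (h2 : √T * y ≤ H) (h3 : U * y ≤ H)
    (ha : HasMeanBound U LL C a) {k d Q : ℕ} (hk : k ≠ 0) (hd : d ∣ k) (hQ2 : 2 ≤ Q)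
    (hkQ : (k : ℝ) * Q ≤ y) (hηQ : η ≤ 2 * Q) :
    charMean Q (fun q ψ => ‖innerSum a T k d q ψ‖) / (Q * √(Q : ℝ))
      ≤ LL ^ C * tau k ^ C * (3 * ((k : ℝ) / d * (T / √η + H))) := by
  have hd0 : d ≠ 0 := ne_zero_of_dvd_ne_zero hk hd
  have hd0r : (0 : ℝ) < d := by exact_mod_cast Nat.pos_of_ne_zero hd0
  have hk0r : (1 : ℝ) ≤ k := by exact_mod_cast Nat.pos_of_ne_zero hk
  have hdk : (d : ℝ) ≤ k := by exact_mod_cast Nat.le_of_dvd (Nat.pos_of_ne_zero hk) hd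
  have hR : 1 ≤ (k : ℝ) / d := by rwa [one_le_div hd0r]
  have hpi := Real.pi_gt_three
  have hH : 0 ≤ H := le_trans (by positivity) h1
  have hQ0 : (0 : ℝ) < Q := by exact_mod_cast (by omega : 0 < Q)
  have hQ2r : (2 : ℝ) ≤ Q := by exact_mod_cast hQ2
  have hQy : (Q : ℝ) ≤ y := (le_mul_of_one_le_left hQ0.le hk0r).trans hkQ
  -- The longest inner sum in the block, at `q = 2Q`. The conditions `Q ≥ 2` and `T ≥ 4` give `X ≥
  -- 1`, and `kQ ≤ y` gives `Xd ≤ yT = U³`.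
  obtain ⟨X, hX⟩ : ∃ X : ℝ, X = (k * (2 * Q) : ℝ) * T / (2 * Real.pi * d) := ⟨_, rfl⟩
  have hXe : X = (k : ℝ) / d * Q * T / Real.pi := by
    rw [hX]
    field_simp
  have hX1 : 1 ≤ X := by
    rw [hXe, le_div_iff₀ Real.pi_pos, one_mul]
    have h4 : 2 * 4 ≤ (k : ℝ) / d * Q * T := by
      have h5 : 1 * 2 ≤ (k : ℝ) / d * Q := mul_le_mul hR hQ2r (by norm_num) (by linarith)
      exact mul_le_mul (by linarith) hT (by norm_num) (by linarith)
    linarith [Real.pi_le_four]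
  have hXd : X * d ≤ U ^ 3 := by
    have e : X * d = (k * Q) * T / Real.pi := by
      rw [hXe]
      field_simp
    rw [e, hyT]
    have h5 : (k : ℝ) * Q * T ≤ y * T := mul_le_mul_of_nonneg_right hkQ (by linarith)
    exact (div_le_self (by positivity) (by linarith)).trans h5
  have hXR : X ≤ (k : ℝ) / d * Q * T := by
    rw [hXe]
    exact div_le_self (by positivity) (by linarith)
  have hQU : ((2 * Q : ℕ) : ℝ) ≤ U ^ 3 := by
    push_cast
    rw [hyT]
    nlinarith
  have hN : ∀ q : ℕ, q < 2 * Q →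
      ((⌊(k * q : ℝ) * T / (2 * Real.pi * d)⌋₊ : ℕ) : ℝ) ≤ X := by
    intro q hq
    refine (Nat.floor_le (by positivity)).trans ?_
    have : (q : ℝ) ≤ 2 * Q := by exact_mod_cast hq.le
    rw [hX]
    gcongr
  have hmean := ha Q d X (fun q => ⌊(k * q : ℝ) * T / (2 * Real.pi * d)⌋₊) hQ2 hQU (by omega) hX1
    hXd hN
  have hdiv := meanBound_div_le (U := U) (by linarith) (by linarith : 0 ≤ T) (by linarith : 0 < η)
    hR (by omega : 1 ≤ Q) hηQ hQy (by linarith : 0 ≤ X) hXR h1 h2 h3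
  have e : (fun (q : ℕ) (ψ : DirichletCharacter ℂ q) => ‖innerSum a T k d q ψ‖) =
      fun (q : ℕ) (ψ : DirichletCharacter ℂ q) =>
      ‖∑ m ∈ Ioc 0 ⌊(k * q : ℝ) * T / (2 * Real.pi * d)⌋₊, (a (m * d) : ℂ) * ψ (m : ZMod q)‖ := by
    funext q ψ
    rw [innerSum_eq]
  rw [e]
  have hτd := tau_nonneg d
  have hLL0 : 0 ≤ LL := by linarith
  calc _ ≤ LL ^ C * tau d ^ C * meanBound U X Q / (Q * √(Q : ℝ)) :=
        div_le_div_of_nonneg_right hmean (by positivity)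
    _ = LL ^ C * tau d ^ C * (meanBound U X Q / (Q * √(Q : ℝ))) := mul_div_assoc _ _ _
    _ ≤ LL ^ C * tau d ^ C * (3 * ((k : ℝ) / d * (T / √η + H))) :=
        mul_le_mul_of_nonneg_left hdiv (by positivity)
    _ ≤ _ := by
        have := pow_le_pow_left₀ hτd (tau_le_of_dvd hk hd) C
        refine mul_le_mul_of_nonneg_right (mul_le_mul_of_nonneg_left this (by positivity)) ?_
        have : 0 ≤ T := by linarith
        positivity

/-- The contribution of a fixed pair `k`, `d` to the sum over large moduli. -/
theorem sum_moduli_le {U LL T y η H : ℝ} {C : ℕ} {a : ArithmeticFunction ℝ} (hU : 1 ≤ U)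
    (hLL : 2 ≤ LL) (hUL : Real.log (U ^ 3) ≤ LL) (hyT : U ^ 3 = y * T) (hT : 4 ≤ T) (hη : 1 ≤ η)
    (hy : 1 ≤ y) (h1 : √T * U ≤ H) (h2 : √T * y ≤ H) (h3 : U * y ≤ H)
    (ha : HasMeanBound U LL C a) {k d : ℕ} (hk : k ≠ 0) (hd : d ∣ k) :
    ∑ q ∈ (Ioc ⌊η⌋₊ ⌊y⌋₊).filter (fun q => ((k * q : ℕ) : ℝ) ≤ y), 1 / (√(q : ℝ) * q.totient) *
        ∑ ψ ∈ primitiveCharacters q, ‖innerSum a T k d q ψ‖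
      ≤ LL ^ (C + 4) * tau k ^ C * ((k : ℝ) / d * (T / √η + H)) := by
  have hLL1 : 1 ≤ LL := by linarith
  have hH : 0 ≤ H := le_trans (by positivity) h1
  have hG : 0 ≤ (k : ℝ) / d * (T / √η + H) := by positivity
  set s := (Ioc ⌊η⌋₊ ⌊y⌋₊).filter (fun q => ((k * q : ℕ) : ℝ) ≤ y) with hs
  set f : ℕ → ℝ := fun q => 1 / (√(q : ℝ) * q.totient) *
        ∑ ψ ∈ primitiveCharacters q, ‖innerSum a T k d q ψ‖ with hf
  have hf0 : ∀ q, 0 ≤ f q := fun q => by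
    simp only [hf]
    exact mul_nonneg (by positivity) (Finset.sum_nonneg fun _ _ => norm_nonneg _)
  set J : ℕ := Nat.log 2 ⌊y⌋₊ + 1 with hJ
  have hyU : y ≤ U ^ 3 := by
    rw [hyT]
    nlinarith
  have hcard : (J : ℝ) ≤ LL ^ 2 := by
    have h1 : (Nat.log 2 ⌊y⌋₊ : ℝ) ≤ Real.logb 2 ⌊y⌋₊ := Real.natLog_le_logb _ _
    have h2 : Real.log ⌊y⌋₊ ≤ LL := log_natCast_le_of_le (by linarith) hUL
      ((Nat.floor_le (by positivity)).trans hyU)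
    have h3 : Real.logb 2 ⌊y⌋₊ ≤ LL * 1.5 := by
      rw [Real.logb, div_le_iff₀ (Real.log_pos one_lt_two)]
      nlinarith [Real.log_two_gt_d9]
    rw [hJ]
    push_cast
    nlinarith
  have hmaps : ∀ q ∈ s, Nat.log 2 q ∈ range J := by
    intro q hq
    simp only [hs, mem_filter, mem_Ioc] at hq
    rw [mem_range, hJ, Nat.lt_succ_iff]
    exact Nat.log_mono_right hq.1.2
  rw [← Finset.sum_fiberwise_of_maps_to hmaps]
  have hblock : ∀ j ∈ range J, ∑ q ∈ s with Nat.log 2 q = j, f q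
      ≤ LL ^ C * tau k ^ C * (3 * ((k : ℝ) / d * (T / √η + H))) := by
    intro j _
    have hτk := tau_nonneg k
    rcases (s.filter fun q => Nat.log 2 q = j).eq_empty_or_nonempty with he | ⟨q₀, hq₀⟩
    · rw [he, Finset.sum_empty]
      positivity
    simp only [hs, mem_filter, mem_Ioc] at hq₀
    obtain ⟨⟨⟨hq1, hq2⟩, hq3⟩, hq4⟩ := hq₀
    have hηq : η < q₀ := Nat.lt_of_floor_lt hq1
    -- The strict inequality `q > η ≥ 1` excludes the modulus one; this yields `Q ≥ 2`, without
    -- which Pólya–Vinogradov fails. A member of the block also gives `kQ ≤ y` and `η ≤ 2Q`.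
    have hq₀2 : 2 ≤ q₀ := by
      have : (1 : ℝ) < q₀ := hη.trans_lt hηq
      exact_mod_cast this
    obtain ⟨Q, hQ⟩ : ∃ Q : ℕ, Q = 2 ^ j := ⟨_, rfl⟩
    have hblk : ∀ q : ℕ, q ≠ 0 → Nat.log 2 q = j → Q ≤ q ∧ q < 2 * Q := by
      intro q hq0 hqj
      refine ⟨by rw [hQ, ← hqj]; exact Nat.pow_log_le_self 2 hq0, ?_⟩
      have := Nat.lt_pow_succ_log_self (b := 2) one_lt_two q
      rwa [hqj, pow_succ, mul_comm, ← hQ] at this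
    obtain ⟨hQq, hqQ⟩ := hblk q₀ (by omega) hq4
    have hQ2 : 2 ≤ Q := by
      have : 1 ≤ j := by
        rw [← hq4]
        exact Nat.log_pos one_lt_two hq₀2
      calc 2 = 2 ^ 1 := rfl
        _ ≤ Q := hQ ▸ Nat.pow_le_pow_right two_pos this
    have hkQ : (k : ℝ) * Q ≤ y := by
      refine le_trans ?_ hq3
      exact_mod_cast Nat.mul_le_mul_left k hQq
    have hηQ : η ≤ 2 * Q := by
      have : (q₀ : ℝ) ≤ 2 * Q := by exact_mod_cast hqQ.le
      linarith
    refine le_trans ?_ (charMean_innerSum_le hU hLL hyT hT hη hy h1 h2 h3 ha hk hd hQ2 hkQ hηQ)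
    -- Since `1/(√q φ(q)) = (q/φ(q)) q^(-3/2)`, the weight of the mean value appears after replacing
    -- `q^(3/2)` by the smaller `Q^(3/2)`.
    rw [charMean, Finset.sum_div]
    refine le_trans (Finset.sum_le_sum_of_subset_of_nonneg (t := Ico Q (2 * Q)) ?_
      fun q _ _ => hf0 q) (Finset.sum_le_sum fun q hq => ?_)
    · intro q hq
      simp only [hs, mem_filter, mem_Ioc] at hq
      exact mem_Ico.2 (hblk q (by omega) hq.2)
    · have hq := mem_Ico.1 hq
      have hQ0 : (0 : ℝ) < Q := by exact_mod_cast (by omega : 0 < Q)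
      have hq0 : (0 : ℝ) < q := by exact_mod_cast (by omega : 0 < q)
      have hQq : (Q : ℝ) ≤ q := by exact_mod_cast hq.1
      have hφ : (0 : ℝ) < q.totient := by exact_mod_cast Nat.totient_pos.2 (by omega)
      have hsq : 0 < √(q : ℝ) := Real.sqrt_pos.2 hq0
      have hsQ : 0 < √(Q : ℝ) := Real.sqrt_pos.2 hQ0
      simp only [hf]
      rw [mul_div_right_comm]
      refine mul_le_mul_of_nonneg_right ?_ (Finset.sum_nonneg fun _ _ => norm_nonneg _)
      rw [div_div, div_le_div_iff₀ (by positivity) (by positivity), one_mul]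
      have h5 : (Q : ℝ) * √Q ≤ q * √q :=
        mul_le_mul hQq (Real.sqrt_le_sqrt hQq) hsQ.le hq0.le
      calc q.totient * (Q * √Q) ≤ q.totient * (q * √(q : ℝ)) := mul_le_mul_of_nonneg_left h5 hφ.le
        _ = _ := by ring
  refine (Finset.sum_le_sum hblock).trans ?_
  rw [Finset.sum_const, card_range, nsmul_eq_mul]
  have hτk := tau_nonneg k
  have h3' : (3 : ℝ) ≤ LL ^ 2 := by nlinarith
  calc (J : ℝ) * (LL ^ C * tau k ^ C * (3 * ((k : ℝ) / d * (T / √η + H))))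
      ≤ LL ^ 2 * (LL ^ C * tau k ^ C * (LL ^ 2 * ((k : ℝ) / d * (T / √η + H)))) := by gcongr
    _ = _ := by ring

theorem norm_sumLargeModuli_le {U LL T y η H B : ℝ} {C : ℕ} {a b : ArithmeticFunction ℝ}
    (hU : 1 ≤ U) (hLL : 2 ≤ LL) (hUL : Real.log (U ^ 3) ≤ LL) (hyT : U ^ 3 = y * T) (hT : 4 ≤ T)
    (hη : 1 ≤ η) (hy : 1 ≤ y) (h1 : √T * U ≤ H) (h2 : √T * y ≤ H) (h3 : U * y ≤ H)
    (ha : HasMeanBound U LL C a) (hb : ∀ n, |b n| ≤ B) (hbs : ∀ n, b n ≠ 0 → Squarefree n) :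
    ‖sumLargeModuli a b η y T‖ ≤ B * (LL ^ (C + 4 + 2 * 2 ^ (C + 3)) * (T / √η + H)) := by
  have hB : 0 ≤ B := (abs_nonneg _).trans (hb 0)
  have hy0 : 0 ≤ y := by linarith
  have hH : 0 ≤ H := le_trans (by positivity) h1
  have hLL1 : 1 ≤ LL := by linarith
  have hlogy : Real.log ⌊y⌋₊ ≤ LL := log_natCast_le_of_le (by linarith) hUL
      ((Nat.floor_le hy0).trans (by rw [hyT]; nlinarith))
  set Y := ⌊y⌋₊ with hY
  set w : ℕ → ℕ → ℝ := fun k d => tau k ^ 2 * d / k ^ 2 with hw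
  have hw0 : ∀ k d, 0 ≤ w k d := fun k d => by simp only [hw]; positivity
  set g : ℕ → ℕ → ℕ → ℝ := fun q k d => 1 / (√(q : ℝ) * q.totient) *
    ∑ ψ ∈ primitiveCharacters q, ‖innerSum a T k d q ψ‖ with hg
  have hq : ∀ q ∈ Ioc ⌊η⌋₊ Y, ‖∑ ψ ∈ primitiveCharacters q, charGaussSum (star ψ) *
      ∑ k ∈ Finset.Icc 1 ⌊y / q⌋₊, (b (k * q) : ℂ) / ((k * q : ℕ) : ℂ) *
      ∑ d ∈ (k * q).divisors, delta q k d ψ * innerSum a T k d q ψ‖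
      ≤ B * ∑ k ∈ Ioc 0 Y, if ((k * q : ℕ) : ℝ) ≤ y then
        ∑ d ∈ k.divisors, w k d * g q k d else 0 := by
    intro q hq
    have hq0 : q ≠ 0 := by
      have := (mem_Ioc.1 hq).1
      omega
    have : NeZero q := ⟨hq0⟩
    have hqr : (0 : ℝ) < q := by exact_mod_cast Nat.pos_of_ne_zero hq0
    have hq1 : (1 : ℝ) ≤ q := by exact_mod_cast Nat.pos_of_ne_zero hq0
    -- Rewriting the range of `k` as the symmetric condition `kq ≤ y` allows the sums over `q` and
    -- `k` to be exchanged.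
    have hIcc : Icc 1 ⌊y / q⌋₊ = (Ioc 0 Y).filter (fun k => ((k * q : ℕ) : ℝ) ≤ y) := by
      ext k
      rw [mem_Icc, mem_filter, mem_Ioc, Nat.le_floor_iff (by positivity), le_div_iff₀ hqr,
        Nat.cast_mul, hY, Nat.le_floor_iff hy0]
      constructor
      · rintro ⟨i1, i2⟩
        exact ⟨⟨i1, (le_mul_of_one_le_right (Nat.cast_nonneg k) hq1).trans i2⟩, i2⟩
      · rintro ⟨⟨i1, -⟩, i2⟩
        exact ⟨i1, i2⟩
    have hψ : ∀ ψ ∈ primitiveCharacters q, ‖charGaussSum (star ψ) *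
        ∑ k ∈ Finset.Icc 1 ⌊y / q⌋₊, (b (k * q) : ℂ) / ((k * q : ℕ) : ℂ) *
        ∑ d ∈ (k * q).divisors, delta q k d ψ * innerSum a T k d q ψ‖
        ≤ √q * ∑ k ∈ Icc 1 ⌊y / q⌋₊, B * ∑ d ∈ k.divisors, w k d * (1 / (q * q.totient))
          * ‖innerSum a T k d q ψ‖ := by
      intro ψ hψ
      rw [norm_mul, norm_charGaussSum_star ((mem_primitiveCharacters ψ).1 hψ)]
      refine mul_le_mul_of_nonneg_left ?_ (Real.sqrt_nonneg _)
      refine (norm_sum_le _ _).trans (Finset.sum_le_sum fun k hk => ?_)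
      exact norm_sum_divisors_delta_le hb hbs (by have := (mem_Icc.1 hk).1; omega) hq0 ψ
    refine (norm_sum_le _ _).trans ((Finset.sum_le_sum hψ).trans (le_of_eq ?_))
    rw [← Finset.sum_filter, ← hIcc, ← Finset.mul_sum, Finset.sum_comm, Finset.mul_sum,
      Finset.mul_sum]
    refine Finset.sum_congr rfl fun k _ => ?_
    rw [← Finset.mul_sum, Finset.sum_comm, mul_left_comm, Finset.mul_sum]
    congr 1
    refine Finset.sum_congr rfl fun d _ => ?_
    have hs : √(q : ℝ) * √q = q := Real.mul_self_sqrt hqr.le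
    have hs0 : 0 < √(q : ℝ) := Real.sqrt_pos.2 hqr
    have hφ : (0 : ℝ) < q.totient := by exact_mod_cast Nat.totient_pos.2 (Nat.pos_of_ne_zero hq0)
    simp only [hg]
    rw [← Finset.mul_sum]
    have e : √(q : ℝ) * (1 / (q * q.totient)) = 1 / (√(q : ℝ) * q.totient) := by
      rw [mul_one_div, div_eq_div_iff (by positivity) (by positivity)]
      linear_combination (q.totient : ℝ) * hs
    rw [← e]
    ring
  have hswap : ∑ q ∈ Ioc ⌊η⌋₊ Y, ∑ k ∈ Ioc 0 Y, (if ((k * q : ℕ) : ℝ) ≤ y then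
        ∑ d ∈ k.divisors, w k d * g q k d else 0)
      = ∑ k ∈ Ioc 0 Y, ∑ d ∈ k.divisors, w k d *
        ∑ q ∈ (Ioc ⌊η⌋₊ Y).filter (fun q => ((k * q : ℕ) : ℝ) ≤ y), g q k d := by
    rw [Finset.sum_comm]
    refine Finset.sum_congr rfl fun k _ => ?_
    rw [← Finset.sum_filter, Finset.sum_comm]
    exact Finset.sum_congr rfl fun d _ => by rw [Finset.mul_sum]
  have hk : ∀ k ∈ Ioc 0 Y, ∑ d ∈ k.divisors, w k d *
        ∑ q ∈ (Ioc ⌊η⌋₊ Y).filter (fun q => ((k * q : ℕ) : ℝ) ≤ y), g q k d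
      ≤ LL ^ (C + 4) * (T / √η + H) * (tau k ^ (C + 3) / k) := by
    intro k hk
    have hk0 : k ≠ 0 := by
      have := (mem_Ioc.1 hk).1
      omega
    have hkr : (0 : ℝ) < k := by exact_mod_cast Nat.pos_of_ne_zero hk0
    -- The weight `τ(k)² d/k²` turns the loss `k/d` into `τ(k)²/k`, independent of `d`; counting the
    -- divisors then adds one more factor `τ(k)`.
    have : ∀ d ∈ k.divisors, w k d *
        ∑ q ∈ (Ioc ⌊η⌋₊ Y).filter (fun q => ((k * q : ℕ) : ℝ) ≤ y), g q k d
        ≤ LL ^ (C + 4) * (T / √η + H) * (tau k ^ (C + 2) / k) := by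
      intro d hd
      have hd' := Nat.dvd_of_mem_divisors hd
      have hd0 : (0 : ℝ) < d := by
        exact_mod_cast Nat.pos_of_ne_zero (ne_zero_of_dvd_ne_zero hk0 hd')
      refine (mul_le_mul_of_nonneg_left
        (sum_moduli_le hU hLL hUL hyT hT hη hy h1 h2 h3 ha hk0 hd') (hw0 k d)).trans (le_of_eq ?_)
      simp only [hw]
      field_simp
      ring
    refine (Finset.sum_le_sum this).trans (le_of_eq ?_)
    rw [Finset.sum_const, nsmul_eq_mul]
    change tau k * _ = _
    ring
  calc ‖sumLargeModuli a b η y T‖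
      ≤ ∑ q ∈ Ioc ⌊η⌋₊ Y, B * ∑ k ∈ Ioc 0 Y, (if ((k * q : ℕ) : ℝ) ≤ y then
        ∑ d ∈ k.divisors, w k d * g q k d else 0) :=
        (norm_sum_le _ _).trans (Finset.sum_le_sum hq)
    _ ≤ B * ∑ k ∈ Ioc 0 Y, LL ^ (C + 4) * (T / √η + H) * (tau k ^ (C + 3) / k) := by
        rw [← Finset.mul_sum, hswap]
        exact mul_le_mul_of_nonneg_left (Finset.sum_le_sum hk) hB
    _ ≤ B * (LL ^ (C + 4) * (T / √η + H) * (LL ^ 2) ^ (2 ^ (C + 3))) := by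
        rw [← Finset.mul_sum]
        have i1 := sum_tau_pow_div_le (C + 3) Y
        have i2 : 0 ≤ Real.log Y := Real.log_natCast_nonneg Y
        have i3 : 1 + Real.log Y ≤ LL ^ 2 := by nlinarith
        have i4 : (1 + Real.log (Y : ℝ)) ^ (2 ^ (C + 3)) ≤ (LL ^ 2) ^ (2 ^ (C + 3)) := by gcongr
        have i5 := i1.trans i4
        gcongr
    _ = _ := by
        rw [← pow_mul LL 2, pow_add LL (C + 4)]
        ring

/-! ### The coefficients of the problem and the choice of parameters -/

theorem coeffOne_eq : coeffOne = moebiusReal * [log, log].prod := by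
  rw [coeffOne, ← moebius_mul_log_eq_vonMangoldt, List.prod_cons, List.prod_singleton, mul_assoc]
  rfl

theorem coeffTwo_eq (P : Polynomial ℝ) (y : ℝ) :
    coeffTwo P y = -(moebiusReal * [log, log, log, mollifierCoeff P y].prod) := by
  rw [coeffTwo, ← moebius_mul_log_eq_vonMangoldt]
  simp only [List.prod_cons, List.prod_nil, mul_one, mul_assoc]
  rfl

theorem mollifierCoeff_apply (P : Polynomial ℝ) (y : ℝ) (k : ℕ) :
    mollifierCoeff P y k = if (k : ℝ) ≤ y then
      (moebius k : ℝ) * P.eval (Real.log (y / k) / Real.log y) else 0 := rfl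

theorem abs_mollifierCoeff_le {P : Polynomial ℝ} {y B : ℝ}
    (hB : ∀ x ∈ Set.Icc (0 : ℝ) 1, |P.eval x| ≤ B) (n : ℕ) : |mollifierCoeff P y n| ≤ B := by
  have hB0 : 0 ≤ B := (abs_nonneg _).trans (hB 0 ⟨le_rfl, zero_le_one⟩)
  rw [mollifierCoeff_apply]
  split_ifs with h
  · rcases Nat.eq_zero_or_pos n with rfl | hn
    · simpa using hB0
    have hn1 : (1 : ℝ) ≤ n := by exact_mod_cast hn
    have hy1 : 1 ≤ y := hn1.trans h
    have hx : Real.log (y / n) / Real.log y ∈ Set.Icc (0 : ℝ) 1 := by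
      have h0 : 0 ≤ Real.log (y / n) := Real.log_nonneg ((one_le_div (by linarith)).2 h)
      have h1 : Real.log (y / n) ≤ Real.log y :=
        Real.log_le_log (by positivity) (div_le_self (by linarith) hn1)
      exact ⟨div_nonneg h0 (h0.trans h1), div_le_one_of_le₀ h1 (h0.trans h1)⟩
    have hμ : |(moebius n : ℝ)| ≤ 1 := by exact_mod_cast abs_moebius_le_one
    rw [abs_mul]
    calc |(moebius n : ℝ)| * _ ≤ 1 * B := mul_le_mul hμ (hB _ hx) (abs_nonneg _) zero_le_one
      _ = B := one_mul B
  · simpa using hB0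

theorem squarefree_of_mollifierCoeff_ne_zero {P : Polynomial ℝ} {y : ℝ} {n : ℕ}
    (h : mollifierCoeff P y n ≠ 0) : Squarefree n := by
  rw [mollifierCoeff_apply] at h
  split_ifs at h
  · exact moebius_ne_zero_iff_squarefree.1 (by exact_mod_cast left_ne_zero_of_mul h)
  · exact absurd rfl h

theorem le_of_mollifierCoeff_ne_zero {P : Polynomial ℝ} {y : ℝ} {n : ℕ}
    (h : mollifierCoeff P y n ≠ 0) : (n : ℝ) ≤ y := by
  rw [mollifierCoeff_apply] at h
  split_ifs at h with hn
  · exact hn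
  · exact absurd rfl h

theorem log_le_two_mul_logT {T : ℝ} (hT : Real.exp 4 ≤ T) : Real.log T ≤ 2 * logT T := by
  have hT0 : 0 < T := (Real.exp_pos 4).trans_le hT
  have h1 : 4 ≤ Real.log T := (Real.le_log_iff_exp_le hT0).2 hT
  have h2 : Real.log (2 * Real.pi) ≤ 2 := by
    rw [Real.log_le_iff_le_exp (by positivity), show (2 : ℝ) = 1 + 1 by norm_num, Real.exp_add]
    nlinarith [Real.exp_one_gt_d9, Real.pi_lt_d2]
  rw [logT, Real.log_div hT0.ne' (by positivity)]
  linarith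

/-- From `log T ≤ T^δ/δ` with `δ = ε/D`. -/
theorem two_mul_log_pow_le {T ε : ℝ} (hT : 1 ≤ T) (hε : 0 < ε) {D : ℕ} (hD : D ≠ 0) :
    (2 * Real.log T) ^ D ≤ (2 * (D / ε)) ^ D * T ^ ε := by
  have hD0 : (0 : ℝ) < D := by exact_mod_cast Nat.pos_of_ne_zero hD
  have h := Real.log_le_rpow_div (by linarith : 0 ≤ T) (div_pos hε hD0)
  have hlog := Real.log_nonneg hT
  calc (2 * Real.log T) ^ D ≤ (2 * (T ^ (ε / D) / (ε / D))) ^ D := by gcongr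
    _ = (2 * (D / ε)) ^ D * (T ^ (ε / D)) ^ D := by
        rw [← mul_pow]
        congr 1
        field_simp
    _ = _ := by rw [← Real.rpow_mul_natCast (by linarith), div_mul_cancel₀ _ hD0.ne']

/-- With `U = (yT)^(1/3)`, the product `√T U` equals `y^(1/3) T^(5/6)`, and the other two quantities
are below it because `y ≤ √T`. The power of the logarithm is absorbed in `T^ε` on this term but kept
as a power of `logT T` on the other, so the exponent `D` does not depend on `ε`. -/
theorem norm_sumLargeModuli_mollifierCoeff_le {P : Polynomial ℝ} {B T y η ε : ℝ} {C D : ℕ}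
    {a : ArithmeticFunction ℝ} (hB : ∀ x ∈ Set.Icc (0 : ℝ) 1, |P.eval x| ≤ B) (hε : 0 < ε)
    (hT : Real.exp 4 ≤ T) (hy : 1 ≤ y) (hyT : y ≤ √T) (hη : 1 ≤ η)
    (hD : C + 4 + 2 * 2 ^ (C + 3) ≤ D)
    (ha : HasMeanBound ((y * T) ^ (1 / 3 : ℝ)) (2 * Real.log T) C a) :
    ‖sumLargeModuli a (mollifierCoeff P y) η y T‖ ≤ B * ((2 * (D / ε)) ^ D + 4 ^ D) *
      (y ^ (1 / 3 : ℝ) * T ^ (5 / 6 + ε) + η ^ (-(1 / 2) : ℝ) * T * logT T ^ D) := by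
  have hB0 : 0 ≤ B := (abs_nonneg _).trans (hB 0 ⟨le_rfl, zero_le_one⟩)
  have hT0 : 0 < T := (Real.exp_pos 4).trans_le hT
  have hy0 : 0 < y := by linarith
  have hlog : 4 ≤ Real.log T := (Real.le_log_iff_exp_le hT0).2 hT
  have hT4 : 4 ≤ T := by linarith [Real.add_one_le_exp (4 : ℝ)]
  have hU3 : ((y * T) ^ (1 / 3 : ℝ)) ^ 3 = y * T := by
    rw [← Real.rpow_mul_natCast (by positivity)]
    norm_num
  have hU1 : 1 ≤ (y * T) ^ (1 / 3 : ℝ) := Real.one_le_rpow (by nlinarith) (by norm_num)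
  have hsT : √T = T ^ (1 / 2 : ℝ) := Real.sqrt_eq_rpow T
  have hyT2 : y ≤ T ^ (1 / 2 : ℝ) := hsT ▸ hyT
  have hlogU : Real.log (((y * T) ^ (1 / 3 : ℝ)) ^ 3) ≤ 2 * Real.log T := by
    rw [hU3, Real.log_mul hy0.ne' hT0.ne']
    have := Real.log_le_log hy0 hyT
    rw [Real.log_sqrt hT0.le] at this
    linarith
  have hUe : (y * T) ^ (1 / 3 : ℝ) = y ^ (1 / 3 : ℝ) * T ^ (1 / 3 : ℝ) :=
    Real.mul_rpow hy0.le hT0.le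
  have e1 : T ^ (1 / 2 : ℝ) * T ^ (1 / 3 : ℝ) = T ^ (5 / 6 : ℝ) := by
    rw [← Real.rpow_add hT0]
    norm_num
  have h1 : √T * (y * T) ^ (1 / 3 : ℝ) ≤ y ^ (1 / 3 : ℝ) * T ^ (5 / 6 : ℝ) := by
    rw [hsT, hUe, ← e1]
    exact le_of_eq (by ring)
  have h2 : √T * y ≤ y ^ (1 / 3 : ℝ) * T ^ (5 / 6 : ℝ) := by
    have i1 : y = y ^ (1 / 3 : ℝ) * y ^ (2 / 3 : ℝ) := by
      rw [← Real.rpow_add hy0]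
      norm_num
    have i2 : y ^ (2 / 3 : ℝ) ≤ T ^ (1 / 3 : ℝ) := by
      calc y ^ (2 / 3 : ℝ) ≤ (T ^ (1 / 2 : ℝ)) ^ (2 / 3 : ℝ) := by gcongr
        _ = T ^ (1 / 3 : ℝ) := by
          rw [← Real.rpow_mul hT0.le]
          norm_num
    calc √T * y = T ^ (1 / 2 : ℝ) * (y ^ (1 / 3 : ℝ) * y ^ (2 / 3 : ℝ)) := by rw [← i1, hsT]
      _ ≤ T ^ (1 / 2 : ℝ) * (y ^ (1 / 3 : ℝ) * T ^ (1 / 3 : ℝ)) := by gcongr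
      _ = _ := by rw [← e1]; ring
  have h3 : (y * T) ^ (1 / 3 : ℝ) * y ≤ y ^ (1 / 3 : ℝ) * T ^ (5 / 6 : ℝ) := by
    calc (y * T) ^ (1 / 3 : ℝ) * y ≤ (y * T) ^ (1 / 3 : ℝ) * √T := by gcongr
      _ = √T * (y * T) ^ (1 / 3 : ℝ) := mul_comm _ _
      _ ≤ _ := h1
  have hmain := norm_sumLargeModuli_le (b := mollifierCoeff P y) hU1 (by linarith) hlogU hU3 hT4 hη hy h1 h2 h3 ha
    (abs_mollifierCoeff_le hB) (fun n hn => squarefree_of_mollifierCoeff_ne_zero hn)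
  have hηs : T / √η = η ^ (-(1 / 2) : ℝ) * T := by
    rw [Real.rpow_neg (by linarith), ← Real.sqrt_eq_rpow, div_eq_inv_mul]
  have hLLD : (2 * Real.log T) ^ (C + 4 + 2 * 2 ^ (C + 3)) ≤ (2 * Real.log T) ^ D :=
    pow_le_pow_right₀ (by linarith) hD
  have hA := two_mul_log_pow_le (by linarith : 1 ≤ T) hε (by omega : D ≠ 0)
  have hl := log_le_two_mul_logT hT
  have hL0 : 0 ≤ logT T := by linarith
  have hB' : (2 * Real.log T) ^ D ≤ 4 ^ D * logT T ^ D := by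
    rw [← mul_pow]
    exact pow_le_pow_left₀ (by linarith) (by linarith) D
  have hG : 0 ≤ η ^ (-(1 / 2) : ℝ) * T := by positivity
  have hH : 0 ≤ y ^ (1 / 3 : ℝ) * T ^ (5 / 6 : ℝ) := by positivity
  refine hmain.trans ?_
  rw [mul_assoc B]
  refine mul_le_mul_of_nonneg_left ?_ hB0
  rw [hηs]
  refine (mul_le_mul_of_nonneg_right hLLD (by positivity)).trans ?_
  rw [mul_add]
  have j1 := mul_le_mul_of_nonneg_right hB' hG
  have j2 := mul_le_mul_of_nonneg_right hA hH
  have e2 : (2 * (D / ε)) ^ D * T ^ ε * (y ^ (1 / 3 : ℝ) * T ^ (5 / 6 : ℝ))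
      = (2 * (D / ε)) ^ D * (y ^ (1 / 3 : ℝ) * T ^ (5 / 6 + ε)) := by
    rw [Real.rpow_add hT0]
    ring
  rw [e2] at j2
  have k1 : 0 ≤ (4 : ℝ) ^ D * (y ^ (1 / 3 : ℝ) * T ^ (5 / 6 + ε)) := by positivity
  have k2 : 0 ≤ (2 * (D / ε)) ^ D * (η ^ (-(1 / 2) : ℝ) * T * logT T ^ D) := by positivity
  calc _ ≤ _ := add_le_add j1 j2
    _ ≤ _ := by linarith

end

end SimpleZeros

theorem lemma2 :
    ∃ C : ℝ, 0 < C ∧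
      ∀ P : Polynomial ℝ, P.eval 0 = 0 → P.eval 1 = 1 →
      ∀ ε : ℝ, 0 < ε →
      ∃ K T₀ : ℝ, ∀ A : ℝ, 0 < A → ∀ ϑ : ℝ, 0 < ϑ → ϑ < 1 / 2 → ∀ T : ℝ, T₀ ≤ T →
      ∀ y η : ℝ, y = T ^ ϑ → η = SimpleZeros.logT T ^ A →
        ‖SimpleZeros.MOneThree P η y T‖ ≤
            K * (y ^ (1 / 3 : ℝ) * T ^ (5 / 6 + ε)
              + η ^ (-(1 / 2) : ℝ) * T * SimpleZeros.logT T ^ C) ∧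
        ‖SimpleZeros.MTwoThree P η y T‖ ≤
            K * (y ^ (1 / 3 : ℝ) * T ^ (5 / 6 + ε)
              + η ^ (-(1 / 2) : ℝ) * T * SimpleZeros.logT T ^ C) := by
  obtain ⟨C₁, hC₁⟩ := SimpleZeros.exists_hasMeanBound_moebius_mul 2
  obtain ⟨C₂, hC₂⟩ := SimpleZeros.exists_hasMeanBound_moebius_mul 4
  -- The sum of the two exponents dominates each, so one constant serves both coefficient sequences;
  -- it is fixed before `P` and `ε`.
  obtain ⟨D, hD⟩ : ∃ D : ℕ, D = (C₁ + 4 + 2 * 2 ^ (C₁ + 3)) + (C₂ + 4 + 2 * 2 ^ (C₂ + 3)) :=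
    ⟨_, rfl⟩
  refine ⟨D, by exact_mod_cast (by omega : 0 < D), fun P _ _ ε hε => ?_⟩
  obtain ⟨B, hB⟩ := isCompact_Icc.exists_bound_of_continuousOn (s := Set.Icc (0 : ℝ) 1)
    P.continuous.continuousOn
  -- The threshold `e^4` makes `log T ≤ 2 logT T` and `η ≥ 1`; `e^B` makes the mollifier
  -- coefficients at most `log T`, so that the mollifier is an admissible factor. Neither depends on
  -- `A` or `ϑ`.
  refine ⟨B * ((2 * (D / ε)) ^ D + 4 ^ D), max (Real.exp 4) (Real.exp B), ?_⟩
  intro A hA ϑ hϑ hϑ2 T hT y η hy hη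
  have hT4 : Real.exp 4 ≤ T := (le_max_left _ _).trans hT
  have hT0 : 0 < T := (Real.exp_pos 4).trans_le hT4
  have hlog : 4 ≤ Real.log T := (Real.le_log_iff_exp_le hT0).2 hT4
  have hlogB : B ≤ Real.log T := (Real.le_log_iff_exp_le hT0).2 ((le_max_right _ _).trans hT)
  have hT1 : 1 ≤ T := by linarith [Real.add_one_le_exp (4 : ℝ)]
  have hy1 : 1 ≤ y := hy ▸ Real.one_le_rpow hT1 hϑ.le
  have hyT : y ≤ √T := by
    rw [hy, Real.sqrt_eq_rpow]
    exact Real.rpow_le_rpow_of_exponent_le hT1 hϑ2.le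
  have hη1 : 1 ≤ η :=
    hη ▸ Real.one_le_rpow (by linarith [SimpleZeros.log_le_two_mul_logT hT4]) hA.le
  have hU1 : 1 ≤ (y * T) ^ (1 / 3 : ℝ) := Real.one_le_rpow (by nlinarith) (by norm_num)
  have hU3 : ((y * T) ^ (1 / 3 : ℝ)) ^ 3 = y * T := by
    rw [← Real.rpow_mul_natCast (by positivity)]
    norm_num
  have hlogU : Real.log (((y * T) ^ (1 / 3 : ℝ)) ^ 3) ≤ 2 * Real.log T := by
    rw [hU3, Real.log_mul (by positivity) hT0.ne']
    have := Real.log_le_log (by linarith) hyT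
    rw [Real.log_sqrt hT0.le] at this
    linarith
  -- From `y² ≤ T` one gets `y³ ≤ yT`, so `y ≤ U` and a fortiori `y ≤ U²`: the mollifier counts as a
  -- factor of short support.
  have hyU : y ≤ ((y * T) ^ (1 / 3 : ℝ)) ^ 2 := by
    have h1 : y ≤ (y * T) ^ (1 / 3 : ℝ) := by
      refine le_of_pow_le_pow_left₀ three_ne_zero (by linarith) ?_
      rw [hU3]
      have h2 : y ^ 2 ≤ T := (Real.le_sqrt (by linarith) hT0.le).1 hyT
      calc y ^ 3 = y * y ^ 2 := by ring
        _ ≤ y * T := mul_le_mul_of_nonneg_left h2 (by linarith)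
    nlinarith
  have hlogF := SimpleZeros.isFactor_log (U := (y * T) ^ (1 / 3 : ℝ)) (by linarith) hlogU
  have hbF : SimpleZeros.IsFactor ((y * T) ^ (1 / 3 : ℝ)) (2 * Real.log T)
      (SimpleZeros.mollifierCoeff P y) :=
    ⟨fun n _ => (SimpleZeros.abs_mollifierCoeff_le hB n).trans (by linarith),
      Or.inl fun n hn => (SimpleZeros.le_of_mollifierCoeff_ne_zero hn).trans hyU⟩
  have ha₁ := hC₁ _ (2 * Real.log T) hU1 (by linarith) hlogU
    [ArithmeticFunction.log, ArithmeticFunction.log] rfl (by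
      simp only [List.mem_cons, List.not_mem_nil, or_false]
      rintro f (rfl | rfl) <;> assumption)
  have ha₂ := (hC₂ _ (2 * Real.log T) hU1 (by linarith) hlogU
    [ArithmeticFunction.log, ArithmeticFunction.log, ArithmeticFunction.log,
      SimpleZeros.mollifierCoeff P y] rfl (by
      simp only [List.mem_cons, List.not_mem_nil, or_false]
      rintro f (rfl | rfl | rfl | rfl) <;> assumption)).neg
  rw [← SimpleZeros.coeffOne_eq] at ha₁
  rw [← SimpleZeros.coeffTwo_eq] at ha₂
  rw [Real.rpow_natCast]
  exact ⟨SimpleZeros.norm_sumLargeModuli_mollifierCoeff_le hB hε hT4 hy1 hyT hη1 (by omega) ha₁,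
    SimpleZeros.norm_sumLargeModuli_mollifierCoeff_le hB hε hT4 hy1 hyT hη1 (by omega) ha₂⟩
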